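/- **Conventions.** $\kappa$ is the security parameter; all objects are encoded as finite binary trees. A (probabilistic) polynomial-time algorithm is a step-counted program (with polynomially many uniform random bits); every algorithm gets $1^\kappa$. A *QPT adversary* is a polynomially bounded, possibly non-uniform quantum machine: a classical polynomial-time control that applies Hadamard, $T$ and CNOT gates and measurements to polynomially many qubits, tosses coins, and exchanges classical messages with a challenger; for each $\kappa$ it has a classical and a quantum advice of polynomial length. $f$ is negligible if for every $c$, $f(\kappa)<\kappa^{-c}$ for all large $\kappa$. Two experiments are indistinguishable if for every QPT adversary the difference of the probabilities that it outputs $1$ is negligible in absolute value. **Ingredients.** * Attribute spaces $\mathcal X_\kappa$ and policy spaces $\mathcal P_\kappa$, recognizable in polynomial time, with policies $P(X)\in\{\top,\bot\}$ evaluated in polynomial time; a plaintext length $\ell=\ell(\kappa)$ such that $1^\kappa\mapsto 1^{\ell(\kappa)}$ is computable in polynomial time (for example, any polynomial). * A key-policy ABE scheme $\mathsf{ABE}=(\mathsf{Setup},\mathsf{KeyGen},\mathsf{Enc},\mathsf{Dec})$ for $\mathcal X,\mathcal P$ with plaintext space $\{0,1\}$, where $\mathsf{Setup},\mathsf{KeyGen},\mathsf{Enc}$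 are PPT and $\mathsf{Dec}$ is deterministic polynomial time. It is *perfectly correct*: for all $\kappa$, $P\in\mathcal P_\kappa$, $X\in\mathcal X_\kappa$ and $m$, with probability $1$ over honest $(pk,msk),sk_P,CT_X$, $\mathsf{Dec}(sk_P,CT_X)=m$ if $P(X)=\top$, and $\mathsf{Dec}(sk_P,CT_X)=\bot$ if $P(X)=\bot$. It is (adaptively) *IND-CPA secure*: given $pk$, the adversary adaptively queries keys for policies before and after its single challenge $(X^*,m_0,m_1)$ and gets $\mathsf{Enc}(pk,X^*,m_b)$, where $P(X^*)=\bot$ is enforced for all queried policies (an illegal query is answered by $\bot$); the experiments for $b=0,1$ are indistinguishable. * A secure indistinguishability obfuscator $i\mathcal O$ for $\mathrm P/\mathrm{poly}$: a PPT algorithm such that $i\mathcal O(1^\kappa,C)$ is, with probability $1$, a circuit computing the same function as the Boolean circuit $C$, and for every polynomial $p$ and all families $C_{0,\kappa},C_{1,\kappa}$ of circuits of equal size at most $p(\kappa)$ computing the same function, $i\mathcal O(1^\kappa,C_{0,\kappa})$ and $i\mathcal O(1^\kappa,C_{1,\kappa})$ are indistinguishable. * A NIZK proof system $(\mathsf{NIZK.Setup},\mathsf{Prove},\mathsf{Vrfy})$,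 with $\mathsf{NIZK.Setup},\mathsf{Prove}$ PPT and $\mathsf{Vrfy}$ deterministic polynomial time, and a PPT simulator $(\mathsf{Sim}_1,\mathsf{Sim}_2)$, for the $\mathrm{NP}$ relation $R$ of all pairs $((\{pk_{i,b}\},\{CT_{i,b}\},X),(m,\{r_{i,b}\}))$, $i\in[\ell]$, $b\in\{0,1\}$, with $X\in\mathcal X_\kappa$ and $CT_{i,b}=\mathsf{Enc}(pk_{i,b},X,m[i];r_{i,b})$ for all $i,b$. It is perfectly complete; statistically sound (an unbounded adversary given $crs\leftarrow\mathsf{NIZK.Setup}(1^\kappa)$ outputs a false statement with an accepted proof only with negligible probability); and computationally zero-knowledge: a QPT adversary that is given $crs$ and then chooses one $(x,w)\in R$ cannot distinguish $crs\leftarrow\mathsf{NIZK.Setup}(1^\kappa)$, $\pi\leftarrow\mathsf{Prove}(crs,x,w)$ from $(crs,td)\leftarrow\mathsf{Sim}_1(1^\kappa)$, $\pi\leftarrow\mathsf{Sim}_2(crs,td,x)$. **Construction of $\Sigma$** (plaintext space $\{0,1\}^{\ell}$). * $\mathsf{Setup}(1^\kappa)$: $(pk_{i,b},msk_{i,b})\leftarrow\mathsf{ABE.Setup}(1^\kappa)$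 for $i\in[\ell]$, $b\in\{0,1\}$; $z\leftarrow\{0,1\}^\ell$; $crs\leftarrow\mathsf{NIZK.Setup}(1^\kappa)$; output $pk=(\{pk_{i,b}\},crs)$ and $msk=(pk,\{msk_{i,z[i]}\},z)$. * $\mathsf{KeyGen}(msk,P)$: $sk_i\leftarrow\mathsf{ABE.KeyGen}(msk_{i,z[i]},P)$; output $i\mathcal O(1^\kappa,\mathsf D[pk,\{sk_i\},z])$. * $\mathsf{Enc}(pk,X,m)$: $CT_{i,b}=\mathsf{ABE.Enc}(pk_{i,b},X,m[i];r_{i,b})$ with random $r_{i,b}$; $\pi\leftarrow\mathsf{Prove}(crs,d,(m,\{r_{i,b}\}))$ with $d=(\{pk_{i,b}\},\{CT_{i,b}\},X)$; output $(\{CT_{i,b}\},X,\pi)$. * $\mathsf{Dec}(sk,CT)$: evaluate the circuit $sk$ at the (padded) binary encoding of $CT$. * $\mathsf{FakeSetup}(1^\kappa)$: as $\mathsf{Setup}$, but with $(crs,td)\leftarrow\mathsf{Sim}_1(1^\kappa)$ and $z^*\leftarrow\{0,1\}^\ell$; output $pk=(\{pk_{i,b}\},crs)$ and $aux=(pk,td,\{msk_{i,b}\},z^*)$.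 * $\mathsf{FakeSK}(pk,aux,P)$: $sk^0_i\leftarrow\mathsf{ABE.KeyGen}(msk_{i,0},P)$; output $i\mathcal O(1^\kappa,\mathsf D_0[pk,\{sk^0_i\}])$. * $\mathsf{FakeCT}(pk,aux,X)$: $CT_{i,z^*[i]}\leftarrow\mathsf{ABE.Enc}(pk_{i,z^*[i]},X,0)$, $CT_{i,1-z^*[i]}\leftarrow\mathsf{ABE.Enc}(pk_{i,1-z^*[i]},X,1)$, $\pi\leftarrow\mathsf{Sim}_2(crs,td,d)$ with $d$ as above; output $(\{CT_{i,b}\},X,\pi)$. * $\mathsf{Reveal}(pk,aux,\widetilde{CT},m)$: output $(pk,\{msk_{i,z^*[i]\oplus m[i]}\},z^*\oplus m)$. On input $(\{CT_{i,b}\},X,\pi)$ the circuit $\mathsf D[pk,\{sk_i\},z]$ outputs $\bot$ if $\mathsf{Vrfy}(crs,d,\pi)$ rejects; otherwise it outputs the concatenation of the bits $\mathsf{ABE.Dec}(sk_i,CT_{i,z[i]})$, $i\in[\ell]$ ($\bot$ if one of them is $\bot$). $\mathsf D_0[pk,\{sk_i\}]$ does the same with $CT_{i,0}$ in place of $CT_{i,z[i]}$.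 Here $\mathsf D,\mathsf D_0$ may be any Boolean circuits that compute these functions, that are generated in polynomial time from $1^\kappa$, $P$ and the hardwired values, whose input length (a polynomial-time computable function of $\kappa$) suffices for all honest ciphertexts, and that are padded to the same size for given $\kappa$, honest $pk$ and $P\in\mathcal P_\kappa$, whenever the hardwired keys are ABE keys for $P$ under honestly generated master secret keys and $z\in\{0,1\}^\ell$. **Theorem.** Under these assumptions $\Sigma$ is an RNC secure NCABE scheme: all its algorithms run in (probabilistic) polynomial time; it is perfectly correct (with probability $1$ an honest key for $P\in\mathcal P_\kappa$ decrypts an honest encryption of $m\in\{0,1\}^\ell$ under $X\in\mathcal X_\kappa$ to $m$ if $P(X)=\top$, and to $\bot$ if $P(X)=\bot$ and $\ell\ge1$); and the following two experiments are indistinguishable for QPT adversaries, which get $pk$, may query keys for any number of policies $P$ adaptively before and after choosing one target $(X^*,m)$, subject to $P(X^*)=\bot$ for all of them (illegal queries are answered by $\bot$), and finally output a bit. * Real: $(pk,msk)\leftarrow\mathsf{Setup}(1^\kappa)$; keys are $\mathsf{KeyGen}(msk,P)$; the target is answered by $(\mathsf{Enc}(pk,X^*,m),msk)$. * Fake: $(pk,aux)\leftarrow\mathsf{FakeSetup}(1^\kappa)$;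 keys are $\mathsf{FakeSK}(pk,aux,P)$; the target is answered by $(\widetilde{CT},\mathsf{Reveal}(pk,aux,\widetilde{CT},m))$ with $\widetilde{CT}\leftarrow\mathsf{FakeCT}(pk,aux,X^*)$. -/

import Mathlib

noncomputable section

/-! ### Binary trees, the data type on which all classical algorithms work -/

/-- Finite binary trees.  A tree is read as the list of its left subtrees along the right spine,
so that tuples, lists, bit strings and unary numerals are all trees. -/
inductive Data where
  | nil : Data
  | cons : Data → Data → Data

namespace Data

def size : Data → ℕ
  | nil => 1
  | cons a b => a.size + b.size + 1

def hd : Data → Data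
  | nil => nil
  | cons a _ => a

def tl : Data → Data
  | nil => nil
  | cons _ b => b

def ofList : List Data → Data
  | [] => nil
  | a :: l => cons a (ofList l)

def toList : Data → List Data
  | nil => []
  | cons a b => a :: toList b

/-- The unary numeral `1ⁿ`. -/
def ofNat (n : ℕ) : Data := ofList (List.replicate n nil)

def toNat (d : Data) : ℕ := d.toList.length

def ofBool : Bool → Data
  | false => nil
  | true => cons nil nil

def toBool : Data → Bool
  | nil => false
  | cons _ _ => true

def ofBits (l : List Bool) : Data := ofList (l.map ofBool)

def toBits (d : Data) : List Bool := d.toList.map toBool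

/-- `⊥` is `nil`, and a proper value `a` is `cons nil a`. -/
def ofOption : Option Data → Data
  | none => nil
  | some a => cons nil a

/-- The `i`-th entry of a list (`nil` if there is none). -/
def nth (d : Data) (i : ℕ) : Data := d.toList.getD i nil

/-- The component with index `b ∈ {0,1}` of a pair. -/
def sel (b : Bool) (d : Data) : Data := if b then d.tl else d.hd

/-- The pair of the components `f 0` and `f 1`. -/
def pair (f : Bool → Data) : Data := cons (f false) (f true)

/-- The list `f 0, …, f (n-1)`. -/
def vec {n : ℕ} (f : Fin n → Data) : Data := ofList (List.ofFn f)

/-- A self-delimiting binary code for trees. -/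
def code : Data → List Bool
  | nil => [false]
  | cons a b => true :: (a.code ++ b.code)

/-- Reads one code word off a bit string (the first argument bounds the recursion depth). -/
def read : ℕ → List Bool → Option (Data × List Bool)
  | 0, _ => none
  | _ + 1, [] => none
  | _ + 1, false :: x => some (nil, x)
  | k + 1, true :: x =>
    (read k x).bind fun p => (read k p.2).bind fun q => some (cons p.1 q.1, q.2)

/-- The tree whose code is a prefix of the given bit string, if there is one. -/
def decode (x : List Bool) : Option Data := (read x.length x).map Prod.fst

end Data

/-! ### Deterministic and probabilistic polynomial time -/

/-- Programs on trees: identity, the constant `nil`, head, tail, pairing, composition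
(`comp f g` runs `g` first), branching on whether a test returns `nil`, and the while loop
(`loop c f` replaces the data `x` by `f x` as long as `c x` is not `nil`). -/
inductive Code where
  | id : Code
  | nil : Code
  | hd : Code
  | tl : Code
  | pair : Code → Code → Code
  | comp : Code → Code → Code
  | ite : Code → Code → Code → Code
  | loop : Code → Code → Code

/-- `Code.Eval c x y t`: on input `x` the program `c` halts with output `y` after `t` steps.
A basic instruction takes as many steps as the size of the data that it reads. -/
inductive Code.Eval : Code → Data → Data → ℕ → Prop
  | id (x : Data) : Code.Eval .id x x x.size
  | nil (x : Data) : Code.Eval .nil x .nil x.size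
  | hd (x : Data) : Code.Eval .hd x x.hd x.size
  | tl (x : Data) : Code.Eval .tl x x.tl x.size
  | pair {f g : Code} {x a b : Data} {s t : ℕ} :
      Code.Eval f x a s → Code.Eval g x b t → Code.Eval (.pair f g) x (.cons a b) (s + t + 1)
  | comp {f g : Code} {x y z : Data} {s t : ℕ} :
      Code.Eval g x y s → Code.Eval f y z t → Code.Eval (.comp f g) x z (s + t + 1)
  | ite_then {c f g : Code} {x u v y : Data} {s t : ℕ} :
      Code.Eval c x (.cons u v) s → Code.Eval f x y t → Code.Eval (.ite c f g) x y (s + t + 1)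
  | ite_else {c f g : Code} {x y : Data} {s t : ℕ} :
      Code.Eval c x .nil s → Code.Eval g x y t → Code.Eval (.ite c f g) x y (s + t + 1)
  | loop_done {c f : Code} {x : Data} {s : ℕ} :
      Code.Eval c x .nil s → Code.Eval (.loop c f) x x (s + 1)
  | loop_step {c f : Code} {x u v y z : Data} {s t r : ℕ} :
      Code.Eval c x (.cons u v) s → Code.Eval f x y t → Code.Eval (.loop c f) y z r →
      Code.Eval (.loop c f) x z (s + t + r + 1)

/-- `f` is computed by a program whose number of steps is polynomial in the size of the input. -/
def PolyTime (f : Data → Data) : Prop :=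
  ∃ (c : Code) (p : Polynomial ℕ), ∀ x : Data, ∃ t ≤ p.eval x.size, c.Eval x (f x) t

/-- A uniformly random string of `n` bits. -/
def uniformBits (n : ℕ) : PMF (List Bool) :=
  (PMF.uniformOfFintype (Fin n → Bool)).map List.ofFn

/-- `F x` is the output distribution of a probabilistic polynomial-time algorithm on input `x`:
a deterministic polynomial-time algorithm that is given `x` and polynomially many
uniformly random bits. -/
def PPT (F : Data → PMF Data) : Prop :=
  ∃ (f : Data → Data → Data) (p : Polynomial ℕ),
    PolyTime (fun d => f d.hd d.tl) ∧
    ∀ x : Data, F x = (uniformBits (p.eval x.size)).map fun r => f x (Data.ofBits r)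

/-- Independent samples from `p 0, …, p (n-1)`. -/
def sampleVec {α : Type} : (n : ℕ) → (Fin n → PMF α) → PMF (Fin n → α)
  | 0, _ => PMF.pure Fin.elim0
  | n + 1, p =>
    (p 0).bind fun a => (sampleVec n fun i => p i.succ).map fun v => Fin.cons a v

/-- Independent samples from `p 0` and `p 1`. -/
def samplePair {α : Type} (p : Bool → PMF α) : PMF (Bool → α) :=
  (p false).bind fun a => (p true).map fun a' b => if b then a' else a

/-- The probability of the event `E`. -/
def pr {α : Type} (p : PMF α) (E : α → Prop) : ℝ := (p.toOuterMeasure {a | E a}).toReal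

def Negligible (f : ℕ → ℝ) : Prop :=
  ∀ c : ℕ, ∃ N : ℕ, ∀ n : ℕ, N < n → f n < ((n : ℝ) ^ c)⁻¹

/-! ### Quantum registers -/

/-- Pure states of a register of `n` qubits. -/
def QState (n : ℕ) : Type := {ψ : EuclideanSpace ℂ (Fin n → Bool) // ‖ψ‖ = 1}

/-- Negation of the `i`-th bit. -/
def flipBit {n : ℕ} (i : Fin n) (x : Fin n → Bool) : Fin n → Bool :=
  Function.update x i (!x i)

theorem flipBit_flipBit {n : ℕ} (i : Fin n) (x : Fin n → Bool) :
    flipBit i (flipBit i x) = x := by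
  simp [flipBit]

/-- `flipBit i` as a permutation of the computational basis. -/
def flipEquiv {n : ℕ} (i : Fin n) : Equiv.Perm (Fin n → Bool) where
  toFun := flipBit i
  invFun := flipBit i
  left_inv := flipBit_flipBit i
  right_inv := flipBit_flipBit i

/-- The basis permutation of the controlled-not gate with control `i` and target `j`. -/
def cnotEquiv {n : ℕ} (i j : Fin n) (h : i ≠ j) : Equiv.Perm (Fin n → Bool) where
  toFun x := if x i then flipBit j x else x
  invFun x := if x i then flipBit j x else x
  left_inv x := by
    cases hx : x i <;> simp [hx, flipBit, h]
  right_inv x := by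
    cases hx : x i <;> simp [hx, flipBit, h]

namespace QState

/-- Hadamard gate on qubit `i`. -/
def hadamardVec {n : ℕ} (i : Fin n) (ψ : EuclideanSpace ℂ (Fin n → Bool)) :
    EuclideanSpace ℂ (Fin n → Bool) :=
  WithLp.toLp 2 fun x => ((if x i then -ψ x else ψ x) + ψ (flipBit i x)) / (Real.sqrt 2 : ℂ)

/-- The gate `T = diag(1, e^{iπ/4})` on qubit `i`. -/
def phaseVec {n : ℕ} (i : Fin n) (ψ : EuclideanSpace ℂ (Fin n → Bool)) :
    EuclideanSpace ℂ (Fin n → Bool) :=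
  WithLp.toLp 2 fun x =>
    if x i then Complex.exp (((Real.pi / 4 : ℝ) : ℂ) * Complex.I) * ψ x else ψ x

/-- Controlled-not gate with control `i` and target `j`. -/
def cnotVec {n : ℕ} (i j : Fin n) (h : i ≠ j) (ψ : EuclideanSpace ℂ (Fin n → Bool)) :
    EuclideanSpace ℂ (Fin n → Bool) :=
  WithLp.toLp 2 fun x => ψ (cnotEquiv i j h x)

/-- Projection onto the subspace on which qubit `i` has the value `b`. -/
def projVec {n : ℕ} (i : Fin n) (b : Bool) (ψ : EuclideanSpace ℂ (Fin n → Bool)) :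
    EuclideanSpace ℂ (Fin n → Bool) :=
  WithLp.toLp 2 fun x => if x i = b then ψ x else 0

theorem norm_hadamardVec {n : ℕ} (i : Fin n) (ψ : EuclideanSpace ℂ (Fin n → Bool)) :
    ‖hadamardVec i ψ‖ = ‖ψ‖ := by
  rw [EuclideanSpace.norm_eq, EuclideanSpace.norm_eq]
  congr 1
  have key : ∀ x : Fin n → Bool,
      ‖hadamardVec i ψ x‖ ^ 2 + ‖hadamardVec i ψ (flipEquiv i x)‖ ^ 2
        = ‖ψ x‖ ^ 2 + ‖ψ (flipEquiv i x)‖ ^ 2 := by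
    intro x
    have h2 : ‖(Real.sqrt 2 : ℂ)‖ ^ 2 = 2 := by
      rw [Complex.norm_real, Real.norm_eq_abs, sq_abs, Real.sq_sqrt (by norm_num)]
    have hp := parallelogram_law_with_norm ℝ (ψ x) (ψ (flipBit i x))
    have e1 : flipBit i x i = !x i := by simp [flipBit]
    have e2 := flipBit_flipBit i x
    simp only [hadamardVec, flipEquiv, Equiv.coe_fn_mk, e1, e2, norm_div, div_pow, h2]
    have h3 : ‖-ψ x + ψ (flipBit i x)‖ = ‖ψ x - ψ (flipBit i x)‖ := by
      rw [← norm_neg]; congr 1; ring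
    have h4 : ‖-ψ (flipBit i x) + ψ x‖ = ‖ψ x - ψ (flipBit i x)‖ := by
      congr 1; ring
    have h5 : ‖ψ (flipBit i x) + ψ x‖ = ‖ψ x + ψ (flipBit i x)‖ := by
      congr 1; ring
    cases x i <;> simp [h3, h4, h5] <;> nlinarith [hp]
  have s1 := Equiv.sum_comp (flipEquiv i) fun x => ‖hadamardVec i ψ x‖ ^ 2
  have s2 := Equiv.sum_comp (flipEquiv i) fun x => ‖ψ x‖ ^ 2
  have s3 := Finset.sum_congr (rfl : (Finset.univ : Finset (Fin n → Bool)) = Finset.univ)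
    fun x _ => key x
  rw [Finset.sum_add_distrib, Finset.sum_add_distrib] at s3
  simp only at s1 s2
  linarith

theorem norm_phaseVec {n : ℕ} (i : Fin n) (ψ : EuclideanSpace ℂ (Fin n → Bool)) :
    ‖phaseVec i ψ‖ = ‖ψ‖ := by
  rw [EuclideanSpace.norm_eq, EuclideanSpace.norm_eq]
  congr 1
  refine Finset.sum_congr rfl fun x _ => ?_
  cases h : x i
  · simp [phaseVec, h]
  · simp only [phaseVec, h, if_true, norm_mul, Complex.norm_exp_ofReal_mul_I, one_mul]

theorem norm_cnotVec {n : ℕ} (i j : Fin n) (h : i ≠ j)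
    (ψ : EuclideanSpace ℂ (Fin n → Bool)) : ‖cnotVec i j h ψ‖ = ‖ψ‖ := by
  rw [EuclideanSpace.norm_eq, EuclideanSpace.norm_eq]
  congr 1
  exact Equiv.sum_comp (cnotEquiv i j h) fun x => ‖ψ x‖ ^ 2

theorem norm_projVec_sq {n : ℕ} (i : Fin n) (ψ : QState n) :
    ∑ b : Bool, ENNReal.ofReal (‖projVec i b ψ.1‖ ^ 2) = 1 := by
  have h1 : ‖projVec i true ψ.1‖ ^ 2 + ‖projVec i false ψ.1‖ ^ 2 = 1 := by
    have h : ‖ψ.1‖ ^ 2 = 1 := by rw [ψ.2, one_pow]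
    refine Eq.trans ?_ h
    rw [EuclideanSpace.norm_sq_eq, EuclideanSpace.norm_sq_eq, EuclideanSpace.norm_sq_eq,
      ← Finset.sum_add_distrib]
    refine Finset.sum_congr rfl fun x _ => ?_
    cases hx : x i <;> simp [projVec, hx]
  rw [Fintype.sum_bool, ← ENNReal.ofReal_add (sq_nonneg _) (sq_nonneg _), h1, ENNReal.ofReal_one]

open Classical in
/-- The normalized state after a measurement of qubit `i` with outcome `b` (for an outcome of
probability `0` the value is irrelevant). -/
def collapse {n : ℕ} (i : Fin n) (b : Bool) (ψ : QState n) : QState n :=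
  if h : projVec i b ψ.1 = 0 then ψ
  else ⟨(‖projVec i b ψ.1‖⁻¹ : ℂ) • projVec i b ψ.1, by
    rw [norm_smul, norm_inv, Complex.norm_real, norm_norm]
    exact inv_mul_cancel₀ (norm_ne_zero_iff.2 h)⟩

/-- Measurement of qubit `i` in the computational basis. -/
def measure {n : ℕ} (i : Fin n) (ψ : QState n) : PMF (Bool × QState n) :=
  (PMF.ofFintype (fun b => ENNReal.ofReal (‖projVec i b ψ.1‖ ^ 2)) (norm_projVec_sq i ψ)).map
    fun b => (b, collapse i b ψ)

end QState

/-! ### Quantum polynomial-time interactive adversaries -/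

/-- The elementary actions of a quantum machine under classical control.  Qubits are addressed
by numbers. -/
inductive QAction where
  | hadamard : ℕ → QAction
  | phase : ℕ → QAction
  | cnot : ℕ → ℕ → QAction
  | measure : ℕ → QAction
  | toss : QAction
  | send : Data → QAction
  | output : Bool → QAction

def QAction.toData : QAction → Data
  | .hadamard i => .cons (.ofNat 0) (.ofNat i)
  | .phase i => .cons (.ofNat 1) (.ofNat i)
  | .cnot i j => .cons (.ofNat 2) (.cons (.ofNat i) (.ofNat j))
  | .measure i => .cons (.ofNat 3) (.ofNat i)
  | .toss => .cons (.ofNat 4) .nil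
  | .send q => .cons (.ofNat 5) q
  | .output b => .cons (.ofNat 6) (.ofBool b)

/-- The result of a unitary action on the register; actions that address no existing qubit have
no effect. -/
def QAction.apply {n : ℕ} (a : QAction) (ψ : QState n) : QState n :=
  match a with
  | .hadamard i =>
    if h : i < n then
      ⟨QState.hadamardVec ⟨i, h⟩ ψ.1, (QState.norm_hadamardVec _ _).trans ψ.2⟩
    else ψ
  | .phase i =>
    if h : i < n then ⟨QState.phaseVec ⟨i, h⟩ ψ.1, (QState.norm_phaseVec _ _).trans ψ.2⟩ else ψ
  | .cnot i j =>
    if h : ∃ (hi : i < n) (hj : j < n), (⟨i, hi⟩ : Fin n) ≠ ⟨j, hj⟩ then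
      ⟨QState.cnotVec ⟨i, h.1⟩ ⟨j, h.2.1⟩ h.2.2 ψ.1, (QState.norm_cnotVec _ _ _ _).trans ψ.2⟩
    else ψ
  | _ => ψ

/-- A quantum polynomial-time adversary: a classical polynomial-time control that acts on a
quantum register.  It is non-uniform: for every security parameter it gets a classical and a
quantum advice of polynomial length.  Applied to its memory content, the control returns a new
memory content and the next action. -/
structure Adversary where
  control : Data → Data × QAction
  control_polyTime : PolyTime fun d => .cons (control d).1 (control d).2.toData
  /-- bounds the number of actions, the memory, and the lengths of the advice -/
  bound : Polynomial ℕ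
  advice : ℕ → Data
  advice_le : ∀ κ, (advice κ).size ≤ bound.eval κ
  qubits : ℕ → ℕ
  qubits_le : ∀ κ, qubits κ ≤ bound.eval κ
  qadvice : ∀ κ, QState (qubits κ)

/-- The other party of an interaction: it sends a first message and then answers messages. -/
structure Challenger where
  State : Type
  start : PMF (State × Data)
  reply : State → Data → PMF (State × Data)

/-- The output of an adversary after at most the given number of actions, when the challenger is
in state `s`, the memory content is `m` and the register is in state `ψ`.  The answer to an action
is appended to the memory.  An adversary that exceeds one of its bounds outputs `0`. -/
def Adversary.run (A : Adversary) (C : Challenger) (bound : ℕ) {n : ℕ} :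
    ℕ → C.State → Data → QState n → PMF Bool
  | 0, _, _, _ => PMF.pure false
  | k + 1, s, m, ψ =>
    if bound < m.size then PMF.pure false
    else
      let m' := (A.control m).1
      match (A.control m).2 with
      | .output b => PMF.pure b
      | .send q => (C.reply s q).bind fun p => A.run C bound k p.1 (.cons m' p.2) ψ
      | .toss =>
        (PMF.uniformOfFintype Bool).bind fun b => A.run C bound k s (.cons m' (.ofBool b)) ψ
      | .measure i =>
        if h : i < n then
          (QState.measure ⟨i, h⟩ ψ).bind fun p =>
            A.run C bound k s (.cons m' (.ofBool p.1)) p.2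
        else A.run C bound k s (.cons m' .nil) ψ
      | a => A.run C bound k s (.cons m' .nil) (a.apply ψ)

/-- The output of `A` in an interaction with `C` for security parameter `κ`.  The memory starts
with `1^κ`, the classical advice and the first message of the challenger. -/
def Adversary.experiment (A : Adversary) (C : Challenger) (κ : ℕ) : PMF Bool :=
  C.start.bind fun p =>
    A.run C (A.bound.eval κ) (A.bound.eval κ) p.1
      (.cons (.ofNat κ) (.cons (A.advice κ) p.2)) (A.qadvice κ)

/-- No quantum polynomial-time adversary distinguishes the two experiments. -/
def Indistinguishable (C₀ C₁ : ℕ → Challenger) : Prop :=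
  ∀ A : Adversary, Negligible fun κ =>
    |pr (A.experiment (C₀ κ) κ) (· = true) - pr (A.experiment (C₁ κ) κ) (· = true)|

/-! ### Boolean circuits and indistinguishability obfuscation -/

inductive Gate where
  | const : Bool → Gate
  | nand : ℕ → ℕ → Gate

/-- Boolean circuits.  The wires are numbered: first the inputs, then the values of the gates in
their order.  A gate is a constant or the negated conjunction of two earlier wires. -/
structure Circuit where
  inputs : ℕ
  gates : List Gate
  outputs : List ℕ

namespace Circuit

def gateValue (w : List Bool) : Gate → Bool
  | .const b => b
  | .nand i j => !(w.getD i false && w.getD j false)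

/-- The values of all wires. -/
def wires (C : Circuit) (x : List Bool) : List Bool :=
  C.gates.foldl (fun w g => w ++ [gateValue w g]) x

def eval (C : Circuit) (x : List Bool) : List Bool :=
  C.outputs.map fun i => (C.wires x).getD i false

def size (C : Circuit) : ℕ := C.inputs + C.gates.length + C.outputs.length

def gateOk (k : ℕ) : Gate → Prop
  | .const _ => True
  | .nand i j => i < k ∧ j < k

/-- Gates refer to earlier wires and outputs to existing ones. -/
def WellFormed (C : Circuit) : Prop :=
  (∀ k (h : k < C.gates.length), gateOk (C.inputs + k) C.gates[k]) ∧
  ∀ i ∈ C.outputs, i < C.inputs + C.gates.length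

/-- The two circuits compute the same function. -/
def Equivalent (C C' : Circuit) : Prop :=
  C.inputs = C'.inputs ∧ ∀ x : List Bool, x.length = C.inputs → C.eval x = C'.eval x

end Circuit

def Gate.toData : Gate → Data
  | .const b => .cons .nil (.ofBool b)
  | .nand i j => .cons (.ofBool true) (.cons (.ofNat i) (.ofNat j))

def Gate.ofData (d : Data) : Gate :=
  if d.hd.toBool then .nand d.tl.hd.toNat d.tl.tl.toNat else .const d.tl.toBool

def Circuit.toData (C : Circuit) : Data :=
  .cons (.ofNat C.inputs)
    (.cons (.ofList (C.gates.map Gate.toData)) (.ofList (C.outputs.map .ofNat)))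

def Circuit.ofData (d : Data) : Circuit where
  inputs := d.hd.toNat
  gates := d.tl.hd.toList.map Gate.ofData
  outputs := d.tl.tl.toList.map Data.toNat

/-- An obfuscator maps a security parameter and a circuit to a random circuit. -/
structure Obfuscator where
  obf : ℕ → Circuit → PMF Circuit

namespace Obfuscator

def Efficient (O : Obfuscator) : Prop :=
  PPT fun d => (O.obf d.hd.toNat (Circuit.ofData d.tl)).map Circuit.toData

/-- Functionality with probability one. -/
def Functional (O : Obfuscator) : Prop :=
  ∀ (κ : ℕ) (C : Circuit), C.WellFormed → pr (O.obf κ C) (fun C' => C'.Equivalent C) = 1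

/-- The distinguisher gets the obfuscation of `C`; its further messages are not answered. -/
def challenger (O : Obfuscator) (κ : ℕ) (C : Circuit) : Challenger where
  State := Unit
  start := (O.obf κ C).map fun C' => ((), C'.toData)
  reply _ _ := PMF.pure ((), .nil)

/-- Indistinguishability for the circuit classes of size at most `p`, for all polynomials `p`. -/
def Hiding (O : Obfuscator) : Prop :=
  ∀ (p : Polynomial ℕ) (C₀ C₁ : ℕ → Circuit),
    (∀ κ, (C₀ κ).WellFormed ∧ (C₁ κ).WellFormed ∧ (C₀ κ).size ≤ p.eval κ ∧
      (C₀ κ).size = (C₁ κ).size ∧ (C₀ κ).Equivalent (C₁ κ)) →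
    Indistinguishable (fun κ => O.challenger κ (C₀ κ)) (fun κ => O.challenger κ (C₁ κ))

/-- Secure indistinguishability obfuscation for `P/poly`. -/
def IsSecureObfuscator (O : Obfuscator) : Prop := O.Efficient ∧ O.Functional ∧ O.Hiding

end Obfuscator

/-! ### Attribute-based encryption -/

/-- For every security parameter an attribute space, a policy space, and the value of a policy
(second argument) at an attribute (third argument). -/
structure PolicyClass where
  attr : ℕ → Data → Bool
  pol : ℕ → Data → Bool
  sat : ℕ → Data → Data → Bool

/-- Attributes and policies are recognized, and policies are evaluated, in polynomial time. -/
def PolicyClass.Efficient (Q : PolicyClass) : Prop :=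
  PolyTime (fun d => .ofBool (Q.attr d.hd.toNat d.tl)) ∧
  PolyTime (fun d => .ofBool (Q.pol d.hd.toNat d.tl)) ∧
  PolyTime (fun d => .ofBool (Q.sat d.hd.toNat d.tl.hd d.tl.tl))

/-- The challenger of an adaptive attribute-based security experiment.  The value of `start` is a
public key together with the secret state of the challenger.  The adversary gets the public key.
It may send any number of key queries `(⊥, P)`, which are answered by `key`, and one challenge
query `(⊤, X, m)`, which is answered by `chal`, in any order.  Queries outside the policy space,
the attribute space or the set `valid`, and queries which lead to a queried policy that the target
attribute satisfies, are answered by `⊥`. -/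
def adaptiveChallenger (Q : PolicyClass) (κ : ℕ) (S : Type) (start : PMF (Data × S))
    (key : S → Data → PMF Data) (valid : Data → Bool) (chal : S → Data → Data → PMF Data) :
    Challenger where
  State := S × List Data × Option Data
  start := start.map fun k => ((k.2, [], none), k.1)
  reply := fun ⟨s, queried, target⟩ q =>
    if q.hd.toBool then
      if target.isNone && Q.attr κ q.tl.hd && valid q.tl.tl &&
          queried.all (fun P => !Q.sat κ P q.tl.hd) then
        (chal s q.tl.hd q.tl.tl).map fun c =>
          ((s, queried, some q.tl.hd), .ofOption (some c))
      else PMF.pure ((s, queried, target), .ofOption none)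
    else
      if Q.pol κ q.tl && target.all (fun X => !Q.sat κ q.tl X) then
        (key s q.tl).map fun k => ((s, q.tl :: queried, target), .ofOption (some k))
      else PMF.pure ((s, queried, target), .ofOption none)

/-- Key-policy attribute-based encryption of single bits.  The encryption algorithm is given with
explicit randomness from `{0,1}^(coins κ)`. -/
structure ABE where
  setup : ℕ → PMF (Data × Data)
  keyGen : (κ : ℕ) → (msk P : Data) → PMF Data
  coins : ℕ → ℕ
  encWith : (κ : ℕ) → (pk X : Data) → (m : Bool) → (r : List Bool) → Data
  dec : (κ : ℕ) → (sk ct : Data) → Option Bool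

namespace ABE

def enc (S : ABE) (κ : ℕ) (pk X : Data) (m : Bool) : PMF Data :=
  (uniformBits (S.coins κ)).map (S.encWith κ pk X m)

/-- All algorithms run in (probabilistic) polynomial time. -/
def Efficient (S : ABE) : Prop :=
  PPT (fun d => (S.setup d.toNat).map fun k => .cons k.1 k.2) ∧
  PPT (fun d => S.keyGen d.hd.toNat d.tl.hd d.tl.tl) ∧
  PolyTime (fun d => .ofNat (S.coins d.toNat)) ∧
  PolyTime (fun d => S.encWith d.hd.toNat d.tl.hd d.tl.tl.hd d.tl.tl.tl.hd.toBool
    d.tl.tl.tl.tl.toBits) ∧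
  PolyTime (fun d => .ofOption ((S.dec d.hd.toNat d.tl.hd d.tl.tl).map .ofBool))

/-- The result of decrypting an honest encryption of `m` for the attribute `X` with an honest key
for the policy `P`. -/
def roundTrip (S : ABE) (κ : ℕ) (P X : Data) (m : Bool) : PMF (Option Bool) := do
  let k ← S.setup κ
  let sk ← S.keyGen κ k.2 P
  let ct ← S.enc κ k.1 X m
  pure (S.dec κ sk ct)

/-- Perfect correctness: an authorized key recovers the plaintext, and a key whose policy is not
satisfied gives `⊥`. -/
def PerfectlyCorrect (S : ABE) (Q : PolicyClass) : Prop :=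
  ∀ (κ : ℕ) (P X : Data) (m : Bool), Q.pol κ P = true → Q.attr κ X = true →
    (Q.sat κ P X = true → pr (S.roundTrip κ P X m) (· ≠ some m) = 0) ∧
    (Q.sat κ P X = false → pr (S.roundTrip κ P X m) (· ≠ none) = 0)

/-- The challenge query contains two plaintexts, of which the `b`-th one is encrypted. -/
def challenger (S : ABE) (Q : PolicyClass) (b : Bool) (κ : ℕ) : Challenger :=
  adaptiveChallenger Q κ (Data × Data) ((S.setup κ).map fun k => (k.1, k))
    (fun k P => S.keyGen κ k.2 P)
    (fun _ => true)
    (fun k X m => S.enc κ k.1 X (m.sel b).toBool)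

/-- Adaptive IND-CPA security. -/
def INDCPA (S : ABE) (Q : PolicyClass) : Prop :=
  Indistinguishable (S.challenger Q false) (S.challenger Q true)

end ABE

/-! ### Receiver non-committing attribute-based encryption -/

structure NCABE where
  setup : ℕ → PMF (Data × Data)
  keyGen : (κ : ℕ) → (msk P : Data) → PMF Data
  enc : (κ : ℕ) → (pk X : Data) → (m : List Bool) → PMF Data
  dec : (κ : ℕ) → (sk ct : Data) → Option (List Bool)
  fakeSetup : ℕ → PMF (Data × Data)
  fakeCT : (κ : ℕ) → (pk aux X : Data) → PMF Data
  fakeSK : (κ : ℕ) → (pk aux P : Data) → PMF Data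
  reveal : (κ : ℕ) → (pk aux ct : Data) → (m : List Bool) → PMF Data

namespace NCABE

/-- All algorithms run in (probabilistic) polynomial time. -/
def Efficient (S : NCABE) : Prop :=
  PPT (fun d => (S.setup d.toNat).map fun k => .cons k.1 k.2) ∧
  PPT (fun d => S.keyGen d.hd.toNat d.tl.hd d.tl.tl) ∧
  PPT (fun d => S.enc d.hd.toNat d.tl.hd d.tl.tl.hd d.tl.tl.tl.toBits) ∧
  PolyTime (fun d => .ofOption ((S.dec d.hd.toNat d.tl.hd d.tl.tl).map .ofBits)) ∧
  PPT (fun d => (S.fakeSetup d.toNat).map fun k => .cons k.1 k.2) ∧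
  PPT (fun d => S.fakeCT d.hd.toNat d.tl.hd d.tl.tl.hd d.tl.tl.tl) ∧
  PPT (fun d => S.fakeSK d.hd.toNat d.tl.hd d.tl.tl.hd d.tl.tl.tl) ∧
  PPT (fun d => S.reveal d.hd.toNat d.tl.hd d.tl.tl.hd d.tl.tl.tl.hd d.tl.tl.tl.tl.toBits)

def roundTrip (S : NCABE) (κ : ℕ) (P X : Data) (m : List Bool) : PMF (Option (List Bool)) := do
  let k ← S.setup κ
  let sk ← S.keyGen κ k.2 P
  let ct ← S.enc κ k.1 X m
  pure (S.dec κ sk ct)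

/-- Perfect correctness with plaintext space `{0,1}^(len κ)`.  (If the only plaintext is the empty
one, nothing is required of unauthorized keys.) -/
def PerfectlyCorrect (S : NCABE) (Q : PolicyClass) (len : ℕ → ℕ) : Prop :=
  ∀ (κ : ℕ) (P X : Data) (m : List Bool),
    Q.pol κ P = true → Q.attr κ X = true → m.length = len κ →
    (Q.sat κ P X = true → pr (S.roundTrip κ P X m) (· ≠ some m) = 0) ∧
    (Q.sat κ P X = false → 0 < len κ → pr (S.roundTrip κ P X m) (· ≠ none) = 0)

/-- The real experiment: the challenge query is answered by a ciphertext and the master secret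
key. -/
def realChallenger (S : NCABE) (Q : PolicyClass) (len : ℕ → ℕ) (κ : ℕ) : Challenger :=
  adaptiveChallenger Q κ (Data × Data) ((S.setup κ).map fun k => (k.1, k))
    (fun k P => S.keyGen κ k.2 P)
    (fun m => m.toBits.length == len κ)
    (fun k X m => do
      let ct ← S.enc κ k.1 X m.toBits
      pure (.cons ct k.2))

/-- The fake experiment: the challenge query is answered by a fake ciphertext and a revealed
master secret key. -/
def fakeChallenger (S : NCABE) (Q : PolicyClass) (len : ℕ → ℕ) (κ : ℕ) : Challenger :=
  adaptiveChallenger Q κ (Data × Data) ((S.fakeSetup κ).map fun k => (k.1, k))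
    (fun k P => S.fakeSK κ k.1 k.2 P)
    (fun m => m.toBits.length == len κ)
    (fun k X m => do
      let ct ← S.fakeCT κ k.1 k.2 X
      let msk ← S.reveal κ k.1 k.2 ct m.toBits
      pure (.cons ct msk))

def RNCSecure (S : NCABE) (Q : PolicyClass) (len : ℕ → ℕ) : Prop :=
  Indistinguishable (S.realChallenger Q len) (S.fakeChallenger Q len)

end NCABE

/-! ### Non-interactive zero-knowledge proofs -/

structure NIZK where
  setup : ℕ → PMF Data
  prove : (κ : ℕ) → (crs x w : Data) → PMF Data
  vrfy : (κ : ℕ) → (crs x π : Data) → Bool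

/-- A simulator: `sim₁` returns a common reference string and a trapdoor. -/
structure NIZKSimulator where
  sim₁ : ℕ → PMF (Data × Data)
  sim₂ : (κ : ℕ) → (crs td x : Data) → PMF Data

def NIZKSimulator.Efficient (Z : NIZKSimulator) : Prop :=
  PPT (fun d => (Z.sim₁ d.toNat).map fun k => .cons k.1 k.2) ∧
  PPT (fun d => Z.sim₂ d.hd.toNat d.tl.hd d.tl.tl.hd d.tl.tl.tl)

namespace NIZK

def Efficient (N : NIZK) : Prop :=
  PPT (fun d => N.setup d.toNat) ∧
  PPT (fun d => N.prove d.hd.toNat d.tl.hd d.tl.tl.hd d.tl.tl.tl) ∧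
  PolyTime (fun d => .ofBool (N.vrfy d.hd.toNat d.tl.hd d.tl.tl.hd d.tl.tl.tl))

/-- Perfect completeness for the witness relation `R` (statement, witness). -/
def Complete (N : NIZK) (R : ℕ → Data → Data → Prop) : Prop :=
  ∀ (κ : ℕ) (x w : Data), R κ x w →
    pr (do let crs ← N.setup κ
           let π ← N.prove κ crs x w
           pure (N.vrfy κ crs x π)) (· = true) = 1

/-- Statistical soundness: the adversary is unbounded and sees the common reference string. -/
def StatisticallySound (N : NIZK) (R : ℕ → Data → Data → Prop) : Prop :=
  ∀ A : ℕ → Data → PMF (Data × Data), Negligible fun κ =>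
    pr (do let crs ← N.setup κ
           let a ← A κ crs
           pure (crs, a))
      fun t => (¬ ∃ w, R κ t.2.1 w) ∧ N.vrfy κ t.1 t.2.1 t.2.2 = true

open Classical in
/-- The challenger sends a common reference string and answers one query that consists of a
statement and a witness for it by a proof; all other queries are answered by `⊥`. -/
def proofChallenger (R : Data → Data → Prop) (S : Type) (start : PMF (Data × S))
    (proof : Data → S → Data → Data → PMF Data) : Challenger where
  State := (Data × S) × Bool
  start := start.map fun k => ((k, false), k.1)
  reply := fun ⟨k, used⟩ q =>
    if used = false ∧ R q.hd q.tl then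
      (proof k.1 k.2 q.hd q.tl).map fun π => ((k, true), .ofOption (some π))
    else PMF.pure ((k, used), .ofOption none)

/-- Computational zero-knowledge with the given simulator, for statements that are chosen
after the common reference string. -/
def ZeroKnowledge (N : NIZK) (Z : NIZKSimulator) (R : ℕ → Data → Data → Prop) : Prop :=
  Indistinguishable
    (fun κ => proofChallenger (R κ) Unit ((N.setup κ).map fun crs => (crs, ()))
      fun crs _ x w => N.prove κ crs x w)
    (fun κ => proofChallenger (R κ) Data (Z.sim₁ κ)
      fun crs td x _ => Z.sim₂ κ crs td x)

/-- `N` is a statistically sound, computationally zero-knowledge proof system for the witness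
relation `R`, with simulator `Z`. -/
def IsProofSystem (N : NIZK) (Z : NIZKSimulator) (R : ℕ → Data → Data → Prop) : Prop :=
  N.Efficient ∧ Z.Efficient ∧ N.Complete R ∧ N.StatisticallySound R ∧ N.ZeroKnowledge Z R

end NIZK

/-! ### The construction -/

/-- The statement about the `2ℓ` public keys `pks`, the `2ℓ` ciphertexts `cts` and the attribute
`X`. -/
def doubleStatement (pks cts X : Data) : Data := .cons pks (.cons cts X)

def doubleWitness {n : ℕ} (m : Fin n → Bool) (r : Fin n → Bool → List Bool) : Data :=
  .cons (.ofBits (List.ofFn m)) (.vec fun i => .pair fun b => .ofBits (r i b))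

/-- The relation of consistent double encryption: for every `i`, both ciphertexts with index `i`
encrypt the bit `m i` under the attribute `X`. -/
def doubleRelation (S : ABE) (Q : PolicyClass) (len : ℕ → ℕ) (κ : ℕ) (x w : Data) : Prop :=
  ∃ (pk ct : Fin (len κ) → Bool → Data) (X : Data) (m : Fin (len κ) → Bool)
    (r : Fin (len κ) → Bool → List Bool),
    x = doubleStatement (.vec fun i => .pair (pk i)) (.vec fun i => .pair (ct i)) X ∧
    w = doubleWitness m r ∧ Q.attr κ X = true ∧
    ∀ i b, (r i b).length = S.coins κ ∧ ct i b = S.encWith κ (pk i b) X (m i) (r i b)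

/-- Ciphertexts `({CT_{i,b}}, X, π)` of the construction. -/
def ncCiphertext {n : ℕ} (ct : Fin n → Bool → Data) (X π : Data) : Data :=
  .cons (.vec fun i => .pair (ct i)) (.cons X π)

open Classical in
/-- The concatenation of `n` bits, or `⊥` if one of them is `⊥`. -/
def joinBits {n : ℕ} (f : Fin n → Option Bool) : Option (List Bool) :=
  if ∀ i, (f i).isSome then some (List.ofFn fun i => (f i).getD false) else none

/-- Left-or-right decryption.  The hardwired values are the public key `({pk_{i,b}}, crs)`, the
keys `sk_i` and `z`. -/
def leftOrRightDec (S : ABE) (N : NIZK) (len : ℕ → ℕ) (κ : ℕ) (pk sks : Data) (z : List Bool)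
    (ct : Data) : Option (List Bool) :=
  if N.vrfy κ pk.tl (doubleStatement pk.hd ct.hd ct.tl.hd) ct.tl.tl then
    joinBits fun i : Fin (len κ) => S.dec κ (sks.nth i) ((ct.hd.nth i).sel (z.getD i false))
  else none

/-- Left decryption. -/
def leftDec (S : ABE) (N : NIZK) (len : ℕ → ℕ) (κ : ℕ) (pk sks : Data) (ct : Data) :
    Option (List Bool) :=
  if N.vrfy κ pk.tl (doubleStatement pk.hd ct.hd ct.tl.hd) ct.tl.tl then
    joinBits fun i : Fin (len κ) => S.dec κ (sks.nth i) (ct.hd.nth i).hd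
  else none

/-- Representation of a plaintext of length `n` or `⊥` by `n + 1` bits. -/
def plainBits (n : ℕ) : Option (List Bool) → List Bool
  | none => false :: List.replicate n false
  | some m => true :: m

def ofPlainBits : List Bool → Option (List Bool)
  | true :: m => some m
  | _ => none

/-- Evaluates a circuit at a tree, whose code is padded with zeros to the input length. -/
def Circuit.evalData (C : Circuit) (d : Data) : Option (List Bool) :=
  if d.code.length ≤ C.inputs then
    ofPlainBits (C.eval (d.code ++ List.replicate (C.inputs - d.code.length) false))
  else none

/-- The circuit `C` computes the function `f` of ciphertexts, with inputs of `n` bits. -/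
def Circuit.Implements (C : Circuit) (n len : ℕ) (f : Data → Option (List Bool)) : Prop :=
  C.WellFormed ∧ C.inputs = n ∧
    ∀ x : List Bool, x.length = n → C.eval x = plainBits len ((Data.decode x).bind f)

def ncSetup (S : ABE) (N : NIZK) (len : ℕ → ℕ) (κ : ℕ) : PMF (Data × Data) := do
  let k ← sampleVec (len κ) fun _ => samplePair fun _ => S.setup κ
  let z ← PMF.uniformOfFintype (Fin (len κ) → Bool)
  let crs ← N.setup κ
  let pk := Data.cons (.vec fun i => .pair fun b => (k i b).1) crs
  let msk := Data.cons pk (.cons (.vec fun i => (k i (z i)).2) (.ofBits (List.ofFn z)))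
  pure (pk, msk)

def ncEnc (S : ABE) (N : NIZK) (len : ℕ → ℕ) (κ : ℕ) (pk X : Data) (m : List Bool) :
    PMF Data := do
  let r ← sampleVec (len κ) fun _ => samplePair fun _ => uniformBits (S.coins κ)
  let m' : Fin (len κ) → Bool := fun i => m.getD i false
  let ct : Fin (len κ) → Bool → Data := fun i b =>
    S.encWith κ ((pk.hd.nth i).sel b) X (m' i) (r i b)
  let π ← N.prove κ pk.tl (doubleStatement pk.hd (.vec fun i => .pair (ct i)) X)
    (doubleWitness m' r)
  pure (ncCiphertext ct X π)

/-- Left-or-right and left decryption circuits, generated from their hardwired values in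
polynomial time.  The policy is passed on only to determine the length of the padding. -/
structure DecCircuits where
  inLen : ℕ → ℕ
  leftOrRight : (κ : ℕ) → (P pk sks : Data) → (z : List Bool) → Circuit
  left : (κ : ℕ) → (P pk sks : Data) → Circuit

/-- `sks` is a list of keys for the policy `P`, under arbitrary honest master secret keys. -/
def ABE.KeysFor (S : ABE) (len : ℕ → ℕ) (κ : ℕ) (P sks : Data) : Prop :=
  ∃ sk : Fin (len κ) → Data, sks = .vec sk ∧
    ∀ i, ∃ k ∈ (S.setup κ).support, sk i ∈ (S.keyGen κ k.2 P).support

/-- The circuits compute the described functions, they are generated in polynomial time, their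
inputs are long enough for all honest ciphertexts, and the two kinds are padded to the same
size. -/
structure DecCircuits.Implement (D : DecCircuits) (S : ABE) (N : NIZK) (Q : PolicyClass)
    (len : ℕ → ℕ) : Prop where
  inLen_polyTime : PolyTime fun d => .ofNat (D.inLen d.toNat)
  leftOrRight_polyTime : PolyTime fun d =>
    (D.leftOrRight d.hd.toNat d.tl.hd d.tl.tl.hd d.tl.tl.tl.hd d.tl.tl.tl.tl.toBits).toData
  left_polyTime : PolyTime fun d =>
    (D.left d.hd.toNat d.tl.hd d.tl.tl.hd d.tl.tl.tl).toData
  leftOrRight_spec : ∀ κ P pk sks z, (D.leftOrRight κ P pk sks z).Implements (D.inLen κ) (len κ)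
    (leftOrRightDec S N len κ pk sks z)
  left_spec : ∀ κ P pk sks, (D.left κ P pk sks).Implements (D.inLen κ) (len κ)
    (leftDec S N len κ pk sks)
  inLen_ge : ∀ κ, ∀ k ∈ (ncSetup S N len κ).support, ∀ X m, Q.attr κ X = true →
    m.length = len κ → ∀ ct ∈ (ncEnc S N len κ k.1 X m).support, ct.code.length ≤ D.inLen κ
  size_eq : ∀ κ P, Q.pol κ P = true → ∀ k ∈ (ncSetup S N len κ).support, ∀ sks sks' z,
    S.KeysFor len κ P sks → S.KeysFor len κ P sks' → z.length = len κ →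
    (D.leftOrRight κ P k.1 sks z).size = (D.left κ P k.1 sks').size

/-- The receiver non-committing scheme. -/
def ncabe (S : ABE) (N : NIZK) (Z : NIZKSimulator) (O : Obfuscator) (D : DecCircuits)
    (len : ℕ → ℕ) : NCABE where
  setup := ncSetup S N len
  keyGen κ msk P := do
    let sk ← sampleVec (len κ) fun i => S.keyGen κ (msk.tl.hd.nth i) P
    let C ← O.obf κ (D.leftOrRight κ P msk.hd (.vec sk) msk.tl.tl.toBits)
    pure C.toData
  enc := ncEnc S N len
  dec _ sk ct := (Circuit.ofData sk).evalData ct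
  fakeSetup κ := do
    let k ← sampleVec (len κ) fun _ => samplePair fun _ => S.setup κ
    let z ← PMF.uniformOfFintype (Fin (len κ) → Bool)
    let t ← Z.sim₁ κ
    let pk := Data.cons (.vec fun i => .pair fun b => (k i b).1) t.1
    let aux := Data.cons pk (.cons t.2
      (.cons (.vec fun i => .pair fun b => (k i b).2) (.ofBits (List.ofFn z))))
    pure (pk, aux)
  fakeCT κ pk aux X := do
    let td := aux.tl.hd
    let z := aux.tl.tl.tl
    let ct ← sampleVec (len κ) fun i => samplePair fun b =>
      S.enc κ ((pk.hd.nth i).sel b) X (b != (z.nth i).toBool)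
    let π ← Z.sim₂ κ pk.tl td (doubleStatement pk.hd (.vec fun i => .pair (ct i)) X)
    pure (ncCiphertext ct X π)
  fakeSK κ pk aux P := do
    let msks := aux.tl.tl.hd
    let sk ← sampleVec (len κ) fun i => S.keyGen κ (msks.nth i).hd P
    let C ← O.obf κ (D.left κ P pk (.vec sk))
    pure C.toData
  reveal κ _ aux _ m :=
    let msks := aux.tl.tl.hd
    let z : Fin (len κ) → Bool := fun i => (aux.tl.tl.tl.nth i).toBool ^^ m.getD i false
    PMF.pure (.cons aux.hd (.cons (.vec fun i => (msks.nth i).sel (z i)) (.ofBits (List.ofFn z))))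

end

/-! ### Typed polynomial time -/

/-! The core is receiver non-committing security, which is proved by passing from the real to the
fake experiment in four moves.

First, every key becomes an obfuscation of the left decryption circuit. By statistical soundness,
outside an event of negligible probability the reference string admits no accepted proof of a false
statement. An accepted ciphertext then consists, for every `i`, of two honest encryptions of one bit
under one common attribute `X`. Perfect correctness of the bit scheme forces keys for `P` to give
the same result on both: the bit if `P` accepts `X`, and `⊥` otherwise. The requirement about `⊥` is
essential, because the circuits must agree on unauthorized ciphertexts too. Hence the left-or-right
and the left circuit compute the same function (`circuits_equivalent`), and obfuscation allows an
exchange key by key (`run_logGame_key_sub_le`, `keys_indist`).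

Second, the proof in the challenge ciphertext is simulated (`proofs_indist`). From here on the two
ciphertexts with the same index need not encrypt the same bit.

Third, the ciphertexts with indices `(i, 1 - z[i])` are changed one at a time from `m[i]` to its
negation. Their master secret keys are not revealed. Where such a position is a left one, the
functional keys for it are obtained from the key oracle of the bit scheme, whose legality condition
is that of the large game. A telescoping sum over the `ℓ` positions reduces the claim to IND-CPA
security (`hybrids_indist`).

Fourth, all functional keys are now left keys, so `z` influences nothing but the answer to the
challenge query and may be drawn when that query arrives (`play_lazy`). At that moment `m` is known,
and `z ↦ z ⊕ m` preserves the uniform distribution. The result is literally the fake experiment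
(`hybRun_len`), so this last move costs nothing.

A reduction is a `Wrapper`: it runs the classical control of the adversary, leaves the quantum
register alone and translates the messages. Values that do not come from the challenger are fixed by
averaging, since some outcome carries at least half of the average difference
(`exists_prT_bind_sub_le`), and they enter the advice. This covers key pairs, `z`, trapdoors and
even the random bits used during the interaction (`Wrapper.indist`, `compGame_indist`). For the
exchange of a single key the reduction starts in the middle of the game: the memory and the state of
the register at that point are taken as classical and quantum advice, and a nearly worst
configuration gives a bound that is uniform in all of them
(`Obfuscator.IsSecureObfuscator.obfRun_sub_le`).

Efficiency, of the scheme and of all reductions, rests on closure properties of `PF` and `PPTF`,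
typed versions of deterministic and probabilistic polynomial time. Correctness is read off on
supports, where events of probability one hold pointwise. -/

theorem Data.size_pos (d : Data) : 0 < d.size := by cases d <;> simp [Data.size]

theorem Code.Eval.input_le {c : Code} {x y : Data} {t : ℕ} (h : c.Eval x y t) : x.size ≤ t := by
  induction h <;> omega

/-- Basic instructions are charged for the data that they read and never return anything larger. A
loop that stops at once returns its input, whose size has already been paid for by the test. This
bounds intermediate data by running times, as composition of polynomial bounds requires. -/
theorem Code.Eval.output_le {c : Code} {x y : Data} {t : ℕ} (h : c.Eval x y t) : y.size ≤ t := by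
  induction h with
  | id x => exact le_rfl
  | nil x => exact x.size_pos
  | hd x => cases x <;> simp [Data.hd, Data.size]; omega
  | tl x => cases x <;> simp [Data.tl, Data.size]; omega
  | pair _ _ h1 h2 => simp only [Data.size]; omega
  | comp _ _ h1 h2 => omega
  | ite_then _ _ h1 h2 => omega
  | ite_else _ _ h1 h2 => omega
  | loop_done h1 h2 => have := h1.input_le; omega
  | loop_step _ _ _ h1 h2 h3 => omega

/-- Coefficients in `ℕ` make every bounding polynomial monotone, so bounds may be composed without
further care. -/
theorem Polynomial.eval_mono_nat (p : Polynomial ℕ) {a b : ℕ} (h : a ≤ b) :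
    p.eval a ≤ p.eval b := by
  simp only [Polynomial.eval_eq_sum, Polynomial.sum]
  exact Finset.sum_le_sum fun i _ => Nat.mul_le_mul_left _ (Nat.pow_le_pow_left h i)

/-- Types whose elements are represented by trees. -/
class Enc (α : Type) where
  enc : α → Data

open Enc (enc)

instance : Enc Data := ⟨fun d => d⟩
instance : Enc Unit := ⟨fun _ => .nil⟩
instance : Enc Bool := ⟨Data.ofBool⟩
instance : Enc ℕ := ⟨Data.ofNat⟩
instance {α β : Type} [Enc α] [Enc β] : Enc (α × β) := ⟨fun p => .cons (enc p.1) (enc p.2)⟩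
instance {α : Type} [Enc α] : Enc (List α) := ⟨fun l => .ofList (l.map enc)⟩
instance {α : Type} [Enc α] : Enc (Option α) := ⟨fun o => .ofOption (o.map enc)⟩

/-- The size of the encoding. -/
def esize {α : Type} [Enc α] (a : α) : ℕ := (enc a).size

/-- `f` is computed on encodings in polynomial time. -/
@[fun_prop]
def PF {α β : Type} [Enc α] [Enc β] (f : α → β) : Prop :=
  ∃ (c : Code) (p : Polynomial ℕ), ∀ a, ∃ t ≤ p.eval (esize a), c.Eval (enc a) (enc (f a)) t

theorem polyTime_iff_PF (f : Data → Data) : PolyTime f ↔ PF f := Iff.rfl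

section
variable {α β γ δ σ : Type} [Enc α] [Enc β] [Enc γ] [Enc δ] [Enc σ]

/-- Programs see only encodings, so a change of type that keeps the encoding is free. Most closure
properties below are a tree operation followed by such a change. -/
theorem PF.of_enc_eq {f : α → β} {g : α → γ} (hf : PF f) (h : ∀ a, enc (g a) = enc (f a)) :
    PF g := by
  obtain ⟨c, p, hc⟩ := hf
  exact ⟨c, p, fun a => by rw [h]; exact hc a⟩

theorem PF.congr {f g : α → β} (hf : PF f) (h : ∀ a, g a = f a) : PF g :=
  hf.of_enc_eq fun a => by rw [h]

theorem PF.out_bound {f : α → β} (hf : PF f) :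
    ∃ q : Polynomial ℕ, ∀ a, esize (f a) ≤ q.eval (esize a) := by
  obtain ⟨c, p, hc⟩ := hf
  refine ⟨p, fun a => ?_⟩
  obtain ⟨t, ht, h⟩ := hc a
  exact h.output_le.trans ht

@[fun_prop]
theorem PF.id : PF (fun a : α => a) :=
  ⟨.id, .X, fun a => ⟨_, by simp [esize], Code.Eval.id _⟩⟩

@[fun_prop]
theorem PF.comp {f : β → γ} {g : α → β} (hf : PF f) (hg : PF g) : PF fun a => f (g a) := by
  obtain ⟨c, p, hc⟩ := hf
  obtain ⟨d, q, hd⟩ := hg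
  refine ⟨.comp c d, q + p.comp q + 1, fun a => ?_⟩
  obtain ⟨t, ht, h⟩ := hd a
  obtain ⟨s, hs, h'⟩ := hc (g a)
  refine ⟨_, ?_, Code.Eval.comp h h'⟩
  simp only [Polynomial.eval_add, Polynomial.eval_comp, Polynomial.eval_one]
  have := p.eval_mono_nat (h.output_le.trans ht)
  exact Nat.add_le_add_right (Nat.add_le_add ht (hs.trans this)) 1

@[fun_prop]
theorem PF.data_cons {f g : α → Data} (hf : PF f) (hg : PF g) :
    PF fun a => Data.cons (f a) (g a) := by
  obtain ⟨c, p, hc⟩ := hf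
  obtain ⟨d, q, hd⟩ := hg
  refine ⟨.pair c d, p + q + 1, fun a => ?_⟩
  obtain ⟨t, ht, h⟩ := hc a
  obtain ⟨s, hs, h'⟩ := hd a
  refine ⟨_, ?_, Code.Eval.pair h h'⟩
  simp only [Polynomial.eval_add, Polynomial.eval_one]
  omega

theorem PF.data_const (d : Data) : PF fun _ : α => d := by
  induction d with
  | nil => exact ⟨.nil, .X, fun a => ⟨_, by simp [esize], Code.Eval.nil _⟩⟩
  | cons a b ha hb => exact ha.data_cons hb

@[fun_prop]
theorem PF.const (b : β) : PF fun _ : α => b :=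
  (PF.data_const (enc b)).of_enc_eq fun _ => rfl

theorem PF.data_hd' : PF Data.hd :=
  ⟨.hd, .X, fun a => ⟨_, by simp [esize, enc], Code.Eval.hd _⟩⟩

theorem PF.data_tl' : PF Data.tl :=
  ⟨.tl, .X, fun a => ⟨_, by simp [esize, enc], Code.Eval.tl _⟩⟩

@[fun_prop]
theorem PF.data_hd {f : α → Data} (hf : PF f) : PF fun a => (f a).hd := PF.data_hd'.comp hf

@[fun_prop]
theorem PF.data_tl {f : α → Data} (hf : PF f) : PF fun a => (f a).tl := PF.data_tl'.comp hf

/-- The encoding as a function. -/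
@[fun_prop]
theorem PF.enc {f : α → β} (hf : PF f) : PF fun a => enc (f a) := hf.of_enc_eq fun _ => rfl

@[fun_prop]
theorem PF.fst {f : α → β × γ} (hf : PF f) : PF fun a => (f a).1 :=
  (hf.enc.data_hd).of_enc_eq fun _ => rfl

@[fun_prop]
theorem PF.snd {f : α → β × γ} (hf : PF f) : PF fun a => (f a).2 :=
  (hf.enc.data_tl).of_enc_eq fun _ => rfl

@[fun_prop]
theorem PF.prodMk {f : α → β} {g : α → γ} (hf : PF f) (hg : PF g) : PF fun a => (f a, g a) :=
  (hf.enc.data_cons hg.enc).of_enc_eq fun _ => rfl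

/-- Branching on whether a tree is `nil`. -/
theorem PF.data_ite {c : α → Data} {f g : α → β} (hc : PF c) (hf : PF f) (hg : PF g) :
    PF fun a => if (c a).toBool then f a else g a := by
  obtain ⟨c', p, hc⟩ := hc
  obtain ⟨d, q, hd⟩ := hf
  obtain ⟨e, r, he⟩ := hg
  refine ⟨.ite c' d e, p + q + r + 1, fun a => ?_⟩
  obtain ⟨t, ht, h⟩ := hc a
  obtain ⟨s, hs, h1⟩ := hd a
  obtain ⟨u, hu, h2⟩ := he a
  change Code.Eval c' (Enc.enc a) (c a) t at h
  rcases hca : c a with _ | ⟨x, y⟩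
  · rw [hca] at h
    have e : (if (c a).toBool then f a else g a) = g a := by rw [hca]; rfl
    refine ⟨_, ?_, by beta_reduce; rw [e]; exact Code.Eval.ite_else h h2⟩
    simp only [Polynomial.eval_add, Polynomial.eval_one]
    omega
  · rw [hca] at h
    have e : (if (c a).toBool then f a else g a) = f a := by rw [hca]; rfl
    refine ⟨_, ?_, by beta_reduce; rw [e]; exact Code.Eval.ite_then h h1⟩
    simp only [Polynomial.eval_add, Polynomial.eval_one]
    omega

@[simp] theorem Data.toBool_ofBool (b : Bool) : (Data.ofBool b).toBool = b := by
  cases b <;> rfl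

@[fun_prop]
theorem PF.ite {c : α → Bool} {f g : α → β} (hc : PF c) (hf : PF f) (hg : PF g) :
    PF fun a => if c a then f a else g a :=
  (PF.data_ite hc.enc hf hg).congr fun a => by
    change _ = if (Data.ofBool (c a)).toBool then _ else _
    rw [Data.toBool_ofBool]

@[fun_prop]
theorem PF.data_toBool {f : α → Data} (hf : PF f) : PF fun a => (f a).toBool :=
  (PF.data_ite hf (PF.const true) (PF.const false)).congr fun a => by
    cases (f a).toBool <;> rfl

@[fun_prop]
theorem PF.data_ofBool {f : α → Bool} (hf : PF f) : PF fun a => Data.ofBool (f a) := hf.enc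

@[fun_prop]
theorem PF.not {f : α → Bool} (hf : PF f) : PF fun a => !(f a) :=
  (PF.ite hf (PF.const false) (PF.const true)).congr fun a => by cases f a <;> rfl

@[fun_prop]
theorem PF.and {f g : α → Bool} (hf : PF f) (hg : PF g) : PF fun a => f a && g a :=
  (PF.ite hf hg (PF.const false)).congr fun a => by cases f a <;> rfl

@[fun_prop]
theorem PF.or {f g : α → Bool} (hf : PF f) (hg : PF g) : PF fun a => f a || g a :=
  (PF.ite hf (PF.const true) hg).congr fun a => by cases f a <;> rfl

@[fun_prop]
theorem PF.xor {f g : α → Bool} (hf : PF f) (hg : PF g) : PF fun a => f a ^^ g a :=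
  (PF.ite hf hg.not hg).congr fun a => by cases f a <;> cases g a <;> rfl

@[fun_prop]
theorem PF.bne {f g : α → Bool} (hf : PF f) (hg : PF g) : PF fun a => f a != g a :=
  (hf.xor hg).congr fun a => by cases f a <;> cases g a <;> rfl

/-- A while loop whose number of iterations and whose intermediate values are polynomially
bounded. -/
theorem PF.while {s : α → σ} {c : σ → Bool} {f : σ → σ} {n : α → ℕ}
    (hs : PF s) (hc : PF c) (hf : PF f) (r q : Polynomial ℕ)
    (hn : ∀ a, n a ≤ r.eval (esize a))
    (hq : ∀ a, ∀ i ≤ n a, esize (f^[i] (s a)) ≤ q.eval (esize a))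
    (hlt : ∀ a, ∀ i < n a, c (f^[i] (s a)) = true) (heq : ∀ a, c (f^[n a] (s a)) = false) :
    PF fun a => f^[n a] (s a) := by
  obtain ⟨cc, pc, hcc⟩ := hc
  obtain ⟨cf, pf, hcf⟩ := hf
  -- The induction is on the number `i` of remaining iterations, because `Code.Eval.loop_step`
  -- splits off the first iteration of a loop.
  have key : ∀ a i, i ≤ n a → ∃ t ≤ (i + 1) * (pc.eval (q.eval (esize a)) +
      pf.eval (q.eval (esize a)) + 1), (Code.loop cc cf).Eval (Enc.enc (f^[n a - i] (s a)))
        (Enc.enc (f^[n a] (s a))) t := by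
    intro a i
    induction i with
    | zero =>
      intro _
      obtain ⟨t, ht, h⟩ := hcc (f^[n a] (s a))
      have := pc.eval_mono_nat (hq a _ le_rfl)
      rw [heq] at h
      refine ⟨t + 1, by omega, Code.Eval.loop_done h⟩
    | succ i ih =>
      intro hi
      obtain ⟨t, ht, h⟩ := hcc (f^[n a - (i + 1)] (s a))
      obtain ⟨u, hu, h'⟩ := hcf (f^[n a - (i + 1)] (s a))
      obtain ⟨v, hv, h''⟩ := ih (by omega)
      rw [hlt a _ (by omega)] at h
      have h1 := pc.eval_mono_nat (hq a (n a - (i + 1)) (by omega))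
      have h2 := pf.eval_mono_nat (hq a (n a - (i + 1)) (by omega))
      rw [← Function.iterate_succ_apply' f, show (n a - (i + 1)).succ = n a - i by omega] at h'
      refine ⟨_, ?_, Code.Eval.loop_step h h' h''⟩
      rw [add_mul _ 1]
      omega
  have hl : PF (α := α) (β := σ) fun a => f^[n a] (s a) := by
    obtain ⟨cs, ps, hcs⟩ := hs
    refine ⟨.comp (.loop cc cf) cs, ps + (r + 1) * (pc.comp q + pf.comp q + 1) + 1, fun a => ?_⟩
    obtain ⟨t, ht, h⟩ := hcs a
    obtain ⟨u, hu, h'⟩ := key a (n a) le_rfl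
    rw [Nat.sub_self] at h'
    refine ⟨_, ?_, Code.Eval.comp h h'⟩
    simp only [Polynomial.eval_add, Polynomial.eval_one, Polynomial.eval_mul,
      Polynomial.eval_comp]
    have := Nat.mul_le_mul_right (pc.eval (q.eval (esize a)) +
      pf.eval (q.eval (esize a)) + 1) (Nat.add_le_add_right (hn a) 1)
    omega
  exact hl

end

section
variable {α β γ δ σ : Type} [Enc α] [Enc β] [Enc γ] [Enc δ] [Enc σ]

/-! ### Sizes -/

theorem esize_pos (a : α) : 0 < esize a := (enc a).size_pos

@[simp] theorem esize_prod (p : α × β) : esize p = esize p.1 + esize p.2 + 1 := rfl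
@[simp] theorem esize_nil : esize ([] : List α) = 1 := rfl
@[simp] theorem esize_cons (a : α) (l : List α) : esize (a :: l) = esize a + esize l + 1 := rfl
@[simp] theorem esize_data (d : Data) : esize d = d.size := rfl

@[simp] theorem esize_nat (n : ℕ) : esize n = 2 * n + 1 := by
  change (Data.ofList (List.replicate n Data.nil)).size = _
  induction n with
  | zero => rfl
  | succ n ih => simp only [List.replicate_succ, Data.ofList, Data.size, ih]; omega

theorem esize_bool (b : Bool) : esize b ≤ 3 := by cases b <;> decide

theorem esize_list (l : List α) : esize l = (l.map fun a => esize a + 1).sum + 1 := by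
  induction l with
  | nil => rfl
  | cons a l ih => simp [ih]; omega

theorem esize_append (l l' : List α) : esize (l ++ l') + 1 = esize l + esize l' := by
  simp [esize_list]; omega

theorem esize_reverse (l : List α) : esize l.reverse = esize l := by
  simp [esize_list, List.sum_reverse]

theorem length_lt_esize (l : List α) : l.length < esize l := by
  induction l with
  | nil => simp
  | cons a l ih => have := esize_pos a; simp; omega

theorem esize_prefix {l l' : List α} (h : l <+: l') : esize l ≤ esize l' := by
  obtain ⟨t, rfl⟩ := h
  have := esize_append l t
  have := esize_pos t
  omega

theorem esize_suffix {l l' : List α} (h : l <:+ l') : esize l ≤ esize l' := by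
  obtain ⟨t, rfl⟩ := h
  have := esize_append t l
  have := esize_pos t
  omega

theorem esize_mem {l : List α} {a : α} (h : a ∈ l) : esize a < esize l := by
  induction l with
  | nil => simp at h
  | cons b l ih =>
    rcases List.mem_cons.1 h with rfl | h
    · simp only [esize_cons]; omega
    · have := ih h; simp only [esize_cons]; omega

theorem esize_list_le {l : List α} {m : ℕ} (h : ∀ a ∈ l, esize a ≤ m) :
    esize l ≤ l.length * (m + 1) + 1 := by
  induction l with
  | nil => simp
  | cons a l ih =>
    have h1 := ih fun b hb => h b (List.mem_cons_of_mem _ hb)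
    have h2 := h a List.mem_cons_self
    simp only [esize_cons, List.length_cons, add_mul, one_mul]
    omega

instance {p : α → Prop} : Enc {a // p a} := ⟨fun a => enc a.1⟩

/-! ### Case distinction and lists -/

/-- Each branch has to be computable only on the inputs on which it is taken. This admits partial
operations such as the head of a nonempty list. -/
theorem PF.cases {c : α → Bool} {h : α → β} (hc : PF c)
    (hf : PF fun a : {a // c a = true} => h a.1) (hg : PF fun a : {a // c a = false} => h a.1) :
    PF h := by
  obtain ⟨c', p, hc⟩ := hc
  obtain ⟨d, q, hd⟩ := hf
  obtain ⟨e, r, he⟩ := hg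
  refine ⟨.ite c' d e, p + q + r + 1, fun a => ?_⟩
  obtain ⟨t, ht, h⟩ := hc a
  cases hca : c a
  · rw [hca] at h
    obtain ⟨u, hu, h2⟩ := he ⟨a, hca⟩
    refine ⟨_, ?_, Code.Eval.ite_else h h2⟩
    simp only [Polynomial.eval_add, Polynomial.eval_one]
    change u ≤ r.eval (esize a) at hu
    omega
  · rw [hca] at h
    obtain ⟨u, hu, h2⟩ := hd ⟨a, hca⟩
    refine ⟨_, ?_, Code.Eval.ite_then h h2⟩
    simp only [Polynomial.eval_add, Polynomial.eval_one]
    change u ≤ q.eval (esize a) at hu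
    omega

theorem PF.restrict {f : α → β} (hf : PF f) {p : α → Prop} : PF fun a : {a // p a} => f a.1 := by
  obtain ⟨c, q, hc⟩ := hf
  exact ⟨c, q, fun a => hc a.1⟩

theorem PF.subtype_val {p : α → Prop} : PF fun a : {a // p a} => a.1 := PF.id.restrict

@[fun_prop]
theorem PF.list_cons {f : α → β} {g : α → List β} (hf : PF f) (hg : PF g) :
    PF fun a => f a :: g a :=
  (hf.enc.data_cons hg.enc).of_enc_eq fun _ => rfl

@[fun_prop]
theorem PF.list_tail {f : α → List β} (hf : PF f) : PF fun a => (f a).tail :=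
  hf.enc.data_tl.of_enc_eq fun a => by cases f a <;> rfl

@[fun_prop]
theorem PF.list_isEmpty {f : α → List β} (hf : PF f) : PF fun a => (f a).isEmpty :=
  hf.enc.data_toBool.not.of_enc_eq fun a => by cases f a <;> rfl

@[fun_prop]
theorem PF.list_headD {f : α → List β} {g : α → β} (hf : PF f) (hg : PF g) :
    PF fun a => (f a).headD (g a) := by
  refine PF.cases hf.list_isEmpty ?_ ?_
  · exact hg.restrict.of_enc_eq fun a => by
      have := a.2
      cases h : f a.1 <;> simp_all
  · exact hf.enc.data_hd.restrict.of_enc_eq fun a => by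
      have := a.2
      cases h : f a.1
      · simp_all
      · rfl

theorem PF.list_head {f : α → List β} (hf : PF f) (h : ∀ a, f a ≠ []) :
    PF fun a => (f a).head (h a) :=
  hf.enc.data_hd.of_enc_eq fun a => by
    have : ∀ (l : List β) (hl : l ≠ []), Enc.enc (l.head hl) = (Enc.enc l).hd := by
      intro l hl
      cases l
      · exact absurd rfl hl
      · rfl
    exact this _ _

theorem iterate_foldl_step {A B C : Type} {h : A → C → B → C} (a : A) (g : C) (l : List B)
    (i : ℕ) (step : A × List B × C → A × List B × C)
    (hstep : ∀ a b l g, step (a, b :: l, g) = (a, l, h a g b)) (hi : i ≤ l.length) :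
    step^[i] (a, l, g) = (a, l.drop i, (l.take i).foldl (h a) g) := by
  induction i generalizing l g with
  | zero => simp
  | succ i ih =>
    cases l with
    | nil => simp at hi
    | cons b l =>
      rw [Function.iterate_succ_apply, hstep, ih _ _ (by simpa using hi)]
      simp

/-- A fold is a while loop on triples of the parameter, the remaining list and the accumulator. The
bound `q` on all partial results cannot be dropped: a polynomial-time step, iterated, may double the
accumulator each time. -/
theorem PF.list_foldl {l : α → List β} {s : α → γ} {h : α → γ → β → γ}
    (hl : PF l) (hs : PF s) (hh : PF fun p : α × γ × β => h p.1 p.2.1 p.2.2)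
    (q : Polynomial ℕ)
    (hq : ∀ a l', l' <+: l a → esize (l'.foldl (h a) (s a)) ≤ q.eval (esize a)) :
    PF fun a => (l a).foldl (h a) (s a) := by
  let step : α × List β × γ → α × List β × γ := fun p =>
    match p.2.1 with
    | [] => p
    | b :: t => (p.1, t, h p.1 p.2.2 b)
  have hstep : PF step := by
    have hc : PF fun p : α × List β × γ => p.2.1.isEmpty := by fun_prop
    refine PF.cases hc ?_ ?_
    · refine PF.subtype_val.of_enc_eq fun p => ?_
      obtain ⟨⟨a, l, g⟩, hp⟩ := p
      cases l with
      | nil => rfl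
      | cons b l => simp at hp
    · have hne : ∀ p : {p : α × List β × γ // p.2.1.isEmpty = false}, p.1.2.1 ≠ [] := by
        rintro ⟨⟨a, l, g⟩, hp⟩
        cases l with
        | nil => simp at hp
        | cons b l => simp
      have h1 : PF fun p : {p : α × List β × γ // p.2.1.isEmpty = false} => p.1.2.1 :=
        PF.subtype_val.snd.fst
      have h2 := hh.comp (PF.subtype_val (p := fun p : α × List β × γ => p.2.1.isEmpty = false)
        |>.fst.prodMk (PF.subtype_val.snd.snd.prodMk (h1.list_head hne)))
      refine (PF.subtype_val.fst.prodMk (h1.list_tail.prodMk h2)).of_enc_eq fun p => ?_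
      obtain ⟨⟨a, l, g⟩, hp⟩ := p
      cases l with
      | nil => simp at hp
      | cons b l => rfl
  obtain ⟨ql, hql⟩ := hl.out_bound
  have it := fun a i hi => iterate_foldl_step (h := h) a (s a) (l a) i step
    (fun _ _ _ _ => rfl) hi
  have main := PF.while (s := fun a => (a, l a, s a)) (c := fun p => !p.2.1.isEmpty) (f := step)
    (n := fun a => (l a).length) (by fun_prop) (by fun_prop) hstep ql (.X + ql + q + 2)
    (fun a => (length_lt_esize _).le.trans (hql a))
    (fun a i hi => by
      rw [it a i hi]
      have h1 := hq a _ (List.take_prefix i (l a))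
      have h2 := (esize_suffix (List.drop_suffix i (l a))).trans (hql a)
      simp only [esize_prod, Polynomial.eval_add, Polynomial.eval_X, Polynomial.eval_ofNat]
      omega)
    (fun a i hi => by
      rw [it a i hi.le]
      simpa using hi)
    (fun a => by
      rw [it a _ le_rfl]
      simp)
  exact main.snd.snd.congr fun a => by rw [it a _ le_rfl]; simp

@[fun_prop]
theorem PF.list_reverse {f : α → List β} (hf : PF f) : PF fun a => (f a).reverse := by
  obtain ⟨q, hq⟩ := hf.out_bound
  have : ∀ l l' : List β, l.foldl (fun acc b => b :: acc) l' = l.reverse ++ l' := by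
    intro l
    induction l with
    | nil => simp
    | cons b l ih => intro l'; simp [ih]
  refine (PF.list_foldl (s := fun _ => []) (h := fun _ acc b => b :: acc) hf (by fun_prop)
    (by fun_prop) q fun a l' hl' => ?_).congr fun a => by simp
  rw [this, List.append_nil, esize_reverse]
  exact (esize_prefix hl').trans (hq a)

@[fun_prop]
theorem PF.list_append {f g : α → List β} (hf : PF f) (hg : PF g) : PF fun a => f a ++ g a := by
  obtain ⟨q, hq⟩ := hf.out_bound
  obtain ⟨r, hr⟩ := hg.out_bound
  have : ∀ l l' : List β, l.foldl (fun acc b => b :: acc) l' = l.reverse ++ l' := by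
    intro l
    induction l with
    | nil => simp
    | cons b l ih => intro l'; simp [ih]
  refine (PF.list_foldl (s := g) (h := fun _ acc b => b :: acc) hf.list_reverse hg
    (by fun_prop) (q + r) fun a l' hl' => ?_).congr fun a => by rw [this]; simp
  have h1 := esize_append l'.reverse (g a)
  have h2 := esize_prefix hl'
  rw [esize_reverse] at h1 h2
  rw [this, Polynomial.eval_add]
  have := hq a
  have := hr a
  omega

@[fun_prop]
theorem PF.list_map {f : α → List β} {h : α → β → γ} (hf : PF f)
    (hh : PF fun p : α × β => h p.1 p.2) : PF fun a => (f a).map (h a) := by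
  obtain ⟨q, hq⟩ := hf.out_bound
  obtain ⟨r, hr⟩ := hh.out_bound
  have : ∀ (a : α) (l : List β) (l' : List γ),
      l.foldl (fun acc b => h a b :: acc) l' = (l.map (h a)).reverse ++ l' := by
    intro a l
    induction l with
    | nil => simp
    | cons b l ih => intro l'; simp [ih]
  refine (PF.list_foldl (s := fun _ => []) (h := fun a acc b => h a b :: acc) hf (by fun_prop)
    ?_ (q * (r.comp (.X + q + 1) + 1) + 1) fun a l' hl' => ?_).list_reverse.congr fun a => by
      rw [this]; simp
  · have := hh.comp (f := fun p : α × β => h p.1 p.2)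
      (g := fun p : α × List γ × β => (p.1, p.2.2)) (by fun_prop)
    fun_prop
  · rw [this, List.append_nil, esize_reverse]
    refine (esize_list_le (m := r.eval (esize a + q.eval (esize a) + 1)) fun c hc => ?_).trans ?_
    · obtain ⟨b, hb, rfl⟩ := List.mem_map.1 hc
      refine (hr (a, b)).trans (r.eval_mono_nat ?_)
      have h1 := esize_mem (hl'.subset hb)
      have h2 := hq a
      simp only [esize_prod]
      omega
    · simp only [Polynomial.eval_add, Polynomial.eval_mul, Polynomial.eval_one,
        Polynomial.eval_comp, Polynomial.eval_X, List.length_map]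
      refine Nat.add_le_add_right (Nat.mul_le_mul_right _ ?_) 1
      have h1 := hl'.length_le
      have h2 := length_lt_esize (f a)
      have h3 := hq a
      omega

theorem PF.list_foldl_bool {f : α → List β} {s : α → Bool} {h : α → Bool → β → Bool} (hf : PF f)
    (hs : PF s) (hh : PF fun p : α × Bool × β => h p.1 p.2.1 p.2.2) :
    PF fun a => (f a).foldl (h a) (s a) :=
  PF.list_foldl hf hs hh 3 fun a l' _ => (esize_bool _).trans (by simp)

@[fun_prop]
theorem PF.list_all {f : α → List β} {h : α → β → Bool} (hf : PF f)
    (hh : PF fun p : α × β => h p.1 p.2) : PF fun a => (f a).all (h a) := by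
  have : ∀ (a : α) (l : List β) (x : Bool),
      l.foldl (fun acc b => acc && h a b) x = (x && l.all (h a)) := by
    intro a l
    induction l with
    | nil => simp
    | cons b l ih => intro x; simp [ih, Bool.and_assoc]
  refine (PF.list_foldl_bool (s := fun _ => true) (h := fun a acc b => acc && h a b) hf
    (by fun_prop) ?_).congr fun a => by simp [this]
  have := hh.comp (f := fun p : α × β => h p.1 p.2)
      (g := fun p : α × Bool × β => (p.1, p.2.2)) (by fun_prop)
  fun_prop

/-! ### Natural numbers -/

theorem Data.ofList_toList (d : Data) : Data.ofList d.toList = d := by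
  induction d with
  | nil => rfl
  | cons a b _ hb => simp [Data.toList, Data.ofList, hb]

@[simp] theorem Data.toList_ofList (l : List Data) : (Data.ofList l).toList = l := by
  induction l with
  | nil => rfl
  | cons a l ih => simp [Data.toList, Data.ofList, ih]

@[fun_prop]
theorem PF.data_toList {f : α → Data} (hf : PF f) : PF fun a => (f a).toList :=
  hf.of_enc_eq fun a => by
    change Data.ofList (List.map (fun d => d) _) = f a
    rw [List.map_id']
    exact Data.ofList_toList _

@[fun_prop]
theorem PF.data_ofList {f : α → List Data} (hf : PF f) : PF fun a => Data.ofList (f a) :=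
  hf.of_enc_eq fun a => by
    change _ = Data.ofList (List.map (fun d => d) _)
    rw [List.map_id']; rfl

@[fun_prop]
theorem PF.data_ofBits {f : α → List Bool} (hf : PF f) : PF fun a => Data.ofBits (f a) := hf.enc

@[fun_prop]
theorem PF.data_ofNat {f : α → ℕ} (hf : PF f) : PF fun a => Data.ofNat (f a) := hf.enc

-- A unary numeral is a list of `nil`s, so a length is computed by erasing the entries. In the same
-- way the arithmetic below is list processing.
@[fun_prop]
theorem PF.list_length {f : α → List β} (hf : PF f) : PF fun a => (f a).length :=
  (PF.list_map (h := fun _ _ => ()) hf (by fun_prop)).of_enc_eq fun a => by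
    change Data.ofList (List.replicate _ _) = Data.ofList (List.map _ (List.map _ _))
    rw [List.map_map]
    congr 1
    rw [← List.map_const]; rfl

@[fun_prop]
theorem PF.data_toNat {f : α → Data} (hf : PF f) : PF fun a => (f a).toNat :=
  hf.data_toList.list_length

@[fun_prop]
theorem PF.data_toBits {f : α → Data} (hf : PF f) : PF fun a => (f a).toBits := by
  unfold Data.toBits
  fun_prop

theorem enc_replicate_unit (n : ℕ) : enc (List.replicate n ()) = enc n := by
  change Data.ofList (List.map _ (List.replicate n ())) = Data.ofList (List.replicate n _)
  rw [List.map_replicate]; rfl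

theorem PF.replicate_unit {f : α → ℕ} (hf : PF f) : PF fun a => List.replicate (f a) () :=
  hf.of_enc_eq fun _ => enc_replicate_unit _

@[fun_prop]
theorem PF.list_replicate {f : α → ℕ} {g : α → β} (hf : PF f) (hg : PF g) :
    PF fun a => List.replicate (f a) (g a) :=
  (PF.list_map (h := fun a _ => g a) hf.replicate_unit (by fun_prop)).congr fun a => by
    simp

@[fun_prop]
theorem PF.nat_add {f g : α → ℕ} (hf : PF f) (hg : PF g) : PF fun a => f a + g a :=
  (hf.replicate_unit.list_append hg.replicate_unit).list_length.congr fun a => by simp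

@[fun_prop]
theorem PF.list_drop {f : α → ℕ} {g : α → List β} (hf : PF f) (hg : PF g) :
    PF fun a => (g a).drop (f a) := by
  obtain ⟨q, hq⟩ := hg.out_bound
  have : ∀ (n : ℕ) (l : List β),
      (List.replicate n ()).foldl (fun acc _ => acc.tail) l = l.drop n := by
    intro n
    induction n with
    | zero => simp
    | succ n ih => intro l; simp [List.replicate_succ, ih]
  refine (PF.list_foldl (s := g) (h := fun _ acc _ => acc.tail) hf.replicate_unit hg
    (by fun_prop) q fun a l' hl' => ?_).congr fun a => by rw [this]
  obtain ⟨m, hm, rfl⟩ : ∃ m, m ≤ f a ∧ l' = List.replicate m () := by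
    refine ⟨l'.length, by simpa using hl'.length_le, ?_⟩
    exact List.eq_replicate_of_mem fun b _ => rfl
  rw [this]
  exact (esize_suffix (List.drop_suffix _ _)).trans (hq a)

@[fun_prop]
theorem PF.list_take {f : α → ℕ} {g : α → List β} (hf : PF f) (hg : PF g) :
    PF fun a => (g a).take (f a) := by
  have h1 : PF fun a => (g a).length.sub (f a) :=
    (PF.list_drop hf (hg.list_length.replicate_unit)).list_length.congr fun a => by simp
  exact (PF.list_drop h1 hg.list_reverse).list_reverse.congr fun a => by
    rw [Nat.sub_eq, ← List.reverse_take, List.reverse_reverse]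

@[fun_prop]
theorem PF.nat_sub {f g : α → ℕ} (hf : PF f) (hg : PF g) : PF fun a => f a - g a :=
  (PF.list_drop hg hf.replicate_unit).list_length.congr fun a => by simp

@[fun_prop]
theorem PF.nat_mul {f g : α → ℕ} (hf : PF f) (hg : PF g) : PF fun a => f a * g a := by
  obtain ⟨q, hq⟩ := hf.out_bound
  obtain ⟨r, hr⟩ := hg.out_bound
  have : ∀ (n m k : ℕ),
      (List.replicate n ()).foldl (fun acc _ => acc + m) k = k + n * m := by
    intro n m
    induction n with
    | zero => simp
    | succ n ih => intro l; simp [List.replicate_succ, ih]; ring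
  refine (PF.list_foldl (s := fun _ => 0) (h := fun a acc _ => acc + g a) hf.replicate_unit
    (by fun_prop) (by fun_prop) (2 * (q * r) + 1) fun a l' hl' => ?_).congr fun a => by
      rw [this]; simp
  obtain ⟨m, hm, rfl⟩ : ∃ m, m ≤ f a ∧ l' = List.replicate m () := by
    refine ⟨l'.length, by simpa using hl'.length_le, ?_⟩
    exact List.eq_replicate_of_mem fun b _ => rfl
  rw [this]
  have h1 := hq a
  have h2 := hr a
  simp only [esize_nat] at h1 h2
  simp only [zero_add, esize_nat, Polynomial.eval_add, Polynomial.eval_mul, Polynomial.eval_one,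
    Polynomial.eval_ofNat]
  have : m * g a ≤ q.eval (esize a) * r.eval (esize a) := Nat.mul_le_mul (by omega) (by omega)
  omega

@[fun_prop]
theorem PF.nat_ble {f g : α → ℕ} (hf : PF f) (hg : PF g) : PF fun a => Nat.ble (f a) (g a) :=
  (hf.nat_sub hg).replicate_unit.list_isEmpty.congr fun a => by
    rw [Bool.eq_iff_iff]
    simp [Nat.sub_eq_zero_iff_le]

@[fun_prop]
theorem PF.nat_beq {f g : α → ℕ} (hf : PF f) (hg : PF g) : PF fun a => f a == g a :=
  ((hf.nat_ble hg).and (hg.nat_ble hf)).congr fun a => by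
    rw [Bool.eq_iff_iff, beq_iff_eq, Bool.and_eq_true, Nat.ble_eq, Nat.ble_eq]
    exact le_antisymm_iff

@[fun_prop]
theorem PF.list_getD {f : α → List β} {g : α → ℕ} {h : α → β} (hf : PF f) (hg : PF g)
    (hh : PF h) : PF fun a => (f a).getD (g a) (h a) :=
  ((hg.list_drop hf).list_headD hh).congr fun a => by
    rw [List.headD_eq_head?_getD, List.head?_drop, List.getD_eq_getElem?_getD]

@[fun_prop]
theorem PF.data_nth {f : α → Data} {g : α → ℕ} (hf : PF f) (hg : PF g) :
    PF fun a => (f a).nth (g a) := hf.data_toList.list_getD hg (PF.const _)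

@[fun_prop]
theorem PF.data_sel {f : α → Data} {g : α → Bool} (hf : PF f) (hg : PF g) :
    PF fun a => (f a).sel (g a) := PF.ite hg hf.data_tl hf.data_hd

@[fun_prop]
theorem PF.list_range {f : α → ℕ} (hf : PF f) : PF fun a => List.range (f a) := by
  obtain ⟨q, hq⟩ := hf.out_bound
  have : ∀ (n : ℕ), (List.replicate n ()).foldl (fun (acc : List ℕ) _ => acc.length :: acc) []
      = (List.range n).reverse := by
    intro n
    induction n with
    | zero => simp
    | succ n ih => rw [List.replicate_succ', List.foldl_append, ih, List.range_succ]; simp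
  refine (PF.list_foldl (s := fun _ => []) (h := fun a acc _ => acc.length :: acc)
    hf.replicate_unit (by fun_prop) (by fun_prop) (q * (2 * q + 2) + 1)
    fun a l' hl' => ?_).list_reverse.congr fun a => by rw [this]; simp
  obtain ⟨m, hm, rfl⟩ : ∃ m, m ≤ f a ∧ l' = List.replicate m () := by
    refine ⟨l'.length, by simpa using hl'.length_le, ?_⟩
    exact List.eq_replicate_of_mem fun b _ => rfl
  rw [this, esize_reverse]
  refine (esize_list_le (m := 2 * m + 1) fun c hc => ?_).trans ?_
  · have := List.mem_range.1 hc
    simp only [esize_nat]; omega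
  · have h1 := hq a
    simp only [esize_nat] at h1
    simp only [List.length_range, Polynomial.eval_add, Polynomial.eval_mul, Polynomial.eval_one,
      Polynomial.eval_ofNat]
    gcongr <;> omega

theorem PF.polynomial_eval (p : Polynomial ℕ) {f : α → ℕ} (hf : PF f) :
    PF fun a => p.eval (f a) := by
  induction p using Polynomial.induction_on' with
  | add p q hp hq => exact (hp.nat_add hq).congr fun a => by simp
  | monomial n c =>
    have : ∀ n : ℕ, PF fun a => f a ^ n := by
      intro n
      induction n with
      | zero => exact (PF.const 1).congr fun a => by simp
      | succ n ih => exact (ih.nat_mul hf).congr fun a => by rw [pow_succ]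
    exact ((PF.const c).nat_mul (this n)).congr fun a => by simp

/-! ### Options -/

@[fun_prop]
theorem PF.option_some {f : α → β} (hf : PF f) : PF fun a => some (f a) :=
  ((PF.const Data.nil).data_cons hf.enc).of_enc_eq fun _ => rfl

end

section
variable {α β γ δ σ : Type} [Enc α] [Enc β] [Enc γ] [Enc δ] [Enc σ]

/-! ### Codes and sizes of trees -/

/-- One step of a depth-first traversal that keeps a stack of pending subtrees and the reversed
code. Recursion on trees is not a primitive of the machine, so the code of a tree is computed by a
loop. -/
def Data.codeStep (p : List Data × List Bool) : List Data × List Bool :=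
  if p.1.isEmpty then p
  else if (p.1.headD .nil).toBool then
    ((p.1.headD .nil).hd :: (p.1.headD .nil).tl :: p.1.tail, true :: p.2)
  else (p.1.tail, false :: p.2)

theorem Data.codeStep_iterate (d : Data) (s : List Data) (o : List Bool) :
    Data.codeStep^[d.size] (d :: s, o) = (s, d.code.reverse ++ o) := by
  induction d generalizing s o with
  | nil => rfl
  | cons a b ha hb =>
    rw [Data.size, Function.iterate_succ_apply, show a.size + b.size = b.size + a.size by omega,
      Function.iterate_add_apply]
    change Data.codeStep^[b.size] (Data.codeStep^[a.size] (a :: b :: s, true :: o)) = _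
    rw [ha, hb]
    simp [Data.code]

/-- Every step removes one node from the stack and emits one bit. This bounds the state during the
loop and shows that the stack is not empty before step `d.size`. -/
theorem Data.codeStep_measure (d : Data) (i : ℕ) (hi : i ≤ d.size) :
    ((Data.codeStep^[i] ([d], [])).1.map Data.size).sum + i = d.size ∧
      (Data.codeStep^[i] ([d], [])).2.length = i := by
  induction i with
  | zero => simp
  | succ i ih =>
    obtain ⟨h1, h2⟩ := ih (by omega)
    rw [Function.iterate_succ_apply']
    generalize Data.codeStep^[i] ([d], []) = p at *
    obtain ⟨s, o⟩ := p
    cases s with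
    | nil => simp at h1; omega
    | cons a s =>
      cases a with
      | nil =>
        simp only [List.map_cons, List.sum_cons, Data.size] at h1
        simp [Data.codeStep, Data.toBool] at h2 ⊢
        omega
      | cons x y =>
        simp only [List.map_cons, List.sum_cons, Data.size] at h1
        simp [Data.codeStep, Data.toBool, Data.hd, Data.tl] at h2 ⊢
        omega

@[fun_prop]
theorem PF.data_code {f : α → Data} (hf : PF f) : PF fun a => (f a).code := by
  suffices h : PF Data.code from h.comp hf
  have hs : PF Data.codeStep := by unfold Data.codeStep; fun_prop
  have main := PF.while (s := fun d : Data => ([d], ([] : List Bool)))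
    (c := fun p => !p.1.isEmpty) (f := Data.codeStep) (n := Data.size) (by fun_prop)
    (by fun_prop) hs .X (6 * .X + 3) (fun d => by simp)
    (fun d i hi => by
      obtain ⟨h1, h2⟩ := Data.codeStep_measure d i hi
      generalize Data.codeStep^[i] ([d], []) = p at *
      obtain ⟨s, o⟩ := p
      have h3 := esize_list_le (l := o) fun b _ => esize_bool b
      have h4 : ∀ s : List Data, esize s ≤ 2 * (s.map Data.size).sum + 1 := by
        intro s
        induction s with
        | nil => simp
        | cons a s ih => have := a.size_pos; simp; omega
      have := h4 s
      simp at h1 h2 ⊢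
      omega)
    (fun d i hi => by
      obtain ⟨h1, h2⟩ := Data.codeStep_measure d i hi.le
      generalize Data.codeStep^[i] ([d], []) = p at *
      obtain ⟨s, o⟩ := p
      cases s
      · simp at h1; omega
      · simp)
    (fun d => by rw [Data.codeStep_iterate]; simp)
  refine main.snd.list_reverse.congr fun d => ?_
  rw [Data.codeStep_iterate]; simp

theorem Data.length_code (d : Data) : d.code.length = d.size := by
  induction d with
  | nil => rfl
  | cons a b ha hb => simp [Data.code, Data.size, ha, hb]

@[fun_prop]
theorem PF.data_size {f : α → Data} (hf : PF f) : PF fun a => (f a).size :=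
  hf.data_code.list_length.congr fun _ => (Data.length_code _).symm

theorem PF.encSize : PF fun a : α => esize a := PF.id.enc.data_size

/-! ### Uniform bits -/

theorem PMF.bind_congr_support {α β : Type} {p : PMF α} {f g : α → PMF β}
    (h : ∀ a ∈ p.support, f a = g a) : p.bind f = p.bind g := by
  ext b
  simp only [PMF.bind_apply]
  refine tsum_congr fun a => ?_
  by_cases ha : a ∈ p.support
  · rw [h a ha]
  · rw [PMF.mem_support_iff, not_not] at ha
    simp [ha]

theorem uniformOfFintype_succ (n : ℕ) :
    PMF.uniformOfFintype (Fin (n + 1) → Bool) = (PMF.uniformOfFintype Bool).bind fun b =>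
      (PMF.uniformOfFintype (Fin n → Bool)).map fun v => Fin.cons b v := by
  ext f
  simp only [PMF.bind_apply, PMF.map_apply, PMF.uniformOfFintype_apply, tsum_fintype]
  have : ∀ b, (∑ v : Fin n → Bool, if f = Fin.cons b v then
      ((Fintype.card (Fin n → Bool) : ENNReal))⁻¹ else 0) =
      if b = f 0 then ((Fintype.card (Fin n → Bool) : ENNReal))⁻¹ else 0 := by
    intro b
    split_ifs with h
    · rw [Finset.sum_eq_single (Fin.tail f)]
      · rw [if_pos (by rw [h, Fin.cons_self_tail])]
      · intro v _ hv
        rw [if_neg]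
        rintro rfl
        exact hv (by simp)
      · simp
    · refine Finset.sum_eq_zero fun v _ => if_neg ?_
      rintro rfl
      simp at h
  simp only [this, mul_ite, mul_zero, Finset.sum_ite_eq', Finset.mem_univ, if_true]
  simp only [Fintype.card_pi, Fintype.card_bool, Finset.prod_const, Finset.card_univ,
    Fintype.card_fin, Nat.cast_pow, Nat.cast_ofNat, pow_succ']
  push_cast
  rw [ENNReal.mul_inv (by simp) (by simp)]

theorem uniformBits_zero : uniformBits 0 = PMF.pure [] := by
  rw [uniformBits]
  have : (List.ofFn : (Fin 0 → Bool) → List Bool) = fun _ => [] := by ext1 f; simp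
  rw [this]
  exact PMF.map_const _ _

theorem uniformBits_succ (n : ℕ) :
    uniformBits (n + 1) = (PMF.uniformOfFintype Bool).bind fun b =>
      (uniformBits n).map fun r => b :: r := by
  simp only [uniformBits, uniformOfFintype_succ, PMF.map_bind, PMF.map_comp]
  congr 1
  funext b
  congr 1
  funext v
  simp

theorem uniformBits_add (m n : ℕ) :
    uniformBits (m + n) = (uniformBits m).bind fun r => (uniformBits n).map fun s => r ++ s := by
  induction m with
  | zero => rw [uniformBits_zero, PMF.pure_bind, Nat.zero_add]; exact (PMF.map_id _).symm
  | succ m ih =>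
    rw [show m + 1 + n = (m + n) + 1 by omega, uniformBits_succ, uniformBits_succ, ih]
    simp only [PMF.bind_bind, PMF.bind_map, PMF.map_bind, PMF.map_comp]
    rfl

theorem length_of_mem_uniformBits {n : ℕ} {r : List Bool} (h : r ∈ (uniformBits n).support) :
    r.length = n := by
  rw [uniformBits, PMF.support_map] at h
  obtain ⟨f, _, rfl⟩ := h
  simp

theorem mem_uniformBits {n : ℕ} {r : List Bool} (h : r.length = n) :
    r ∈ (uniformBits n).support := by
  subst h
  rw [uniformBits, PMF.support_map]
  exact ⟨fun i => r[i], by simp, by simp⟩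

/-- Unused coins integrate out. Algorithms can therefore be handed more randomness than they need,
which lets several of them share one random string. -/
theorem uniformBits_map_take {n N : ℕ} (h : n ≤ N) :
    (uniformBits N).map (fun r => r.take n) = uniformBits n := by
  obtain ⟨k, rfl⟩ := Nat.exists_eq_add_of_le h
  rw [uniformBits_add, PMF.map_bind]
  simp only [PMF.map_comp]
  conv_rhs => rw [← PMF.bind_pure (uniformBits n)]
  refine PMF.bind_congr_support fun r hr => ?_
  rw [← PMF.map_const (uniformBits k) r]
  congr 1
  funext s
  simp [← length_of_mem_uniformBits hr]

theorem esize_bits (r : List Bool) : esize r ≤ 4 * r.length + 1 := by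
  have := esize_list_le (l := r) fun b _ => esize_bool b
  omega

/-! ### Probabilistic polynomial time -/

/-- `F` is sampled by a polynomial-time algorithm from polynomially many uniform bits.  Any larger
number of bits may be supplied instead. -/
def PPTF (F : α → PMF β) : Prop :=
  ∃ (f : α → List Bool → β) (p : Polynomial ℕ), PF (fun x : α × List Bool => f x.1 x.2) ∧
    ∀ a N, p.eval (esize a) ≤ N → F a = (uniformBits N).map (f a)

theorem PPT.toPPTF {F : Data → PMF Data} (h : PPT F) : PPTF F := by
  obtain ⟨f, p, hf, hF⟩ := h
  refine ⟨fun x r => f x (Data.ofBits (r.take (p.eval x.size))), p, ?_, fun a N hN => ?_⟩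
  · rw [polyTime_iff_PF] at hf
    have h1 : PF fun x : Data × List Bool => p.eval x.1.size :=
      PF.polynomial_eval p (by fun_prop)
    have := hf.comp (g := fun x : Data × List Bool =>
      Data.cons x.1 (Data.ofBits (x.2.take (p.eval x.1.size)))) (by fun_prop)
    exact this
  · rw [hF, ← esize_data, ← uniformBits_map_take hN, PMF.map_comp]
    rfl

@[simp] theorem Data.toBits_ofBits (r : List Bool) : (Data.ofBits r).toBits = r := by
  simp [Data.ofBits, Data.toBits, Function.comp_def]

@[simp] theorem Data.toNat_ofNat (n : ℕ) : (Data.ofNat n).toNat = n := by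
  simp [Data.ofNat, Data.toNat]

theorem PPTF.toPPT {F : Data → PMF Data} (h : PPTF F) : PPT F := by
  obtain ⟨f, p, hf, hF⟩ := h
  refine ⟨fun x y => f x y.toBits, p, ?_, fun x => ?_⟩
  · rw [polyTime_iff_PF]
    exact hf.comp (g := fun d : Data => (d.hd, d.tl.toBits)) (by fun_prop)
  · simpa using hF x _ le_rfl

theorem PPTF.congr {F G : α → PMF β} (hF : PPTF F) (h : ∀ a, G a = F a) : PPTF G := by
  obtain rfl : G = F := funext h
  exact hF

theorem PPTF.pure {f : α → β} (hf : PF f) : PPTF fun a => PMF.pure (f a) :=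
  ⟨fun a _ => f a, 0, by fun_prop, fun a N _ => (PMF.map_const _ _).symm⟩

theorem PPTF.comp {G : β → PMF γ} {g : α → β} (hG : PPTF G) (hg : PF g) :
    PPTF fun a => G (g a) := by
  obtain ⟨f, p, hf, hF⟩ := hG
  obtain ⟨q, hq⟩ := hg.out_bound
  refine ⟨fun a r => f (g a) r, p.comp q,
    hf.comp (g := fun x : α × List Bool => (g x.1, x.2)) (by fun_prop), fun a N hN => ?_⟩
  rw [Polynomial.eval_comp] at hN
  exact hF _ _ ((p.eval_mono_nat (hq a)).trans hN)

/-- The random string is cut in two: the first `p` bits drive `F`, all others drive `G`. That `G`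
accepts any sufficient number of bits is used here. -/
theorem PPTF.bind {F : α → PMF β} {G : α → β → PMF γ} (hF : PPTF F)
    (hG : PPTF fun p : α × β => G p.1 p.2) : PPTF fun a => (F a).bind (G a) := by
  obtain ⟨f, p, hf, hF⟩ := hF
  obtain ⟨g, q, hg, hG⟩ := hG
  obtain ⟨b, hb⟩ := hf.out_bound
  have h1 : PF fun x : α × List Bool => p.eval (esize x.1) :=
    PF.polynomial_eval p (PF.encSize.comp (by fun_prop))
  have h2 := hf.comp (f := fun x : α × List Bool => f x.1 x.2)
    (g := fun x : α × List Bool => (x.1, x.2.take (p.eval (esize x.1)))) (by fun_prop)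
  refine ⟨fun a r => g (a, f a (r.take (p.eval (esize a)))) (r.drop (p.eval (esize a))),
    -- A string of `n` bits has encoded size at most `4 * n + 1`, so the input of `f` has size at
    -- most `|a| + 4 * p + 2`. Then `b` bounds the result of `F`, which is part of the input of `G`.
    p + q.comp (.X + b.comp (.X + 4 * p + 2) + 1),
    hg.comp (g := fun x : α × List Bool => ((x.1, f x.1 (x.2.take (p.eval (esize x.1)))),
      x.2.drop (p.eval (esize x.1)))) (by fun_prop), fun a N hN => ?_⟩
  obtain ⟨k, rfl⟩ := Nat.exists_eq_add_of_le ((Nat.le_add_right _ _).trans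
    (Polynomial.eval_add (R := ℕ) ▸ hN))
  simp only [Polynomial.eval_add, Polynomial.eval_comp, Polynomial.eval_X, Polynomial.eval_one,
    Polynomial.eval_mul, Polynomial.eval_ofNat] at hN
  beta_reduce
  rw [hF a _ le_rfl, uniformBits_add, PMF.map_bind, PMF.bind_map]
  refine PMF.bind_congr_support fun r hr => ?_
  have hr := length_of_mem_uniformBits hr
  simp only [Function.comp_apply]
  rw [show G a (f a r) = _ from hG (a, f a r) k ?_, PMF.map_comp]
  · congr 1
    funext s
    simp [← hr]
  · have h3 := hb (a, r)
    have h4 := b.eval_mono_nat (a := esize (a, r)) (b := esize a + 4 * p.eval (esize a) + 2)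
      (by have := esize_bits r; simp only [esize_prod]; omega)
    have h5 := q.eval_mono_nat (a := esize (a, f a r))
      (b := esize a + b.eval (esize a + 4 * p.eval (esize a) + 2) + 1)
      (by simp only [esize_prod] at *; omega)
    omega

theorem PPTF.map {F : α → PMF β} {h : α → β → γ} (hF : PPTF F)
    (hh : PF fun p : α × β => h p.1 p.2) : PPTF fun a => (F a).map (h a) :=
  PPTF.bind (G := fun a b => PMF.pure (h a b)) hF (PPTF.pure hh)

theorem PPTF.uniformBits {n : α → ℕ} (hn : PF n) : PPTF fun a => uniformBits (n a) := by
  obtain ⟨q, hq⟩ := hn.out_bound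
  refine ⟨fun a r => r.take (n a), q, by fun_prop, fun a N hN => ?_⟩
  rw [uniformBits_map_take]
  have := hq a
  rw [esize_nat] at this
  omega

theorem PPTF.cases {c : α → Bool} {F G : α → PMF β} (hc : PF c) (hF : PPTF F) (hG : PPTF G) :
    PPTF fun a => if c a then F a else G a := by
  obtain ⟨f, p, hf, hF⟩ := hF
  obtain ⟨g, q, hg, hG⟩ := hG
  refine ⟨fun a r => if c a then f a r else g a r, p + q, by fun_prop, fun a N hN => ?_⟩
  rw [Polynomial.eval_add] at hN
  beta_reduce
  cases c a
  · simpa using hG a N (by omega)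
  · simpa using hF a N (by omega)

/-- The samples are computed from consecutive blocks of a common length `B`. Equal lengths make the
position of the `i`-th block computable. -/
theorem sampleVec_blocks {β : Type} (B : ℕ) : ∀ (n : ℕ) (F : ℕ → PMF β) (f : ℕ → List Bool → β)
    (_ : ∀ i < n, F i = (uniformBits B).map (f i)) (N : ℕ) (_ : n * B ≤ N),
    (sampleVec n fun i => F i).map List.ofFn = (uniformBits N).map fun r =>
      (List.range n).map fun i => f i ((r.drop (i * B)).take B)
  | 0, F, f, _, N, _ => by
    simp only [sampleVec, PMF.pure_map, List.range_zero, List.map_nil]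
    rw [show (fun _ : List Bool => ([] : List β)) = Function.const _ [] from rfl, PMF.map_const]
    simp
  | n + 1, F, f, hF, N, hN => by
    have hB : B ≤ N := by rw [add_mul, one_mul] at hN; omega
    obtain ⟨k, rfl⟩ := Nat.exists_eq_add_of_le hB
    have ih := sampleVec_blocks B n (fun i => F (i + 1)) (fun i => f (i + 1))
      (fun i hi => hF _ (by omega)) k (by rw [add_mul, one_mul] at hN; omega)
    rw [sampleVec, PMF.map_bind, uniformBits_add, PMF.map_bind]
    simp only [Fin.val_zero, Fin.val_succ]
    rw [hF 0 (by omega), PMF.bind_map]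
    refine PMF.bind_congr_support fun r hr => ?_
    have hr := length_of_mem_uniformBits hr
    simp only [Function.comp_apply, PMF.map_comp]
    have : (List.ofFn ∘ fun v : Fin n → β => (Fin.cons (f 0 r) v : Fin (n + 1) → β))
        = (fun l => f 0 r :: l) ∘ List.ofFn := by
      funext v
      simp
    rw [this, ← PMF.map_comp, ih, PMF.map_comp]
    congr 1
    funext s
    simp only [Function.comp_apply, List.range_succ_eq_map, List.map_cons, List.map_map,
      zero_mul, List.drop_zero]
    rw [List.take_append_of_le_length (by omega), List.take_of_length_le (by omega)]
    congr 1
    refine List.map_congr_left fun i _ => ?_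
    simp only [Function.comp_apply, Nat.succ_eq_add_one]
    rw [List.drop_append, List.drop_of_length_le (l := r) (by rw [hr]; nlinarith),
      List.nil_append, hr]
    congr 3
    rw [add_mul, one_mul, Nat.add_sub_cancel]

theorem PPTF.sampleVec {F : α → ℕ → PMF β} {n : α → ℕ} (hn : PF n)
    (hF : PPTF fun p : α × ℕ => F p.1 p.2) :
    PPTF fun a => (sampleVec (n a) fun i => F a i).map List.ofFn := by
  obtain ⟨f, p, hf, hF⟩ := hF
  obtain ⟨q, hq⟩ := hn.out_bound
  -- The block length is `p` at a bound for the size of `(a, i)`: an index `i < n a` in unary has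
  -- size at most `2 * n a + 1`.
  let B : α → ℕ := fun a => p.eval (esize a + (2 * n a + 1) + 1)
  have hB : PF B := PF.polynomial_eval p
    ((PF.encSize.nat_add (((PF.const 2).nat_mul hn).nat_add (PF.const 1))).nat_add (PF.const 1))
  refine ⟨fun a r => (List.range (n a)).map fun i => f (a, i) ((r.drop (i * B a)).take (B a)),
    q * p.comp (.X + (2 * q + 1) + 1), ?_, fun a N hN => ?_⟩
  · have := hf.comp (f := fun x : (α × ℕ) × List Bool => f x.1 x.2)
      (g := fun x : (α × List Bool) × ℕ =>
        ((x.1.1, x.2), (x.1.2.drop (x.2 * B x.1.1)).take (B x.1.1))) (by fun_prop)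
    fun_prop
  · have h1 := hq a
    rw [esize_nat] at h1
    refine sampleVec_blocks (B a) (n a) (F a) (fun i => f (a, i)) (fun i hi => ?_) N ?_
    · refine hF (a, i) _ (p.eval_mono_nat ?_)
      simp only [esize_prod, esize_nat]
      omega
    · refine le_trans ?_ hN
      simp only [Polynomial.eval_add, Polynomial.eval_comp, Polynomial.eval_X,
        Polynomial.eval_one, Polynomial.eval_mul, Polynomial.eval_ofNat]
      exact Nat.mul_le_mul (by omega) (p.eval_mono_nat (by omega))

theorem PPTF.samplePair {F : α → Bool → PMF β} (hF : PPTF fun p : α × Bool => F p.1 p.2) :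
    PPTF fun a => (samplePair (F a)).map fun f => (f false, f true) := by
  have h0 : PPTF fun a => F a false := hF.comp (g := fun a => (a, false)) (by fun_prop)
  have h1 : PPTF fun a => F a true := hF.comp (g := fun a => (a, true)) (by fun_prop)
  refine (PPTF.bind (G := fun a x => (F a true).map fun y => (x, y)) h0
    (PPTF.map (h := fun p y => (p.2, y)) (h1.comp (g := Prod.fst) (by fun_prop))
      (by fun_prop))).congr fun a => ?_
  simp only [_root_.samplePair, PMF.map_bind, PMF.map_comp]
  rfl

end

section
variable {α β γ δ σ : Type} [Enc α] [Enc β] [Enc γ] [Enc δ] [Enc σ]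

/-! ### Evaluation of circuits -/

theorem Gate.ofData_toData (g : Gate) : Gate.ofData g.toData = g := by
  cases g <;> simp [Gate.ofData, Gate.toData, Data.hd, Data.tl, Data.toBool, Data.ofBool]
  rename_i b; cases b <;> rfl

theorem Circuit.ofData_toData (C : Circuit) : Circuit.ofData C.toData = C := by
  cases C
  simp [Circuit.ofData, Circuit.toData, Data.hd, Data.tl, Function.comp_def, Gate.ofData_toData]

@[fun_prop]
theorem PF.gateValue {f : α → List Bool} {g : α → Data} (hf : PF f) (hg : PF g) :
    PF fun a => Circuit.gateValue (f a) (Gate.ofData (g a)) := by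
  have h : PF fun a => if (g a).hd.toBool then
      !((f a).getD (g a).tl.hd.toNat false && (f a).getD (g a).tl.tl.toNat false)
      else (g a).tl.toBool := by fun_prop
  refine h.congr fun a => ?_
  simp only [Gate.ofData]
  split_ifs <;> rfl

theorem Circuit.length_wires_foldl (l : List Gate) (w : List Bool) :
    (l.foldl (fun w g => w ++ [gateValue w g]) w).length = w.length + l.length := by
  induction l generalizing w with
  | nil => rfl
  | cons g l ih => simp [ih]; omega

-- The list of wires grows by one bit per gate, so the fold over the gates stays within the size of
-- the circuit and the input.
@[fun_prop]
theorem PF.circuit_eval {f : α → Data} {g : α → List Bool} (hf : PF f) (hg : PF g) :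
    PF fun a => (Circuit.ofData (f a)).eval (g a) := by
  obtain ⟨q, hq⟩ := hf.out_bound
  obtain ⟨r, hr⟩ := hg.out_bound
  have hw : PF fun a => (Circuit.ofData (f a)).wires (g a) := by
    refine (PF.list_foldl (l := fun a => (f a).tl.hd.toList) (s := g)
      (h := fun _ w d => w ++ [Circuit.gateValue w (Gate.ofData d)])
      (by fun_prop) hg (by fun_prop) (4 * r + 4 * q + 1) fun a l' hl' => ?_).congr fun a => by
        simp [Circuit.wires, Circuit.ofData, List.foldl_map]
    have h1 := Circuit.length_wires_foldl (l'.map Gate.ofData) (g a)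
    rw [List.foldl_map, List.length_map] at h1
    refine (esize_bits _).trans ?_
    rw [h1]
    have h2 := hl'.length_le
    have h3 := length_lt_esize (f a).tl.hd.toList
    have h4 : esize (f a).tl.hd.toList = (f a).tl.hd.size := by
      change (Data.ofList (List.map (fun d => d) _)).size = _
      rw [List.map_id', Data.ofList_toList]
    have h5 : (f a).tl.hd.size ≤ (f a).size := by
      rcases f a with _ | ⟨x, _ | ⟨y, z⟩⟩ <;> simp [Data.tl, Data.hd, Data.size]; omega
    have h6 := hq a
    have h7 := hr a
    have h8 := length_lt_esize (g a)
    simp only [Polynomial.eval_add, Polynomial.eval_mul, Polynomial.eval_one,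
      Polynomial.eval_ofNat, esize_data] at *
    omega
  have h : PF fun a => (f a).tl.tl.toList.map fun d =>
      ((Circuit.ofData (f a)).wires (g a)).getD d.toNat false := by
    refine PF.list_map (h := fun a (d : Data) =>
      ((Circuit.ofData (f a)).wires (g a)).getD d.toNat false)
      (by fun_prop) ?_
    have := hw.comp (g := fun p : α × Data => p.1) (by fun_prop)
    fun_prop
  refine h.congr fun a => ?_
  simp [Circuit.eval, Circuit.ofData, Function.comp_def]

theorem PF.circuit_evalData {f g : α → Data} (hf : PF f) (hg : PF g) :
    PF fun a => (Circuit.ofData (f a)).evalData (g a) := by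
  have h1 : PF fun a => (Circuit.ofData (f a)).eval
      ((g a).code ++ List.replicate ((f a).hd.toNat - (g a).code.length) false) := by fun_prop
  have h2 : PF fun a => if Nat.ble (g a).code.length (f a).hd.toNat then
      (if ((Circuit.ofData (f a)).eval
      ((g a).code ++ List.replicate ((f a).hd.toNat - (g a).code.length) false)).headD false
      then some ((Circuit.ofData (f a)).eval
      ((g a).code ++ List.replicate ((f a).hd.toNat - (g a).code.length) false)).tail else none)
      else none := by fun_prop
  refine h2.congr fun a => ?_
  have h3 : ∀ l, ofPlainBits l = if l.headD false then some l.tail else none := by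
    intro l
    rcases l with _ | ⟨_ | _, l⟩ <;> rfl
  rw [Circuit.evalData, h3]
  simp only [Nat.ble_eq]
  rfl

/-! ### Vectors -/

theorem ofFn_eq_range_map {τ : Type} {n : ℕ} {f : Fin n → τ} {g : ℕ → τ} (h : ∀ i, f i = g i) :
    List.ofFn f = (List.range n).map g := by
  rw [List.ofFn_eq_map, ← List.map_coe_finRange_eq_range, List.map_map]
  exact List.map_congr_left fun i _ => h i

@[simp] theorem Data.nth_vec {n : ℕ} (f : Fin n → Data) (i : Fin n) : (Data.vec f).nth i = f i := by
  simp [Data.nth, Data.vec]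

@[simp] theorem Data.sel_pair (f : Bool → Data) (b : Bool) : (Data.pair f).sel b = f b := by
  cases b <;> rfl

@[simp] theorem Data.hd_cons (a b : Data) : (Data.cons a b).hd = a := rfl
@[simp] theorem Data.tl_cons (a b : Data) : (Data.cons a b).tl = b := rfl

theorem PF.data_vec {n : α → ℕ} {g : α → ℕ → Data} (hn : PF n)
    (hg : PF fun p : α × ℕ => g p.1 p.2) :
    PF fun a => Data.vec fun i : Fin (n a) => g a i :=
  (PF.list_map hn.list_range hg).data_ofList.congr fun a => by
    rw [Data.vec, ofFn_eq_range_map fun _ => rfl]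

theorem PF.data_pair {g : α → Bool → Data} (hg : PF fun p : α × Bool => g p.1 p.2) :
    PF fun a => Data.pair (g a) :=
  (hg.comp (g := fun a => (a, false)) (by fun_prop)).data_cons
    (hg.comp (g := fun a => (a, true)) (by fun_prop))

theorem PF.data_vec_pair {n : α → ℕ} {g : α → ℕ → Bool → Data} (hn : PF n)
    (hg : PF fun p : α × ℕ × Bool => g p.1 p.2.1 p.2.2) :
    PF fun a => Data.vec fun i : Fin (n a) => Data.pair (g a i) := by
  refine PF.data_vec (g := fun a i => Data.pair (g a i)) hn ?_
  exact PF.data_pair (α := α × ℕ) (g := fun p b => g p.1 p.2 b)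
    (hg.comp (g := fun p : (α × ℕ) × Bool => (p.1.1, p.1.2, p.2)) (by fun_prop))

/-- The list of the pairs `(k i 0, k i 1)`. -/
def pairList {τ : Type} {n : ℕ} (k : Fin n → Bool → τ) : List (τ × τ) :=
  List.ofFn fun i => (k i false, k i true)

def pairGet {τ : Type} (d : τ) (l : List (τ × τ)) (i : ℕ) (b : Bool) : τ :=
  if b then (l.getD i (d, d)).2 else (l.getD i (d, d)).1

@[simp] theorem pairGet_pairList {τ : Type} {n : ℕ} (d : τ) (k : Fin n → Bool → τ) (i : Fin n)
    (b : Bool) : pairGet d (pairList k) i b = k i b := by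
  cases b <;> simp [pairGet, pairList]

@[fun_prop]
theorem PF.pairGet {f : α → List (β × β)} {i : α → ℕ} {b : α → Bool} (d : β) (hf : PF f)
    (hi : PF i) (hb : PF b) : PF fun a => pairGet d (f a) (i a) (b a) := by
  unfold _root_.pairGet
  fun_prop

theorem sampleVec_map {τ υ : Type} : ∀ {n : ℕ} (p : Fin n → PMF τ) (g : Fin n → τ → υ),
    (sampleVec n fun i => (p i).map (g i)) = (sampleVec n p).map fun v i => g i (v i)
  | 0, p, g => by
    simp only [sampleVec, PMF.pure_map]
    congr 1
    funext i
    exact i.elim0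
  | n + 1, p, g => by
    simp only [sampleVec, PMF.bind_map, PMF.map_bind, Function.comp_def, PMF.map_comp]
    refine congrArg _ (funext fun a => ?_)
    rw [sampleVec_map (fun i => p i.succ) fun i => g i.succ, PMF.map_comp]
    refine congrArg (fun f => PMF.map f _) (funext fun v => funext fun i => ?_)
    refine Fin.cases ?_ (fun i => ?_) i <;> simp

theorem PPTF.sampleVec_pair {F : α → ℕ → Bool → PMF β} {n : α → ℕ} (hn : PF n)
    (hF : PPTF fun p : α × ℕ × Bool => F p.1 p.2.1 p.2.2) :
    PPTF fun a => (_root_.sampleVec (n a) fun i => _root_.samplePair fun b => F a i b).map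
      pairList := by
  have h := PPTF.samplePair (F := fun (p : α × ℕ) b => F p.1 p.2 b)
    (hF.comp (g := fun p : (α × ℕ) × Bool => (p.1.1, p.1.2, p.2)) (by fun_prop))
  refine (PPTF.sampleVec (F := fun a i => (_root_.samplePair (F a i)).map
    fun f => (f false, f true)) hn h).congr fun a => ?_
  rw [sampleVec_map (fun i : Fin (n a) => _root_.samplePair (F a i))
    fun _ f => (f false, f true), PMF.map_comp]
  rfl

end

/-! ### Typed forms of the efficiency assumptions -/

theorem ABE.Efficient.setup {S : ABE} (h : S.Efficient) : PPTF fun κ : ℕ => S.setup κ := by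
  have h1 := PPTF.map (h := fun _ d => (d.hd, d.tl))
    (h.1.toPPTF.comp (g := fun κ : ℕ => Data.ofNat κ) (by fun_prop)) (by fun_prop)
  refine h1.congr fun κ => ?_
  rw [PMF.map_comp, Data.toNat_ofNat]
  exact (PMF.map_id _).symm

theorem ABE.Efficient.keyGen {S : ABE} (h : S.Efficient) :
    PPTF fun p : ℕ × Data × Data => S.keyGen p.1 p.2.1 p.2.2 :=
  (h.2.1.toPPTF.comp (g := fun p : ℕ × Data × Data => Enc.enc p) (by fun_prop)).congr fun p => by
    simp [Enc.enc]

theorem ABE.Efficient.coins {S : ABE} (h : S.Efficient) : PF fun κ : ℕ => S.coins κ := by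
  have h1 := h.2.2.1
  rw [polyTime_iff_PF] at h1
  refine (h1.comp (g := fun κ : ℕ => Data.ofNat κ) (by fun_prop)).of_enc_eq fun κ => ?_
  rw [Data.toNat_ofNat]; rfl

theorem ABE.Efficient.encWith {S : ABE} (h : S.Efficient) :
    PF fun p : ℕ × Data × Data × Bool × List Bool =>
      S.encWith p.1 p.2.1 p.2.2.1 p.2.2.2.1 p.2.2.2.2 := by
  have h1 := h.2.2.2.1
  rw [polyTime_iff_PF] at h1
  refine (h1.comp (g := fun p : ℕ × Data × Data × Bool × List Bool => Enc.enc p)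
    (by fun_prop)).congr fun p => ?_
  change _ = S.encWith (Data.ofNat p.1).toNat p.2.1 p.2.2.1 (Data.ofBool p.2.2.2.1).toBool
    (Data.ofBits p.2.2.2.2).toBits
  simp

theorem ABE.Efficient.enc {S : ABE} (h : S.Efficient) :
    PPTF fun p : ℕ × Data × Data × Bool => S.enc p.1 p.2.1 p.2.2.1 p.2.2.2 := by
  have h1 := PPTF.uniformBits (α := ℕ × Data × Data × Bool) (n := fun p => S.coins p.1)
    (h.coins.comp (by fun_prop))
  refine PPTF.map (h := fun (p : ℕ × Data × Data × Bool) r => S.encWith p.1 p.2.1 p.2.2.1 p.2.2.2 r)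
    h1 ?_
  exact h.encWith.comp (g := fun x : (ℕ × Data × Data × Bool) × List Bool =>
    (x.1.1, x.1.2.1, x.1.2.2.1, x.1.2.2.2, x.2)) (by fun_prop)

theorem NIZK.Efficient.setup {N : NIZK} (h : N.Efficient) : PPTF fun κ : ℕ => N.setup κ :=
  (h.1.toPPTF.comp (g := fun κ : ℕ => Data.ofNat κ) (by fun_prop)).congr fun κ => by simp

theorem NIZK.Efficient.prove {N : NIZK} (h : N.Efficient) :
    PPTF fun p : ℕ × Data × Data × Data => N.prove p.1 p.2.1 p.2.2.1 p.2.2.2 :=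
  (h.2.1.toPPTF.comp (g := fun p : ℕ × Data × Data × Data => Enc.enc p)
    (by fun_prop)).congr
    fun p => by simp [Enc.enc]

theorem NIZKSimulator.Efficient.sim₁ {Z : NIZKSimulator} (h : Z.Efficient) :
    PPTF fun κ : ℕ => Z.sim₁ κ := by
  have h1 := PPTF.map (h := fun _ d => (d.hd, d.tl))
    (h.1.toPPTF.comp (g := fun κ : ℕ => Data.ofNat κ) (by fun_prop)) (by fun_prop)
  refine h1.congr fun κ => ?_
  rw [PMF.map_comp, Data.toNat_ofNat]
  exact (PMF.map_id _).symm

theorem NIZKSimulator.Efficient.sim₂ {Z : NIZKSimulator} (h : Z.Efficient) :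
    PPTF fun p : ℕ × Data × Data × Data => Z.sim₂ p.1 p.2.1 p.2.2.1 p.2.2.2 :=
  (h.2.toPPTF.comp (g := fun p : ℕ × Data × Data × Data => Enc.enc p)
    (by fun_prop)).congr
    fun p => by simp [Enc.enc]

theorem Obfuscator.Efficient.obf {O : Obfuscator} (h : O.Efficient) :
    PPTF fun p : ℕ × Data => (O.obf p.1 (Circuit.ofData p.2)).map Circuit.toData :=
  (h.toPPTF.comp (g := fun p : ℕ × Data => enc p) (by fun_prop)).congr fun p => by simp [Enc.enc]

theorem PF.of_len {len : ℕ → ℕ} (h : PolyTime fun d => .ofNat (len d.toNat)) :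
    PF fun κ : ℕ => len κ := by
  rw [polyTime_iff_PF] at h
  refine (h.comp (g := fun κ : ℕ => Data.ofNat κ) (by fun_prop)).of_enc_eq fun κ => ?_
  rw [Data.toNat_ofNat]; rfl

theorem DecCircuits.Implement.left_PF {D : DecCircuits} {S : ABE} {N : NIZK} {Q : PolicyClass}
    {len : ℕ → ℕ} (h : D.Implement S N Q len) :
    PF fun p : ℕ × Data × Data × Data => (D.left p.1 p.2.1 p.2.2.1 p.2.2.2).toData := by
  have h1 := h.left_polyTime
  rw [polyTime_iff_PF] at h1
  refine (h1.comp (g := fun p : ℕ × Data × Data × Data => Enc.enc p)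
    (by fun_prop)).congr
    fun p => by simp [Enc.enc]

theorem DecCircuits.Implement.leftOrRight_PF {D : DecCircuits} {S : ABE} {N : NIZK}
    {Q : PolicyClass} {len : ℕ → ℕ} (h : D.Implement S N Q len) :
    PF fun p : ℕ × Data × Data × Data × List Bool =>
      (D.leftOrRight p.1 p.2.1 p.2.2.1 p.2.2.2.1 p.2.2.2.2).toData := by
  have h1 := h.leftOrRight_polyTime
  rw [polyTime_iff_PF] at h1
  refine (h1.comp (g := fun p : ℕ × Data × Data × Data × List Bool => Enc.enc p)
    (by fun_prop)).congr
    fun p => ?_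
  change _ = (D.leftOrRight (Data.ofNat p.1).toNat p.2.1 p.2.2.1 p.2.2.2.1
    (Data.ofBits p.2.2.2.2).toBits).toData
  simp

/-! ### Efficiency of the construction -/

section
variable {α : Type} [Enc α]

theorem PF.encWith_comp {S : ABE} (h : S.Efficient) {κ : α → ℕ} {pk X : α → Data} {m : α → Bool}
    {r : α → List Bool} (hκ : PF κ) (hpk : PF pk) (hX : PF X) (hm : PF m) (hr : PF r) :
    PF fun a => S.encWith (κ a) (pk a) (X a) (m a) (r a) :=
  h.encWith.comp (g := fun a => (κ a, pk a, X a, m a, r a)) (by fun_prop)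

end

section
variable {Q : PolicyClass} {len : ℕ → ℕ} {S : ABE} {O : Obfuscator} {N : NIZK}
  {Z : NIZKSimulator} {D : DecCircuits}

theorem PPTF.keyPairs (hlen : PF fun κ : ℕ => len κ) (hS : S.Efficient) :
    PPTF fun κ : ℕ => (_root_.sampleVec (len κ) fun _ => _root_.samplePair fun _ =>
      S.setup κ).map pairList :=
  PPTF.sampleVec_pair (F := fun κ _ _ => S.setup κ) hlen
    (hS.setup.comp (g := fun p : ℕ × ℕ × Bool => p.1) (by fun_prop))

/-- The list of the public keys, as a function of the list of all keys. -/
def pksOf (l : List ((Data × Data) × (Data × Data))) : Data :=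
  .ofList (l.map fun e => .cons e.1.1 e.2.1)

theorem pksOf_pairList {n : ℕ} (k : Fin n → Bool → Data × Data) :
    pksOf (pairList k) = .vec fun i => .pair fun b => (k i b).1 := by
  simp only [pksOf, pairList, List.map_ofFn, Data.vec]
  rfl

def msksOf (l : List ((Data × Data) × (Data × Data))) : Data :=
  .ofList (l.map fun e => .cons e.1.2 e.2.2)

theorem msksOf_pairList {n : ℕ} (k : Fin n → Bool → Data × Data) :
    msksOf (pairList k) = .vec fun i => .pair fun b => (k i b).2 := by
  simp only [msksOf, pairList, List.map_ofFn, Data.vec]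
  rfl

/-- The construction samples functions on `Fin (len κ)`, which have no encoding. The algorithm
samples the corresponding lists instead, and the results agree because only entries with index below
`len κ` are read. The other algorithms of the scheme are treated in the same way. -/
theorem PPTF.ncSetup (hlen : PF fun κ : ℕ => len κ) (hS : S.Efficient) (hN : N.Efficient) :
    PPTF fun κ : ℕ => ncSetup S N len κ := by
  let build : ℕ → List ((Data × Data) × (Data × Data)) → List Bool → Data → Data × Data :=
    fun n l z crs => (.cons (pksOf l) crs, .cons (.cons (pksOf l) crs)
      (.cons (.vec fun i : Fin n => (pairGet (.nil, .nil) l i (z.getD i false)).2) (.ofBits z)))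
  have hb : PF fun p : ((ℕ × List ((Data × Data) × (Data × Data))) × List Bool) × Data =>
      build (len p.1.1.1) p.1.1.2 p.1.2 p.2 := by
    have h1 : PF fun p : ((ℕ × List ((Data × Data) × (Data × Data))) × List Bool) × Data =>
        (Data.vec fun i : Fin (len p.1.1.1) =>
          (pairGet (.nil, .nil) p.1.1.2 i (p.1.2.getD i false)).2) :=
      PF.data_vec (α := ((ℕ × List ((Data × Data) × (Data × Data))) × List Bool) × Data)
        (n := fun p => len p.1.1.1)
        (g := fun p i => (pairGet (.nil, .nil) p.1.1.2 i (p.1.2.getD i false)).2)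
        (hlen.comp (by fun_prop)) (by fun_prop)
    simp only [build, pksOf]
    fun_prop
  have h := PPTF.bind (PPTF.keyPairs hlen hS) (G := fun κ l =>
    (_root_.uniformBits (len κ)).bind fun z => (N.setup κ).map fun crs => build (len κ) l z crs) ?_
  · refine h.congr fun κ => ?_
    rw [PMF.bind_map]
    change PMF.bind _ _ = PMF.bind _ _
    congr 1
    funext k
    simp only [Function.comp_apply, _root_.uniformBits, PMF.bind_map]
    change PMF.bind _ _ = PMF.bind _ _
    congr 1
    funext z
    simp only [Function.comp_apply]
    change PMF.bind _ _ = PMF.bind _ _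
    congr 1
    funext crs
    change PMF.pure _ = PMF.pure _
    simp only [build, pksOf_pairList, pairGet_pairList]
    simp
  · refine PPTF.bind (α := ℕ × _) (F := fun p => _root_.uniformBits (len p.1))
      (G := fun p z => (N.setup p.1).map fun crs => build (len p.1) p.2 z crs)
      (PPTF.uniformBits (hlen.comp (by fun_prop))) ?_
    exact PPTF.map (α := (ℕ × List ((Data × Data) × (Data × Data))) × List Bool)
      (F := fun p => N.setup p.1.1) (h := fun p crs => build (len p.1.1) p.1.2 p.2 crs)
      (hN.setup.comp (by fun_prop)) hb

theorem PPTF.fakeSetup (hlen : PF fun κ : ℕ => len κ) (hS : S.Efficient) (hZ : Z.Efficient) :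
    PPTF fun κ : ℕ => (ncabe S N Z O D len).fakeSetup κ := by
  let build : List ((Data × Data) × (Data × Data)) → List Bool → Data × Data → Data × Data :=
    fun l z t => (.cons (pksOf l) t.1, .cons (.cons (pksOf l) t.1)
      (.cons t.2 (.cons (msksOf l) (.ofBits z))))
  have hb : PF fun p : ((ℕ × List ((Data × Data) × (Data × Data))) × List Bool) × Data × Data =>
      build p.1.1.2 p.1.2 p.2 := by
    simp only [build, pksOf, msksOf]
    fun_prop
  have h := PPTF.bind (PPTF.keyPairs hlen hS) (G := fun κ l =>
    (_root_.uniformBits (len κ)).bind fun z => (Z.sim₁ κ).map fun crs => build l z crs) ?_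
  · refine h.congr fun κ => ?_
    rw [PMF.bind_map]
    change PMF.bind _ _ = PMF.bind _ _
    congr 1
    funext k
    simp only [Function.comp_apply, _root_.uniformBits, PMF.bind_map]
    change PMF.bind _ _ = PMF.bind _ _
    congr 1
    funext z
    simp only [Function.comp_apply]
    change PMF.bind _ _ = PMF.bind _ _
    congr 1
    funext crs
    change PMF.pure _ = PMF.pure _
    simp only [build, pksOf_pairList, msksOf_pairList]
  · refine PPTF.bind (α := ℕ × _) (F := fun p => _root_.uniformBits (len p.1))
      (G := fun p z => (Z.sim₁ p.1).map fun crs => build p.2 z crs)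
      (PPTF.uniformBits (hlen.comp (by fun_prop))) ?_
    exact PPTF.map (α := (ℕ × List ((Data × Data) × (Data × Data))) × List Bool)
      (F := fun p => Z.sim₁ p.1.1) (h := fun p crs => build p.1.2 p.2 crs)
      (hZ.sim₁.comp (by fun_prop)) hb

/-- Sampling of decryption keys for one policy from a list of master secret keys. -/
theorem PPTF.sampleKeys (hlen : PF fun κ : ℕ => len κ) (hS : S.Efficient) {κ : α → ℕ}
    {msk : α → ℕ → Data} {P : α → Data} [Enc α] (hκ : PF κ)
    (hmsk : PF fun p : α × ℕ => msk p.1 p.2) (hP : PF P) :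
    PPTF fun a => (_root_.sampleVec (len (κ a)) fun i => S.keyGen (κ a) (msk a i) (P a)).map
      Data.vec := by
  have h1 := PPTF.sampleVec (F := fun (a : α) i => S.keyGen (κ a) (msk a i) (P a))
    (n := fun a => len (κ a)) (hlen.comp hκ) (hS.keyGen.comp (g := fun p : α × ℕ =>
      (κ p.1, msk p.1 p.2, P p.1)) (by fun_prop))
  refine (PPTF.map (h := fun _ l => Data.ofList l) h1 (by fun_prop)).congr fun a => ?_
  rw [PMF.map_comp]
  rfl

theorem PPTF.keyGen (hlen : PF fun κ : ℕ => len κ) (hS : S.Efficient) (hO : O.Efficient)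
    (hD : D.Implement S N Q len) :
    PPTF fun p : ℕ × Data × Data => (ncabe S N Z O D len).keyGen p.1 p.2.1 p.2.2 := by
  have h1 := PPTF.sampleKeys (α := ℕ × Data × Data) (κ := fun p => p.1)
    (msk := fun p i => p.2.1.tl.hd.nth i) (P := fun p => p.2.2) hlen hS (by fun_prop)
    (by fun_prop) (by fun_prop)
  have h2 := hD.leftOrRight_PF.comp (g := fun x : (ℕ × Data × Data) × Data =>
    (x.1.1, x.1.2.2, x.1.2.1.hd, x.2, x.1.2.1.tl.tl.toBits)) (by fun_prop)
  refine (PPTF.bind h1 (G := fun p sks => (O.obf p.1 (Circuit.ofData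
    (D.leftOrRight p.1 p.2.2 p.2.1.hd sks p.2.1.tl.tl.toBits).toData)).map Circuit.toData)
    (hO.obf.comp (g := fun x : (ℕ × Data × Data) × Data => (x.1.1, (D.leftOrRight x.1.1 x.1.2.2
      x.1.2.1.hd x.2 x.1.2.1.tl.tl.toBits).toData)) (by fun_prop))).congr fun p => ?_
  rw [PMF.bind_map]
  simp only [Circuit.ofData_toData]
  rfl

theorem PPTF.fakeSK (hlen : PF fun κ : ℕ => len κ) (hS : S.Efficient) (hO : O.Efficient)
    (hD : D.Implement S N Q len) :
    PPTF fun p : ℕ × Data × Data × Data =>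
      (ncabe S N Z O D len).fakeSK p.1 p.2.1 p.2.2.1 p.2.2.2 := by
  have h1 := PPTF.sampleKeys (α := ℕ × Data × Data × Data) (κ := fun p => p.1)
    (msk := fun p i => (p.2.2.1.tl.tl.hd.nth i).hd) (P := fun p => p.2.2.2) hlen hS (by fun_prop)
    (by fun_prop) (by fun_prop)
  have h2 := hD.left_PF.comp (g := fun x : (ℕ × Data × Data × Data) × Data =>
    (x.1.1, x.1.2.2.2, x.1.2.1, x.2)) (by fun_prop)
  refine (PPTF.bind h1 (G := fun p sks => (O.obf p.1 (Circuit.ofData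
    (D.left p.1 p.2.2.2 p.2.1 sks).toData)).map Circuit.toData)
    (hO.obf.comp (g := fun x : (ℕ × Data × Data × Data) × Data => (x.1.1, (D.left x.1.1 x.1.2.2.2
      x.1.2.1 x.2).toData)) (by fun_prop))).congr fun p => ?_
  rw [PMF.bind_map]
  simp only [Circuit.ofData_toData]
  rfl

/-- The randomness of a double encryption. -/
theorem PPTF.encCoins (hlen : PF fun κ : ℕ => len κ) (hS : S.Efficient) :
    PPTF fun κ : ℕ => (_root_.sampleVec (len κ) fun _ => _root_.samplePair fun _ =>
      _root_.uniformBits (S.coins κ)).map pairList :=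
  PPTF.sampleVec_pair (F := fun κ _ _ => _root_.uniformBits (S.coins κ)) hlen
    (PPTF.uniformBits (hS.coins.comp (g := fun p : ℕ × ℕ × Bool => p.1) (by fun_prop)))

theorem ofBits_ofFn_getD (m : List Bool) (n : ℕ) :
    Data.ofBits (List.ofFn fun i : Fin n => m.getD i false) =
      Data.vec fun i : Fin n => Data.ofBool (m.getD i false) := by
  simp [Data.ofBits, Data.vec, List.map_ofFn, Function.comp_def]

theorem PPTF.ncEnc (hlen : PF fun κ : ℕ => len κ) (hS : S.Efficient) (hN : N.Efficient) :
    PPTF fun p : ℕ × Data × Data × List Bool =>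
      ncEnc S N len p.1 p.2.1 p.2.2.1 p.2.2.2 := by
  let ctf : ℕ × Data × Data × List Bool → List (List Bool × List Bool) → ℕ → Bool → Data :=
    fun p r i b => S.encWith p.1 ((p.2.1.hd.nth i).sel b) p.2.2.1 (p.2.2.2.getD i false)
      (pairGet [] r i b)
  let ct : ℕ × Data × Data × List Bool → List (List Bool × List Bool) → Data :=
    fun p r => .vec fun i : Fin (len p.1) => .pair fun b => ctf p r i b
  let wit : ℕ × Data × Data × List Bool → List (List Bool × List Bool) → Data := fun p r =>
    .cons (.vec fun i : Fin (len p.1) => Data.ofBool (p.2.2.2.getD i false))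
      (.vec fun i : Fin (len p.1) => .pair fun b => .ofBits (pairGet [] r i b))
  have hct : PF fun x : (ℕ × Data × Data × List Bool) × List (List Bool × List Bool) =>
      ct x.1 x.2 := by
    refine PF.data_vec_pair (α := (ℕ × Data × Data × List Bool) × List (List Bool × List Bool))
      (n := fun x => len x.1.1)
      (g := fun x i b => ctf x.1 x.2 i b) (hlen.comp (by fun_prop)) ?_
    exact PF.encWith_comp hS (by fun_prop) (by fun_prop) (by fun_prop) (by fun_prop) (by fun_prop)
  have hwit : PF fun x : (ℕ × Data × Data × List Bool) × List (List Bool × List Bool) =>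
      wit x.1 x.2 := by
    refine PF.data_cons (PF.data_vec (α := (ℕ × Data × Data × List Bool) × List (List Bool × List Bool))
      (n := fun x => len x.1.1)
      (g := fun x i => Data.ofBool (x.1.2.2.2.getD i false))
      (hlen.comp (by fun_prop)) (by fun_prop)) ?_
    exact PF.data_vec_pair (α := (ℕ × Data × Data × List Bool) × List (List Bool × List Bool))
      (n := fun x => len x.1.1)
      (g := fun x i b => Data.ofBits (pairGet [] x.2 i b))
      (hlen.comp (by fun_prop)) (by fun_prop)
  have h1 := (PPTF.encCoins hlen hS).comp (g := fun p : ℕ × Data × Data × List Bool => p.1)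
    (by fun_prop)
  refine (PPTF.bind h1 (G := fun p r => (N.prove p.1 p.2.1.tl
    (doubleStatement p.2.1.hd (ct p r) p.2.2.1) (wit p r)).map fun π =>
      Data.cons (ct p r) (.cons p.2.2.1 π)) ?_).congr fun p => ?_
  · refine PPTF.map (α := (ℕ × Data × Data × List Bool) × List (List Bool × List Bool))
      (h := fun x π => Data.cons (ct x.1 x.2) (.cons x.1.2.2.1 π))
      (F := fun x => N.prove x.1.1 x.1.2.1.tl (doubleStatement x.1.2.1.hd (ct x.1 x.2) x.1.2.2.1)
        (wit x.1 x.2)) ?_ ?_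
    · refine hN.prove.comp (g := fun x : (ℕ × Data × Data × List Bool) ×
        List (List Bool × List Bool) => (x.1.1, x.1.2.1.tl, doubleStatement x.1.2.1.hd
          (ct x.1 x.2) x.1.2.2.1, wit x.1 x.2)) ?_
      simp only [doubleStatement]
      fun_prop
    · have := hct.comp (g := fun x : ((ℕ × Data × Data × List Bool) ×
        List (List Bool × List Bool)) × Data => x.1) (by fun_prop)
      fun_prop
  · rw [PMF.bind_map]
    change PMF.bind _ _ = PMF.bind _ _
    congr 1
    funext r
    simp only [Function.comp_apply, ct, ctf, wit, pairGet_pairList, ← ofBits_ofFn_getD]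
    rfl

theorem PPTF.encBits (hlen : PF fun κ : ℕ => len κ) (hS : S.Efficient) [Enc α] {κ : α → ℕ}
    {pk : α → ℕ → Bool → Data} {X : α → Data} {m : α → ℕ → Bool → Bool} (hκ : PF κ)
    (hpk : PF fun p : α × ℕ × Bool => pk p.1 p.2.1 p.2.2) (hX : PF X)
    (hm : PF fun p : α × ℕ × Bool => m p.1 p.2.1 p.2.2) :
    PPTF fun a => (_root_.sampleVec (len (κ a)) fun i => _root_.samplePair fun b =>
      S.enc (κ a) (pk a i b) (X a) (m a i b)).map fun ct => Data.vec fun i => .pair (ct i) := by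
  have h1 := PPTF.sampleVec_pair (n := fun a => len (κ a)) (F := fun (a : α) i b =>
    S.enc (κ a) (pk a i b) (X a) (m a i b)) (hlen.comp hκ)
    (hS.enc.comp (g := fun p : α × ℕ × Bool =>
      (κ p.1, pk p.1 p.2.1 p.2.2, X p.1, m p.1 p.2.1 p.2.2)) (by fun_prop))
  refine (PPTF.map (h := fun _ l => Data.ofList (l.map fun e => Data.cons e.1 e.2)) h1
    (by fun_prop)).congr fun a => ?_
  rw [PMF.map_comp]
  congr 1
  funext ct
  simp only [Function.comp_apply, pairList, List.map_ofFn, Data.vec]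
  rfl

theorem PPTF.fakeCT (hlen : PF fun κ : ℕ => len κ) (hS : S.Efficient) (hZ : Z.Efficient) :
    PPTF fun p : ℕ × Data × Data × Data =>
      (ncabe S N Z O D len).fakeCT p.1 p.2.1 p.2.2.1 p.2.2.2 := by
  have h1 := PPTF.encBits (α := ℕ × Data × Data × Data) (κ := fun p => p.1)
    (pk := fun p i b => (p.2.1.hd.nth i).sel b) (X := fun p => p.2.2.2)
    (m := fun p i b => b != (p.2.2.1.tl.tl.tl.nth i).toBool) hlen hS (by fun_prop) (by fun_prop)
    (by fun_prop) (by fun_prop)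
  refine (PPTF.bind h1 (G := fun p ct => (Z.sim₂ p.1 p.2.1.tl p.2.2.1.tl.hd
    (doubleStatement p.2.1.hd ct p.2.2.2)).map fun π => Data.cons ct (.cons p.2.2.2 π)) ?_).congr
    fun p => ?_
  · refine PPTF.map (α := (ℕ × Data × Data × Data) × Data)
      (h := fun x π => Data.cons x.2 (.cons x.1.2.2.2 π)) (F := fun x => Z.sim₂ x.1.1 x.1.2.1.tl
        x.1.2.2.1.tl.hd (doubleStatement x.1.2.1.hd x.2 x.1.2.2.2)) ?_ (by fun_prop)
    refine hZ.sim₂.comp (g := fun x : (ℕ × Data × Data × Data) × Data => (x.1.1, x.1.2.1.tl,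
      x.1.2.2.1.tl.hd, doubleStatement x.1.2.1.hd x.2 x.1.2.2.2)) ?_
    simp only [doubleStatement]
    fun_prop
  · rw [PMF.bind_map]
    rfl

theorem ncabe_efficient (hlen : PolyTime fun d => .ofNat (len d.toNat)) (hS : S.Efficient)
    (hO : O.Efficient) (hN : N.Efficient) (hZ : Z.Efficient) (hD : D.Implement S N Q len) :
    (ncabe S N Z O D len).Efficient := by
  have hl := PF.of_len hlen
  refine ⟨?_, ?_, ?_, ?_, ?_, ?_, ?_, ?_⟩
  · exact (PPTF.map (h := fun _ k => Data.cons k.1 k.2) ((PPTF.ncSetup hl hS hN).comp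
      (g := fun d : Data => d.toNat) (by fun_prop)) (by fun_prop)).toPPT
  · exact ((PPTF.keyGen hl hS hO hD).comp
      (g := fun d : Data => (d.hd.toNat, d.tl.hd, d.tl.tl)) (by fun_prop)).toPPT
  · exact ((PPTF.ncEnc hl hS hN).comp (g := fun d : Data =>
      (d.hd.toNat, d.tl.hd, d.tl.tl.hd, d.tl.tl.tl.toBits)) (by fun_prop)).toPPT
  · rw [polyTime_iff_PF]
    exact (PF.circuit_evalData (f := fun d : Data => d.tl.hd) (g := fun d => d.tl.tl)
      (by fun_prop) (by fun_prop)).enc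
  · exact (PPTF.map (h := fun _ k => Data.cons k.1 k.2) ((PPTF.fakeSetup hl hS hZ).comp
      (g := fun d : Data => d.toNat) (by fun_prop)) (by fun_prop)).toPPT
  · exact ((PPTF.fakeCT hl hS hZ).comp (g := fun d : Data =>
      (d.hd.toNat, d.tl.hd, d.tl.tl.hd, d.tl.tl.tl)) (by fun_prop)).toPPT
  · exact ((PPTF.fakeSK hl hS hO hD).comp (g := fun d : Data =>
      (d.hd.toNat, d.tl.hd, d.tl.tl.hd, d.tl.tl.tl)) (by fun_prop)).toPPT
  · refine (PPTF.pure (α := Data) ?_).toPPT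
    have h1 : PF fun d : Data => Data.vec fun i : Fin (len d.hd.toNat) =>
        (d.tl.tl.hd.tl.tl.hd.nth i).sel
          ((d.tl.tl.hd.tl.tl.tl.nth i).toBool ^^ d.tl.tl.tl.tl.toBits.getD i false) :=
      PF.data_vec (α := Data) (n := fun d => len d.hd.toNat)
        (g := fun d i => (d.tl.tl.hd.tl.tl.hd.nth i).sel
          ((d.tl.tl.hd.tl.tl.tl.nth i).toBool ^^ d.tl.tl.tl.tl.toBits.getD i false))
        (hl.comp (by fun_prop)) (by fun_prop)
    have h2 : PF fun d : Data => Data.vec fun i : Fin (len d.hd.toNat) =>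
        Data.ofBool ((d.tl.tl.hd.tl.tl.tl.nth i).toBool ^^ d.tl.tl.tl.tl.toBits.getD i false) :=
      PF.data_vec (α := Data) (n := fun d => len d.hd.toNat) (g := fun d i => Data.ofBool
          ((d.tl.tl.hd.tl.tl.tl.nth i).toBool ^^ d.tl.tl.tl.tl.toBits.getD i false))
        (hl.comp (by fun_prop)) (by fun_prop)
    have h3 : PF fun d : Data => d.tl.tl.hd.hd := by fun_prop
    refine (h3.data_cons (h1.data_cons h2)).congr fun d => ?_
    simp only [Data.ofBits, Data.vec, List.map_ofFn]
    rfl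

end

/-! ### Supports -/

theorem PMF.toOuterMeasure_ne_top {α : Type} (p : PMF α) (s : Set α) :
    p.toOuterMeasure s ≠ ⊤ :=
  ne_top_of_le_ne_top ENNReal.one_ne_top ((p.toOuterMeasure.mono (Set.subset_univ s)).trans_eq
    ((p.toOuterMeasure_apply_eq_one_iff _).2 (Set.subset_univ _)))

theorem pr_eq_zero_iff {α : Type} {p : PMF α} {E : α → Prop} :
    pr p E = 0 ↔ ∀ a ∈ p.support, ¬ E a := by
  rw [pr, ENNReal.toReal_eq_zero_iff, or_iff_left (p.toOuterMeasure_ne_top _),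
    PMF.toOuterMeasure_apply_eq_zero_iff, Set.disjoint_left]
  rfl

theorem of_pr_eq_one {α : Type} {p : PMF α} {E : α → Prop} (h : pr p E = 1) :
    ∀ a ∈ p.support, E a := by
  rw [pr, ENNReal.toReal_eq_one_iff, PMF.toOuterMeasure_apply_eq_one_iff] at h
  exact fun a ha => h ha

theorem mem_support_sampleVec {τ : Type} : ∀ {n : ℕ} {p : Fin n → PMF τ} {v : Fin n → τ},
    v ∈ (sampleVec n p).support ↔ ∀ i, v i ∈ (p i).support
  | 0, p, v => by
    simp only [sampleVec, PMF.support_pure, Set.mem_singleton_iff]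
    exact ⟨fun _ i => i.elim0, fun _ => funext fun i => i.elim0⟩
  | n + 1, p, v => by
    simp only [sampleVec, PMF.mem_support_bind_iff, PMF.mem_support_map_iff,
      mem_support_sampleVec]
    constructor
    · rintro ⟨a, ha, w, hw, rfl⟩ i
      refine Fin.cases ?_ (fun i => ?_) i
      · simpa using ha
      · simpa using hw i
    · intro h
      exact ⟨v 0, h 0, fun i => v i.succ, fun i => h i.succ, Fin.cons_self_tail v⟩

theorem mem_support_samplePair {τ : Type} {p : Bool → PMF τ} {v : Bool → τ} :
    v ∈ (samplePair p).support ↔ ∀ b, v b ∈ (p b).support := by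
  simp only [samplePair, PMF.mem_support_bind_iff, PMF.mem_support_map_iff]
  constructor
  · rintro ⟨a, ha, b, hb, rfl⟩ c
    cases c
    · simpa using ha
    · simpa using hb
  · intro h
    refine ⟨_, h false, _, h true, ?_⟩
    funext b
    cases b <;> rfl

theorem mem_support_ncSetup {S : ABE} {N : NIZK} {len : ℕ → ℕ} {κ : ℕ} {x : Data × Data} :
    x ∈ (ncSetup S N len κ).support ↔ ∃ (k : Fin (len κ) → Bool → Data × Data)
      (z : Fin (len κ) → Bool) (crs : Data), (∀ i b, k i b ∈ (S.setup κ).support) ∧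
      crs ∈ (N.setup κ).support ∧
      x = (.cons (.vec fun i => .pair fun b => (k i b).1) crs,
        .cons (.cons (.vec fun i => .pair fun b => (k i b).1) crs)
          (.cons (.vec fun i => (k i (z i)).2) (.ofBits (List.ofFn z)))) := by
  change x ∈ (PMF.bind _ _).support ↔ _
  rw [PMF.mem_support_bind_iff]
  constructor
  · rintro ⟨k, hk, hx⟩
    change x ∈ (PMF.bind _ _).support at hx
    rw [PMF.mem_support_bind_iff] at hx
    obtain ⟨z, -, hx⟩ := hx
    change x ∈ (PMF.bind _ _).support at hx
    rw [PMF.mem_support_bind_iff] at hx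
    obtain ⟨crs, hcrs, hx⟩ := hx
    change x ∈ (PMF.pure _).support at hx
    rw [PMF.mem_support_pure_iff] at hx
    exact ⟨k, z, crs, fun i => mem_support_samplePair.1 (mem_support_sampleVec.1 hk i), hcrs, hx⟩
  · rintro ⟨k, z, crs, hk, hcrs, rfl⟩
    refine ⟨k, mem_support_sampleVec.2 fun i => mem_support_samplePair.2 (hk i), ?_⟩
    change _ ∈ (PMF.bind _ _).support
    rw [PMF.mem_support_bind_iff]
    refine ⟨z, by simp, ?_⟩
    change _ ∈ (PMF.bind _ _).support
    rw [PMF.mem_support_bind_iff]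
    refine ⟨crs, hcrs, ?_⟩
    change _ ∈ (PMF.pure _).support
    rw [PMF.mem_support_pure_iff]

/-! ### Codes of trees and circuits for functions of trees -/

/-- Code words are self-delimiting: reading stops at the end of the first word, whatever follows.
The nesting of recursive calls is bounded by the size of the tree. -/
theorem Data.read_code (d : Data) (x : List Bool) (n : ℕ) (h : d.size ≤ n) :
    Data.read n (d.code ++ x) = some (d, x) := by
  induction d generalizing x n with
  | nil =>
    obtain ⟨n, rfl⟩ := Nat.exists_eq_add_of_le' h
    rfl
  | cons a b ha hb =>
    simp only [Data.size] at h
    obtain ⟨n, rfl⟩ := Nat.exists_eq_add_of_le' (show 1 ≤ n by omega)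
    simp only [Data.code, List.cons_append, List.append_assoc, Data.read]
    rw [ha _ _ (by omega)]
    simp only [Option.bind_some]
    rw [hb _ _ (by omega)]
    rfl

theorem Data.decode_code (d : Data) (x : List Bool) : Data.decode (d.code ++ x) = some d := by
  rw [Data.decode, Data.read_code]
  · rfl
  · rw [List.length_append, Data.length_code]
    omega

/-- The zeros of the padding follow a complete code word and are ignored by `Data.decode`. Passing
to an equivalent circuit, as obfuscation does, changes nothing. -/
theorem Circuit.Implements.evalData_eq {C C' : Circuit} {n len : ℕ} {f : Data → Option (List Bool)}
    (h : C.Implements n len f) (h' : C'.Equivalent C) {d : Data} (hd : d.code.length ≤ n) :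
    C'.evalData d = f d := by
  obtain ⟨-, hn, hC⟩ := h
  obtain ⟨hi, he⟩ := h'
  rw [Circuit.evalData, hi, hn, if_pos hd, he, hC, Data.decode_code]
  · rw [Option.bind_some]
    cases f d <;> rfl
  all_goals
    simp only [List.length_append, List.length_replicate]
    omega

theorem Circuit.Implements.equivalent {C C' : Circuit} {n len : ℕ}
    {f f' : Data → Option (List Bool)} (h : C.Implements n len f) (h' : C'.Implements n len f')
    (hf : ∀ d, f d = f' d) : C.Equivalent C' := by
  refine ⟨h.2.1.trans h'.2.1.symm, fun x hx => ?_⟩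
  rw [h.2.2 x (hx.trans h.2.1), h'.2.2 x (hx.trans h.2.1), funext hf]

/-! ### Correctness -/

theorem joinBits_eq_some {n : ℕ} {f : Fin n → Option Bool} {m : Fin n → Bool}
    (h : ∀ i, f i = some (m i)) : joinBits f = some (List.ofFn m) := by
  simp [joinBits, h]

theorem joinBits_eq_none {n : ℕ} {f : Fin n → Option Bool} (i : Fin n)
    (h : f i = none) : joinBits f = none := by
  rw [joinBits, if_neg]
  exact fun H => by simpa [h] using H i

theorem joinBits_congr {n : ℕ} {f g : Fin n → Option Bool} (h : ∀ i, f i = g i) :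
    joinBits f = joinBits g := congrArg _ (funext h)

/-- Failure with probability zero excludes failure for every single choice of coins, since all
strings of length `S.coins κ` lie in the support. This form also applies to ciphertexts that
somebody else has produced with unknown coins, as long as such coins exist. -/
theorem ABE.PerfectlyCorrect.dec_eq {S : ABE} {Q : PolicyClass} (h : S.PerfectlyCorrect Q)
    {κ : ℕ} {P X : Data} {m : Bool} (hP : Q.pol κ P = true) (hX : Q.attr κ X = true)
    {k : Data × Data} (hk : k ∈ (S.setup κ).support) {sk : Data}
    (hsk : sk ∈ (S.keyGen κ k.2 P).support) {r : List Bool} (hr : r.length = S.coins κ) :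
    S.dec κ sk (S.encWith κ k.1 X m r) = if Q.sat κ P X then some m else none := by
  have hmem : S.dec κ sk (S.encWith κ k.1 X m r) ∈ (S.roundTrip κ P X m).support := by
    change _ ∈ (PMF.bind _ _).support
    rw [PMF.mem_support_bind_iff]
    refine ⟨k, hk, ?_⟩
    change _ ∈ (PMF.bind _ _).support
    rw [PMF.mem_support_bind_iff]
    refine ⟨sk, hsk, ?_⟩
    change _ ∈ (PMF.bind _ _).support
    rw [PMF.mem_support_bind_iff]
    refine ⟨S.encWith κ k.1 X m r, ?_, ?_⟩
    · rw [ABE.enc, PMF.mem_support_map_iff]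
      exact ⟨r, mem_uniformBits hr, rfl⟩
    · change _ ∈ (PMF.pure _).support
      rw [PMF.mem_support_pure_iff]
  obtain ⟨h1, h2⟩ := h κ P X m hP hX
  cases hs : Q.sat κ P X
  · simpa using pr_eq_zero_iff.1 (h2 hs) _ hmem
  · simpa using pr_eq_zero_iff.1 (h1 hs) _ hmem

theorem NIZK.Complete.vrfy_eq {N : NIZK} {R : ℕ → Data → Data → Prop} (h : N.Complete R)
    {κ : ℕ} {x w : Data} (hR : R κ x w) {crs : Data} (hcrs : crs ∈ (N.setup κ).support)
    {π : Data} (hπ : π ∈ (N.prove κ crs x w).support) : N.vrfy κ crs x π = true := by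
  refine of_pr_eq_one (h κ x w hR) (N.vrfy κ crs x π) ?_
  change _ ∈ (PMF.bind _ _).support
  rw [PMF.mem_support_bind_iff]
  refine ⟨crs, hcrs, ?_⟩
  change _ ∈ (PMF.bind _ _).support
  rw [PMF.mem_support_bind_iff]
  refine ⟨π, hπ, ?_⟩
  change _ ∈ (PMF.pure _).support
  rw [PMF.mem_support_pure_iff]

section
variable {Q : PolicyClass} {len : ℕ → ℕ} {S : ABE} {O : Obfuscator} {N : NIZK}
  {Z : NIZKSimulator} {D : DecCircuits}

/-- On the supports, the obfuscated circuit is equivalent to left-or-right decryption, the proof is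
accepted by completeness, and each component is decrypted with the key that belongs to its index `z
i`. -/
theorem ncabe_correct (hcorrect : S.PerfectlyCorrect Q) (hO : O.Functional)
    (hN : N.Complete (doubleRelation S Q len)) (hD : D.Implement S N Q len) :
    (ncabe S N Z O D len).PerfectlyCorrect Q len := by
  intro κ P X m hP hX hm
  have key : ∀ x ∈ ((ncabe S N Z O D len).roundTrip κ P X m).support,
      (Q.sat κ P X = true → x = some m) ∧ (Q.sat κ P X = false → 0 < len κ → x = none) := by
    intro x hx
    change _ ∈ (PMF.bind _ _).support at hx
    rw [PMF.mem_support_bind_iff] at hx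
    obtain ⟨km, hkm, hx⟩ := hx
    change _ ∈ (PMF.bind _ _).support at hx
    rw [PMF.mem_support_bind_iff] at hx
    obtain ⟨sk, hsk, hx⟩ := hx
    change _ ∈ (PMF.bind _ _).support at hx
    rw [PMF.mem_support_bind_iff] at hx
    obtain ⟨ct, hct, hx⟩ := hx
    change _ ∈ (PMF.pure _).support at hx
    rw [PMF.mem_support_pure_iff] at hx
    subst hx
    have hctlen := hD.inLen_ge κ km hkm X m hX hm ct hct
    obtain ⟨k, z, crs, hk, hcrs, rfl⟩ := mem_support_ncSetup.1 hkm
    change _ ∈ (PMF.bind _ _).support at hsk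
    rw [PMF.mem_support_bind_iff] at hsk
    obtain ⟨sks, hsks, hsk⟩ := hsk
    change _ ∈ (PMF.bind _ _).support at hsk
    rw [PMF.mem_support_bind_iff] at hsk
    obtain ⟨C, hC, hsk⟩ := hsk
    change _ ∈ (PMF.pure _).support at hsk
    rw [PMF.mem_support_pure_iff] at hsk
    subst hsk
    rw [mem_support_sampleVec] at hsks
    simp only [Data.hd_cons, Data.tl_cons, Data.nth_vec, Data.toBits_ofBits] at hsks hC
    have hspec := hD.leftOrRight_spec κ P
      (.cons (.vec fun i => .pair fun b => (k i b).1) crs) (.vec sks) (List.ofFn z)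
    have hC' := of_pr_eq_one (hO κ _ hspec.1) C hC
    change _ ∈ (PMF.bind _ _).support at hct
    rw [PMF.mem_support_bind_iff] at hct
    obtain ⟨r, hr, hct⟩ := hct
    change _ ∈ (PMF.bind _ _).support at hct
    rw [PMF.mem_support_bind_iff] at hct
    obtain ⟨π, hπ, hct⟩ := hct
    change _ ∈ (PMF.pure _).support at hct
    rw [PMF.mem_support_pure_iff] at hct
    subst hct
    have hr' : ∀ i b, (r i b).length = S.coins κ := fun i b => length_of_mem_uniformBits
      (mem_support_samplePair.1 (mem_support_sampleVec.1 hr i) b)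
    simp only [Data.hd_cons, Data.tl_cons, Data.nth_vec, Data.sel_pair] at hπ hctlen
    have hv := hN.vrfy_eq (κ := κ) ⟨_, _, X, fun i => m.getD i false, r, rfl, rfl, hX,
      fun i b => ⟨hr' i b, rfl⟩⟩ hcrs hπ
    have hval : (Circuit.ofData C.toData).evalData (ncCiphertext
        (fun i b => S.encWith κ (k i b).1 X (m.getD i false) (r i b)) X π) =
        joinBits fun i : Fin (len κ) => if Q.sat κ P X then some (m.getD i false) else none := by
      rw [Circuit.ofData_toData, hspec.evalData_eq hC' hctlen]
      refine (if_pos hv).trans (joinBits_congr fun i => ?_)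
      simp only [ncCiphertext, Data.hd_cons, Data.nth_vec, Data.sel_pair]
      have hz : (List.ofFn z).getD i false = z i := by simp
      rw [hz]
      exact hcorrect.dec_eq hP hX (hk i (z i)) (hsks i) (hr' i (z i))
    have hdec : ∀ ct, (ncabe S N Z O D len).dec κ C.toData ct =
      (Circuit.ofData C.toData).evalData ct := fun _ => rfl
    simp only [Data.hd_cons, Data.nth_vec, Data.sel_pair]
    rw [hdec, hval]
    refine ⟨fun hs => ?_, fun hs hl => ?_⟩
    · rw [joinBits_eq_some (m := fun i : Fin (len κ) => m.getD i false) fun i => by simp [hs]]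
      congr 1
      refine List.ext_getElem (by simp [hm]) fun i h1 h2 => ?_
      simp [h2]
    -- A single `⊥` spoils the concatenation, but there must be a component at all; hence the
    -- hypothesis `0 < len κ`.
    · exact joinBits_eq_none ⟨0, hl⟩ (by simp [hs])
  refine ⟨fun hs => pr_eq_zero_iff.2 fun x hx => ?_, fun hs hl => pr_eq_zero_iff.2 fun x hx => ?_⟩
  · simpa using (key x hx).1 hs
  · simpa using (key x hx).2 hs hl

end

/-! ### Probabilities of output bits -/

/-- The probability that the output is `1`. -/
noncomputable def prT (p : PMF Bool) : ℝ := (p true).toReal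

theorem pr_eq_prT (p : PMF Bool) : pr p (· = true) = prT p := by
  rw [pr, prT, ← PMF.toOuterMeasure_apply_singleton]
  rfl

theorem prT_nonneg (p : PMF Bool) : 0 ≤ prT p := ENNReal.toReal_nonneg

theorem prT_le_one (p : PMF Bool) : prT p ≤ 1 :=
  ENNReal.toReal_le_of_le_ofReal zero_le_one (by simpa using p.coe_le_one true)

theorem summable_toReal {α : Type} (p : PMF α) : Summable fun a => (p a).toReal :=
  ENNReal.summable_toReal p.tsum_coe_ne_top

theorem tsum_toReal {α : Type} (p : PMF α) : ∑' a, (p a).toReal = 1 := by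
  rw [← ENNReal.tsum_toReal_eq fun a => p.apply_ne_top a, p.tsum_coe, ENNReal.toReal_one]

theorem prT_bind {α : Type} (p : PMF α) (f : α → PMF Bool) :
    prT (p.bind f) = ∑' a, (p a).toReal * prT (f a) := by
  rw [prT, PMF.bind_apply, ENNReal.tsum_toReal_eq]
  · simp [prT, ENNReal.toReal_mul]
  · exact fun a => ENNReal.mul_ne_top (p.apply_ne_top a) ((f a).apply_ne_top true)

theorem summable_mul_prT {α : Type} (p : PMF α) (f : α → PMF Bool) :
    Summable fun a => (p a).toReal * prT (f a) :=
  Summable.of_nonneg_of_le (fun _ => mul_nonneg ENNReal.toReal_nonneg (prT_nonneg _))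
    (fun _ => mul_le_of_le_one_right ENNReal.toReal_nonneg (prT_le_one _)) (summable_toReal p)

theorem abs_prT_sub_le_one (p q : PMF Bool) : |prT p - prT q| ≤ 1 := by
  rw [abs_le]
  constructor <;> linarith [prT_nonneg p, prT_nonneg q, prT_le_one p, prT_le_one q]

theorem prT_bind_sub_le_tsum {α : Type} (p : PMF α) (f g : α → PMF Bool) (h : α → ℝ)
    (hs : Summable fun a => (p a).toReal * h a)
    (hh : ∀ a ∈ p.support, |prT (f a) - prT (g a)| ≤ h a) :
    |prT (p.bind f) - prT (p.bind g)| ≤ ∑' a, (p a).toReal * h a := by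
  rw [prT_bind, prT_bind, ← (summable_mul_prT p f).tsum_sub (summable_mul_prT p g)]
  have hle : ∀ a, ‖(p a).toReal * prT (f a) - (p a).toReal * prT (g a)‖ ≤ (p a).toReal * h a := by
    intro a
    rw [← mul_sub, norm_mul, Real.norm_eq_abs, Real.norm_eq_abs, abs_of_nonneg
      ENNReal.toReal_nonneg]
    by_cases ha : a ∈ p.support
    · exact mul_le_mul_of_nonneg_left (hh a ha) ENNReal.toReal_nonneg
    · rw [PMF.mem_support_iff, not_not] at ha
      simp [ha]
  exact tsum_of_norm_bounded hs.hasSum hle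

theorem prT_bind_sub_le {α : Type} (p : PMF α) (f g : α → PMF Bool) (ε : ℝ)
    (hh : ∀ a ∈ p.support, |prT (f a) - prT (g a)| ≤ ε) :
    |prT (p.bind f) - prT (p.bind g)| ≤ ε := by
  refine (prT_bind_sub_le_tsum p f g (fun _ => ε) ((summable_toReal p).mul_right ε) hh).trans ?_
  rw [tsum_mul_right, tsum_toReal, one_mul]

theorem pr_eq_tsum {α : Type} (p : PMF α) (E : α → Prop) [DecidablePred E] :
    pr p E = ∑' a, (p a).toReal * (if E a then 1 else 0) := by
  rw [pr, PMF.toOuterMeasure_apply, ENNReal.tsum_toReal_eq]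
  · refine tsum_congr fun a => ?_
    by_cases h : E a <;> simp [Set.indicator, h]
  · intro a
    by_cases h : E a <;> simp [Set.indicator, h, p.apply_ne_top]

/-- Differences are averaged, apart from an exceptional event. -/
theorem prT_bind_sub_le_add {α : Type} (p : PMF α) (f g : α → PMF Bool) (E : α → Prop) (ε : ℝ)
    (hε : 0 ≤ ε) (hh : ∀ a ∈ p.support, ¬ E a → |prT (f a) - prT (g a)| ≤ ε) :
    |prT (p.bind f) - prT (p.bind g)| ≤ pr p E + ε := by
  classical
  have hs : Summable fun a => (p a).toReal * (if E a then (1 : ℝ) else 0) :=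
    Summable.of_nonneg_of_le (fun _ => mul_nonneg ENNReal.toReal_nonneg (by positivity))
      (fun _ => mul_le_of_le_one_right ENNReal.toReal_nonneg (by split_ifs <;> norm_num))
      (summable_toReal p)
  have hs' : Summable fun a => (p a).toReal * ε := (summable_toReal p).mul_right ε
  refine (prT_bind_sub_le_tsum p f g (fun a => (if E a then (1 : ℝ) else 0) + ε) ?_ ?_).trans ?_
  · simp only [mul_add]
    exact hs.add hs'
  · intro a ha
    by_cases h : E a
    · simp only [h, if_true]
      linarith [abs_prT_sub_le_one (f a) (g a)]
    · simpa [h] using hh a ha h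
  · simp only [mul_add]
    rw [hs.tsum_add hs', tsum_mul_right, tsum_toReal, one_mul, pr_eq_tsum]

/-- Some value has at least half of the average difference. -/
theorem exists_prT_bind_sub_le {α : Type} (p : PMF α) (f g : α → PMF Bool) :
    ∃ a ∈ p.support, |prT (p.bind f) - prT (p.bind g)| ≤ 2 * |prT (f a) - prT (g a)| := by
  by_contra! H
  obtain ⟨a, ha⟩ := p.support_nonempty
  have h1 := H a ha
  -- If every value had less than half of the average difference, the average would be at most half
  -- of itself. The factor 2 makes strict inequalities between infinite sums unnecessary.
  have h2 := prT_bind_sub_le p f g (|prT (p.bind f) - prT (p.bind g)| / 2)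
    fun b hb => by linarith [H b hb]
  linarith [abs_nonneg (prT (f a) - prT (g a))]

/-! ### Negligible functions -/

/-- For `n ≥ 1` one has `p(n) ≤ p(1) * n ^ deg p`, and the constant `p(1)` is absorbed by one more
factor `n` as soon as `n > p(1)`. -/
theorem Polynomial.eval_le_pow (p : Polynomial ℕ) :
    ∃ e M : ℕ, ∀ n, M < n → p.eval n ≤ n ^ e := by
  refine ⟨p.natDegree + 1, p.eval 1, fun n hn => ?_⟩
  rw [Polynomial.eval_eq_sum, Polynomial.sum, pow_succ']
  rw [Polynomial.eval_eq_sum, Polynomial.sum] at hn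
  simp only [one_pow, mul_one] at hn
  refine le_trans ?_ (Nat.mul_le_mul_right _ hn.le)
  rw [Finset.sum_mul]
  refine Finset.sum_le_sum fun i hi => Nat.mul_le_mul_left _ (Nat.pow_le_pow_right (by omega) ?_)
  exact Polynomial.le_natDegree_of_mem_supp i hi

theorem Negligible.mono {f g : ℕ → ℝ} (hf : Negligible f) (h : ∀ n, g n ≤ f n) : Negligible g :=
  fun c => (hf c).imp fun _ hN n hn => (h n).trans_lt (hN n hn)

theorem Negligible.poly_mul {f : ℕ → ℝ} (hf : Negligible f) (p : Polynomial ℕ)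
    (h0 : ∀ n, 0 ≤ f n) : Negligible fun n => ((p.eval n : ℕ) : ℝ) * f n := by
  intro c
  obtain ⟨e, M, hp⟩ := p.eval_le_pow
  obtain ⟨N, hN⟩ := hf (c + e)
  refine ⟨max M N, fun n hn => ?_⟩
  have h1 := hN n (lt_of_le_of_lt (le_max_right _ _) hn)
  have h2 : ((p.eval n : ℕ) : ℝ) ≤ (n : ℝ) ^ e := by
    exact_mod_cast hp n (lt_of_le_of_lt (le_max_left _ _) hn)
  have hn0 : (0 : ℝ) < n := by exact_mod_cast (Nat.zero_le _).trans_lt hn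
  calc ((p.eval n : ℕ) : ℝ) * f n ≤ (n : ℝ) ^ e * f n := mul_le_mul_of_nonneg_right h2 (h0 n)
    _ < (n : ℝ) ^ e * ((n : ℝ) ^ (c + e))⁻¹ := mul_lt_mul_of_pos_left h1 (by positivity)
    _ = ((n : ℝ) ^ c)⁻¹ := by rw [pow_add]; field_simp

theorem Negligible.const_mul {f : ℕ → ℝ} (hf : Negligible f) (a : ℕ) (h0 : ∀ n, 0 ≤ f n) :
    Negligible fun n => (a : ℝ) * f n := by
  simpa using hf.poly_mul (Polynomial.C a) h0

theorem Negligible.add {f g : ℕ → ℝ} (hf : Negligible f) (hg : Negligible g)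
    (h0 : ∀ n, 0 ≤ f n) : Negligible fun n => f n + g n := by
  have h : Negligible fun n => max (f n) (g n) := by
    intro c
    obtain ⟨N, hN⟩ := hf c
    obtain ⟨M, hM⟩ := hg c
    exact ⟨max N M, fun n hn => max_lt (hN n (lt_of_le_of_lt (le_max_left _ _) hn))
      (hM n (lt_of_le_of_lt (le_max_right _ _) hn))⟩
  refine (h.const_mul 2 fun n => le_max_of_le_left (h0 n)).mono fun n => ?_
  push_cast
  linarith [le_max_left (f n) (g n), le_max_right (f n) (g n)]

theorem Negligible.add_abs {f g : ℕ → ℝ} (hf : Negligible fun n => |f n|)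
    (hg : Negligible fun n => |g n|) : Negligible fun n => |f n + g n| :=
  (hf.add hg fun _ => abs_nonneg _).mono fun _ => abs_add_le _ _

/-! ### Runs of adversaries -/

namespace QAction

/-- Actions that do not involve the challenger and do not stop the machine. -/
def IsLocal : QAction → Prop
  | .send _ => False
  | .output _ => False
  | _ => True

/-- The answer to a local action together with the new state of the register. -/
noncomputable def localStep {n : ℕ} (a : QAction) (ψ : QState n) : PMF (Data × QState n) :=
  match a with
  | .toss => (PMF.uniformOfFintype Bool).map fun b => (.ofBool b, ψ)
  | .measure i =>
    if h : i < n then (QState.measure ⟨i, h⟩ ψ).map fun p => (.ofBool p.1, p.2)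
    else PMF.pure (.nil, ψ)
  | a => PMF.pure (.nil, a.apply ψ)

theorem kind (a : QAction) : (∃ b, a = .output b) ∨ (∃ q, a = .send q) ∨ a.IsLocal := by
  cases a <;> simp [IsLocal]

theorem size_localStep {n : ℕ} (a : QAction) (ψ : QState n) :
    ∀ p ∈ (a.localStep ψ).support, p.1.size ≤ 3 := by
  have hb : ∀ b, (Data.ofBool b).size ≤ 3 := esize_bool
  intro p hp
  cases a <;> simp only [localStep] at hp
  case toss => obtain ⟨b, -, rfl⟩ := (PMF.mem_support_map_iff _ _ _).1 hp; exact hb b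
  case measure i =>
    split_ifs at hp
    · obtain ⟨b, -, rfl⟩ := (PMF.mem_support_map_iff _ _ _).1 hp; exact hb _
    · rw [PMF.mem_support_pure_iff] at hp
      subst hp
      simp [Data.size]
  all_goals
    rw [PMF.mem_support_pure_iff] at hp
    subst hp
    simp [Data.size]

/-- The message that is sent (for other actions the value is irrelevant). -/
def payload (a : QAction) : Data := a.toData.tl

def isSend (a : QAction) : Bool := a.toData.hd.toNat == 5

@[simp] theorem isSend_send (q : Data) : (send q).isSend = true := by
  simp [isSend, toData]

theorem isSend_of_isLocal {a : QAction} (h : a.IsLocal) : a.isSend = false := by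
  cases a <;> first | exact h.elim | simp [isSend, toData]

@[simp] theorem isSend_output (b : Bool) : (output b).isSend = false := by
  simp [isSend, toData]

end QAction

instance : Enc QAction := ⟨QAction.toData⟩

namespace Adversary

variable (A : Adversary) {C : Challenger} {b k : ℕ} {n : ℕ} {s : C.State} {m : Data} {ψ : QState n}

theorem run_zero : A.run C b 0 s m ψ = PMF.pure false := by rw [run]

theorem run_of_lt (h : b < m.size) : A.run C b k s m ψ = PMF.pure false := by
  cases k with
  | zero => rw [run]
  | succ k => rw [run, if_pos h]

theorem run_output (h : ¬ b < m.size) {x : Bool} (hx : (A.control m).2 = .output x) :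
    A.run C b (k + 1) s m ψ = PMF.pure x := by
  rw [run, if_neg h]
  simp only [hx]

theorem run_send (h : ¬ b < m.size) {q : Data} (hq : (A.control m).2 = .send q) :
    A.run C b (k + 1) s m ψ = (C.reply s q).bind fun p =>
      A.run C b k p.1 (.cons (A.control m).1 p.2) ψ := by
  rw [run, if_neg h]
  simp only [hq]

theorem run_local (h : ¬ b < m.size) (ha : (A.control m).2.IsLocal) :
    A.run C b (k + 1) s m ψ = ((A.control m).2.localStep ψ).bind fun p =>
      A.run C b k s (.cons (A.control m).1 p.1) p.2 := by
  rw [run, if_neg h]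
  generalize (A.control m).2 = a at *
  cases a
  case send => simp [QAction.IsLocal] at ha
  case output => simp [QAction.IsLocal] at ha
  case toss => simp only [QAction.localStep, PMF.bind_map]; rfl
  case measure i =>
    simp only [QAction.localStep]
    split_ifs
    · rw [PMF.bind_map]; rfl
    · rw [PMF.pure_bind]
  all_goals simp only [QAction.localStep, PMF.pure_bind]

/-- A functional bisimulation between two challengers, with an invariant that may depend on the
number of remaining steps. -/
theorem run_bisim {C C' : Challenger} (φ : C'.State → C.State) (I : ℕ → C'.State → Prop)
    (b qb : ℕ) (hqb : ∀ m : Data, m.size ≤ b → (A.control m).2.payload.size ≤ qb)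
    (hI : ∀ k s, I (k + 1) s → I k s)
    (h : ∀ k s, I (k + 1) s → ∀ q : Data, q.size ≤ qb →
      C.reply (φ s) q = (C'.reply s q).map (fun p => (φ p.1, p.2)) ∧
        ∀ p ∈ (C'.reply s q).support, I k p.1) :
    ∀ (k : ℕ) (s : C'.State) (m : Data) (ψ : QState n), I k s →
      A.run C b k (φ s) m ψ = A.run C' b k s m ψ := by
  intro k
  induction k with
  | zero => intro s m ψ _; rw [run_zero, run_zero]
  | succ k ih =>
    intro s m ψ hs
    by_cases hm : b < m.size
    · rw [run_of_lt _ hm, run_of_lt _ hm]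
    rcases (A.control m).2.kind with ⟨x, hx⟩ | ⟨q, hq⟩ | hl
    · rw [run_output _ hm hx, run_output _ hm hx]
    · rw [run_send _ hm hq, run_send _ hm hq]
      have hqs := hqb m (by omega)
      rw [hq] at hqs
      obtain ⟨h1, h2⟩ := h k s hs q hqs
      rw [h1, PMF.bind_map]
      exact PMF.bind_congr_support fun p hp => ih p.1 _ ψ (h2 p hp)
    · rw [run_local _ hm hl, run_local _ hm hl]
      exact PMF.bind_congr_support fun p _ => ih s _ p.2 (hI k s hs)

end Adversary

theorem PF.control (A : Adversary) : PF A.control :=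
  ((polyTime_iff_PF _).1 A.control_polyTime).of_enc_eq fun _ => rfl

@[fun_prop]
theorem PF.control_comp (A : Adversary) {α : Type} [Enc α] {f : α → Data} (hf : PF f) :
    PF fun a => A.control (f a) := (PF.control A).comp hf

@[fun_prop]
theorem PF.payload {α : Type} [Enc α] {f : α → QAction} (hf : PF f) : PF fun a => (f a).payload :=
  hf.enc.data_tl

@[fun_prop]
theorem PF.isSend {α : Type} [Enc α] {f : α → QAction} (hf : PF f) : PF fun a => (f a).isSend :=
  hf.enc.data_hd.data_toNat.nat_beq (PF.const 5)

@[fun_prop]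
theorem PF.send {α : Type} [Enc α] {f : α → Data} (hf : PF f) : PF fun a => QAction.send (f a) :=
  ((PF.const (Data.ofNat 5)).data_cons hf).of_enc_eq fun _ => rfl

/-! ### Wrappers: efficient simulation of one challenger with the help of another one -/

/-- A classical machine that sits between an adversary and a challenger.  It has fixed data `c` and
a log of the legal queries.  For a legal query `q` and random bits `ω` it sends `pre c q ω` to the
challenger and converts the answer `a` to `post c q a ω`. -/
structure Wrapper where
  legal : Data → Data → Data → Bool
  pre : Data → Data → Data → Data
  post : Data → Data → Data → Data → Data
  first : Data → Data
  legal_PF : PF fun x : Data × Data × Data => legal x.1 x.2.1 x.2.2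
  pre_PF : PF fun x : Data × Data × Data => pre x.1 x.2.1 x.2.2
  post_PF : PF fun x : Data × Data × Data × Data => post x.1 x.2.1 x.2.2.1 x.2.2.2
  first_PF : PF first

namespace Wrapper

variable (W : Wrapper)

/-- The adversary's view of the challenger `B` behind the wrapper, with `N` fresh random bits for
every legal query. -/
noncomputable def rand (B : Challenger) (N : ℕ) (c : Data) : Challenger where
  State := Data × B.State
  start := B.start.map fun p => ((.nil, p.1), p.2)
  reply := fun ⟨log, s⟩ q =>
    if W.legal c log q then
      (uniformBits N).bind fun r => (B.reply s (W.pre c q (.ofBits r))).map fun p =>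
        ((.cons q log, p.1), .cons .nil (W.post c q p.2 (.ofBits r)))
    else PMF.pure ((log, s), .nil)

/-- The same with the random bits taken from a tape. -/
noncomputable def det (B : Challenger) (c : Data) : Challenger where
  State := (Data × Data) × B.State
  start := B.start.map fun p => ((((.nil, .nil) : Data × Data), p.1), p.2)
  reply := fun ⟨⟨log, tape⟩, s⟩ q =>
    if W.legal c log q then
      (B.reply s (W.pre c q tape.hd)).map fun p =>
        (((.cons q log, tape.tl), p.1), .cons .nil (W.post c q p.2 tape.hd))
    else PMF.pure (((log, tape), s), .nil)

def randState (B : Challenger) (N : ℕ) (c log : Data) (s : B.State) : (W.rand B N c).State :=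
  (log, s)

def detState (B : Challenger) (c log t : Data) (s : B.State) : (W.det B c).State :=
  ((log, t), s)

variable {W} in
theorem rand_reply {B : Challenger} {N : ℕ} {c log q : Data} {s : B.State}
    (h : W.legal c log q = true) : (W.rand B N c).reply (W.randState B N c log s) q =
      (uniformBits N).bind fun r => (B.reply s (W.pre c q (.ofBits r))).map fun p =>
        (W.randState B N c (.cons q log) p.1, .cons .nil (W.post c q p.2 (.ofBits r))) := if_pos h

variable {W} in
theorem rand_reply_illegal {B : Challenger} {N : ℕ} {c log q : Data} {s : B.State}
    (h : ¬ W.legal c log q = true) : (W.rand B N c).reply (W.randState B N c log s) q =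
      PMF.pure (W.randState B N c log s, .nil) := if_neg h

variable {W} in
theorem det_reply {B : Challenger} {c log t q : Data} {s : B.State}
    (h : W.legal c log q = true) : (W.det B c).reply (W.detState B c log t s) q =
      (B.reply s (W.pre c q t.hd)).map fun p =>
        (W.detState B c (.cons q log) t.tl p.1, .cons .nil (W.post c q p.2 t.hd)) := if_pos h

variable {W} in
theorem det_reply_illegal {B : Challenger} {c log t q : Data} {s : B.State}
    (h : ¬ W.legal c log q = true) : (W.det B c).reply (W.detState B c log t s) q =
      PMF.pure (W.detState B c log t s, .nil) := if_neg h

/-- A tape with `k` blocks of `N` random bits. -/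
noncomputable def tape (N : ℕ) : ℕ → PMF Data
  | 0 => PMF.pure .nil
  | k + 1 => (uniformBits N).bind fun r => (tape N k).map fun t => .cons (.ofBits r) t

theorem size_tape (N : ℕ) : ∀ k, ∀ t ∈ (tape N k).support, t.size ≤ k * (4 * N + 2) + 1
  | 0, t, h => by
    rw [tape, PMF.mem_support_pure_iff] at h
    subst h
    simp [Data.size]
  | k + 1, t, h => by
    rw [tape, PMF.mem_support_bind_iff] at h
    obtain ⟨r, hr, h⟩ := h
    obtain ⟨t, ht, rfl⟩ := (PMF.mem_support_map_iff _ _ _).1 h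
    have h1 := size_tape N k t ht
    have h2 := esize_bits r
    rw [length_of_mem_uniformBits hr] at h2
    change (Data.ofBits r).size ≤ _ at h2
    simp only [Data.size]
    rw [add_mul, one_mul]
    omega

/-- Fresh bits for every query may be drawn in advance. A query costs one action, so `j ≥ k` blocks
suffice for `k` actions, and blocks that are not reached integrate out. -/
theorem run_rand (A : Adversary) (B : Challenger) (N : ℕ) (c : Data) (b : ℕ) {n : ℕ} :
    ∀ (k j : ℕ) (_ : k ≤ j) (log : Data) (s : B.State) (m : Data) (ψ : QState n),
      A.run (W.rand B N c) b k (W.randState B N c log s) m ψ =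
        (tape N j).bind fun t => A.run (W.det B c) b k (W.detState B c log t s) m ψ := by
  intro k
  induction k with
  | zero => intro j _ log s m ψ; simp only [Adversary.run_zero, PMF.bind_const]
  | succ k ih =>
    intro j hj log s m ψ
    by_cases hm : b < m.size
    · simp only [Adversary.run_of_lt _ hm, PMF.bind_const]
    rcases (A.control m).2.kind with ⟨x, hx⟩ | ⟨q, hq⟩ | hl
    · simp only [Adversary.run_output _ hm hx, PMF.bind_const]
    · simp only [Adversary.run_send _ hm hq]
      by_cases hlegal : W.legal c log q = true
      · obtain ⟨j, rfl⟩ := Nat.exists_eq_add_of_le' (show 1 ≤ j by omega)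
        simp only [rand_reply hlegal, det_reply hlegal, tape, PMF.bind_bind, PMF.bind_map,
          Function.comp_def, Data.hd_cons, Data.tl_cons]
        congr 1
        funext r
        rw [PMF.bind_comm]
        congr 1
        funext p
        exact ih j (by omega) _ _ _ _
      · simp only [rand_reply_illegal hlegal, det_reply_illegal hlegal, PMF.pure_bind]
        exact ih j (by omega) _ _ _ _
    · simp only [Adversary.run_local _ hm hl]
      rw [PMF.bind_comm]
      congr 1
      funext p
      exact ih j (by omega) _ _ _ _

/-! ### The wrapped adversary -/

/-- The memory content of the wrapped adversary while it waits for an answer. -/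
def pending (tag c log k tape bd x : Data) : Data :=
  .cons (.cons .nil tag) (.cons c (.cons log (.cons k (.cons tape (.cons bd x)))))

/-- The configuration `(c, log, k, tape, bd, m)` that is represented by a memory content, where `m`
is the memory of the inner adversary. -/
def view (M : Data) : Data × Data × Data × Data × Data × Data :=
  if M.hd.hd.toBool then
    (M.hd.tl.hd, M.hd.tl.tl.hd, M.hd.tl.tl.tl.hd, M.hd.tl.tl.tl.tl.hd, M.hd.tl.tl.tl.tl.tl.hd,
      if M.hd.hd.tl.toBool then
        .cons M.hd.tl.tl.tl.tl.tl.tl.hd (.cons .nil (W.post M.hd.tl.hd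
          M.hd.tl.tl.tl.tl.tl.tl.tl.hd M.tl M.hd.tl.tl.tl.tl.tl.tl.tl.tl))
      else .cons M.hd.tl.tl.tl.tl.tl.tl M.tl)
  else
    (.cons M.tl.hd.hd M.tl.tl, M.tl.hd.tl.hd, M.tl.hd.tl.tl.hd, M.tl.hd.tl.tl.tl.hd,
      M.tl.hd.tl.tl.tl.tl, W.first (.cons M.tl.hd.hd M.tl.tl))

/-- The step of the wrapped adversary in a configuration. -/
def step (A : Adversary) (v : Data × Data × Data × Data × Data × Data) : Data × QAction :=
  if !v.2.2.1.toBool || !(Nat.ble v.2.2.2.2.2.size v.2.2.2.2.1.toNat) then (.nil, .output false)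
  else if (A.control v.2.2.2.2.2).2.isSend then
    if W.legal v.1 v.2.1 (A.control v.2.2.2.2.2).2.payload then
      (pending (.cons .nil .nil) v.1 (.cons (A.control v.2.2.2.2.2).2.payload v.2.1) v.2.2.1.tl
        v.2.2.2.1.tl v.2.2.2.2.1 (.cons (A.control v.2.2.2.2.2).1
          (.cons (A.control v.2.2.2.2.2).2.payload v.2.2.2.1.hd)),
        .send (W.pre v.1 (A.control v.2.2.2.2.2).2.payload v.2.2.2.1.hd))
    else (pending .nil v.1 v.2.1 v.2.2.1.tl v.2.2.2.1 v.2.2.2.2.1 (A.control v.2.2.2.2.2).1,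
      .cnot 0 0)
  else (pending .nil v.1 v.2.1 v.2.2.1.tl v.2.2.2.1 v.2.2.2.2.1 (A.control v.2.2.2.2.2).1,
    (A.control v.2.2.2.2.2).2)

theorem view_PF : PF W.view := by
  have h1 := W.post_PF.comp (g := fun M : Data => (M.hd.tl.hd,
          M.hd.tl.tl.tl.tl.tl.tl.tl.hd, M.tl, M.hd.tl.tl.tl.tl.tl.tl.tl.tl)) (by fun_prop)
  have h2 := W.first_PF.comp (g := fun M : Data => Data.cons M.tl.hd.hd M.tl.tl) (by fun_prop)
  unfold view
  fun_prop

theorem step_PF (A : Adversary) : PF (W.step A) := by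
  have h1 := W.legal_PF.comp (g := fun v : Data × Data × Data × Data × Data × Data =>
    (v.1, v.2.1, (A.control v.2.2.2.2.2).2.payload)) (by fun_prop)
  have h2 := W.pre_PF.comp (g := fun v : Data × Data × Data × Data × Data × Data =>
    (v.1, (A.control v.2.2.2.2.2).2.payload, v.2.2.2.1.hd)) (by fun_prop)
  unfold step pending
  fun_prop

/-- The wrapped adversary. -/
def adversary (A : Adversary) (bound : Polynomial ℕ) (advice : ℕ → Data)
    (h : ∀ κ, (advice κ).size ≤ bound.eval κ) (h' : ∀ κ, A.qubits κ ≤ bound.eval κ)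
    (ψ : ∀ κ, QState (A.qubits κ)) : Adversary where
  control M := W.step A (W.view M)
  control_polyTime :=
    (polyTime_iff_PF _).2 (((W.step_PF A).comp W.view_PF).of_enc_eq fun _ => rfl)
  bound := bound
  advice := advice
  advice_le := h
  qubits := A.qubits
  qubits_le := h'
  qadvice := ψ

theorem view_pending (tag c log k tape bd x resp : Data) :
    W.view (.cons (pending tag c log k tape bd x) resp) = (c, log, k, tape, bd,
      if tag.toBool then .cons x.hd (.cons .nil (W.post c x.tl.hd resp x.tl.tl))
      else .cons x resp) := rfl

theorem size_pending (tag c log k tape bd x : Data) : (pending tag c log k tape bd x).size =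
    tag.size + c.size + log.size + k.size + tape.size + bd.size + x.size + 8 := by
  simp only [pending, Data.size]
  omega

@[simp] theorem _root_.Data.size_ofNat (n : ℕ) : (Data.ofNat n).size = 2 * n + 1 := esize_nat n

theorem _root_.Data.size_hd_le (d : Data) : d.hd.size ≤ d.size := by
  cases d <;> simp only [Data.hd, Data.size] <;> omega

theorem _root_.Data.size_tl_le (d : Data) : d.tl.size ≤ d.size := by
  cases d <;> simp only [Data.tl, Data.size] <;> omega

/-- The simulation is step by step: one action of the wrapped machine for one action of `A`, with
the register shared. The limits of `A` on memory and steps are enforced by `step` itself, which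
carries the step counter and the memory bound along. The wrapped machine's own memory limit `bR` is
never hit, since it dominates the sum of the sizes of all components of a memory content, with 20 to
spare for the constructors. -/
theorem run_adversary (A R : Adversary) (hR : ∀ M, R.control M = W.step A (W.view M))
    (B : Challenger) (I : B.State → Prop) (c : Data) (b qb pb ρ L K τ bR : ℕ) {n : ℕ}
    (hqb : ∀ m : Data, m.size ≤ b → (A.control m).1.size ≤ qb ∧ (A.control m).2.payload.size ≤ qb)
    (hpb : ∀ q ω : Data, q.size ≤ qb → ω.size ≤ τ → (W.pre c q ω).size ≤ pb)
    (hB : ∀ s, I s → ∀ q : Data, q.size ≤ pb → ∀ p ∈ (B.reply s q).support,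
      I p.1 ∧ p.2.size ≤ ρ)
    (hbR : c.size + L + (2 * K + 1) + τ + (2 * b + 1) + (2 * qb + τ + 2) + ρ + 20 ≤ bR) :
    ∀ (k kR : ℕ) (M log t m : Data) (s : B.State) (ψ : QState n), k ≤ kR → k ≤ K → I s →
      M.size ≤ bR → log.size + k * (qb + 1) ≤ L → t.size ≤ τ →
      W.view M = (c, log, .ofNat k, t, .ofNat b, m) →
      R.run B bR kR s M ψ = A.run (W.det B c) b k (W.detState B c log t s) m ψ := by
  have hofNat : ∀ k, Data.ofNat (k + 1) = .cons .nil (.ofNat k) := fun k => rfl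
  intro k
  induction k with
  | zero =>
    intro kR M log t m s ψ _ _ _ hM _ _ hv
    rw [Adversary.run_zero]
    cases kR with
    | zero => rw [Adversary.run_zero]
    | succ kR =>
      refine Adversary.run_output _ (by omega) ?_
      rw [hR, hv, step, if_pos]
      simp [Data.ofNat, Data.ofList, Data.toBool]
  | succ k ih =>
    intro kR M log t m s ψ hk hK hs hM hlog ht hv
    obtain ⟨kR, rfl⟩ := Nat.exists_eq_add_of_le' (show 1 ≤ kR by omega)
    have hsz := size_pending
    have h1 := Data.size_tl_le t
    have h2 := Data.size_hd_le t
    rw [add_mul, one_mul] at hlog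
    by_cases hm : b < m.size
    · rw [Adversary.run_of_lt _ hm]
      refine Adversary.run_output _ (by omega) ?_
      rw [hR, hv, step, if_pos]
      have : Nat.ble m.size b = false := by simpa [← Bool.not_eq_true] using hm
      simp [this]
    obtain ⟨hq1, hq2⟩ := hqb m (by omega)
    have hstep : R.control M = if (A.control m).2.isSend then
        if W.legal c log (A.control m).2.payload then
          (pending (.cons .nil .nil) c (.cons (A.control m).2.payload log)
            (Data.ofNat (k + 1)).tl t.tl (.ofNat b) (.cons (A.control m).1
              (.cons (A.control m).2.payload t.hd)),
            .send (W.pre c (A.control m).2.payload t.hd))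
        else (pending .nil c log (Data.ofNat (k + 1)).tl t (.ofNat b) (A.control m).1, .cnot 0 0)
      else (pending .nil c log (Data.ofNat (k + 1)).tl t (.ofNat b) (A.control m).1,
        (A.control m).2) := by
      rw [hR, hv, step, if_neg]
      have h3 : (Data.ofNat (k + 1)).toBool = true := rfl
      have h4 : Nat.ble m.size b = true := by simpa using hm
      simp [h3, h4]
    rcases (A.control m).2.kind with ⟨x, hx⟩ | ⟨q, hq⟩ | hl
    · rw [Adversary.run_output _ hm hx]
      refine Adversary.run_output _ (by omega) ?_
      rw [hstep, hx]
      simp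
    · rw [Adversary.run_send _ hm hq]
      have hpay : (QAction.send q).payload = q := rfl
      rw [hq] at hstep hq2
      rw [hpay] at hstep hq2
      simp only [QAction.isSend_send, if_true] at hstep
      by_cases hlegal : W.legal c log q = true
      · rw [if_pos hlegal] at hstep
        rw [Adversary.run_send (q := W.pre c q t.hd) _ (by omega) (by rw [hstep])]
        simp only [det_reply hlegal, PMF.bind_map, hstep]
        refine PMF.bind_congr_support fun p hp => ?_
        obtain ⟨hp1, hp2⟩ := hB s hs _ (hpb q t.hd hq2 (by omega)) p hp
        refine ih kR _ _ _ _ _ _ (by omega) (by omega) hp1 ?_ ?_ (by omega) ?_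
        · simp only [Data.size, size_pending, hofNat, Data.tl_cons, Data.size_ofNat]
          omega
        · simp only [Data.size]; omega
        · rw [view_pending, hofNat]
          rfl
      · rw [if_neg hlegal] at hstep
        rw [Adversary.run_local _ (by omega) (by rw [hstep]; trivial)]
        simp only [det_reply_illegal hlegal, PMF.pure_bind, hstep, QAction.localStep]
        -- An illegal query must be answered by `nil` without contacting the challenger, yet it must
        -- use up one action. A controlled-not whose control is its target does exactly this.
        have : (QAction.cnot 0 0).apply ψ = ψ := by simp [QAction.apply]
        rw [this]
        refine ih kR _ _ _ _ _ _ (by omega) (by omega) hs ?_ (by omega) (by omega) ?_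
        · simp only [Data.size, size_pending, hofNat, Data.tl_cons, Data.size_ofNat]
          omega
        · rw [view_pending, hofNat]
          rfl
    · rw [Adversary.run_local _ hm hl]
      rw [QAction.isSend_of_isLocal hl, if_neg (by simp)] at hstep
      rw [Adversary.run_local _ (by omega) (by rw [hstep]; exact hl), hstep]
      refine PMF.bind_congr_support fun p hp => ?_
      have hp3 := QAction.size_localStep _ _ p hp
      refine ih kR _ _ _ _ _ _ (by omega) (by omega) hs ?_ (by omega) (by omega) ?_
      · simp only [Data.size, size_pending, hofNat, Data.tl_cons, Data.size_ofNat]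
        omega
      · rw [view_pending, hofNat]
        rfl

end Wrapper

/-- On reachable states the messages of the challengers have polynomial size. -/
def PolyBounded (B : ℕ → Challenger) : Prop :=
  ∃ (g : Polynomial ℕ) (I : ∀ κ, (B κ).State → Prop), ∀ κ,
    (∀ p ∈ (B κ).start.support, I κ p.1 ∧ p.2.size ≤ g.eval κ) ∧
    ∀ s, I κ s → ∀ q : Data, ∀ p ∈ ((B κ).reply s q).support,
      I κ p.1 ∧ p.2.size ≤ g.eval (κ + q.size)

/-! ### Transfer of indistinguishability through a wrapper -/

namespace Wrapper

variable (W : Wrapper)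

theorem run_rand_start (A : Adversary) (B : Challenger) (N : ℕ) (c0 log : Data) (b k : ℕ) {n : ℕ}
    (ψ : QState n) :
    (B.start.bind fun p => A.run (W.rand B N (.cons c0 p.2)) b k
      (W.randState B N (.cons c0 p.2) log p.1) (W.first (.cons c0 p.2)) ψ) =
    (tape N k).bind fun t => B.start.bind fun p => A.run (W.det B (.cons c0 p.2)) b k
      (W.detState B (.cons c0 p.2) log t p.1) (W.first (.cons c0 p.2)) ψ := by
  rw [PMF.bind_comm]
  congr 1
  funext p
  exact W.run_rand A B N _ b k k le_rfl log p.1 _ ψ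

/-- The advice of the wrapped adversary. -/
def adviceData (c0 log t : Data) (k b : ℕ) : Data :=
  .cons c0 (.cons log (.cons (.ofNat k) (.cons t (.ofNat b))))

theorem size_adviceData (c0 log t : Data) (k b : ℕ) : (adviceData c0 log t k b).size =
    c0.size + log.size + (2 * k + 1) + t.size + (2 * b + 1) + 4 := by
  simp only [adviceData, Data.size, Data.size_ofNat]
  omega

/-- A pending memory content begins with a nonempty mark, whereas a unary numeral has head `nil`.
This is how the initial memory is recognized. -/
theorem view_start (κ : ℕ) (c0 log t msg : Data) (k b : ℕ) :
    W.view (.cons (.ofNat κ) (.cons (adviceData c0 log t k b) msg)) =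
      (.cons c0 msg, log, .ofNat k, t, .ofNat b, W.first (.cons c0 msg)) := by
  rw [view, if_neg]
  · rfl
  · cases κ <;> simp [Data.ofNat, Data.ofList, Data.hd, Data.toBool, List.replicate_succ]

/-- Challengers behind a wrapper are indistinguishable if the challengers are. -/
theorem indist (A : Adversary) {B₀ B₁ : ℕ → Challenger} (h : Indistinguishable B₀ B₁)
    (h₀ : PolyBounded B₀) (h₁ : PolyBounded B₁) (N : ℕ → ℕ) (pN : Polynomial ℕ)
    (hN : ∀ κ, N κ ≤ pN.eval κ) (c0 log : ℕ → Data) (pc pl : Polynomial ℕ)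
    (hc : ∀ κ, (c0 κ).size ≤ pc.eval κ) (hl : ∀ κ, (log κ).size ≤ pl.eval κ) (k : ℕ → ℕ)
    (hk : ∀ κ, k κ ≤ A.bound.eval κ) (ψ : ∀ κ, QState (A.qubits κ)) :
    Negligible fun κ =>
      |prT ((B₀ κ).start.bind fun p => A.run (W.rand (B₀ κ) (N κ) (.cons (c0 κ) p.2))
          (A.bound.eval κ) (k κ) (W.randState (B₀ κ) (N κ) (.cons (c0 κ) p.2) (log κ) p.1)
          (W.first (.cons (c0 κ) p.2)) (ψ κ)) -
        prT ((B₁ κ).start.bind fun p => A.run (W.rand (B₁ κ) (N κ) (.cons (c0 κ) p.2))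
          (A.bound.eval κ) (k κ) (W.randState (B₁ κ) (N κ) (.cons (c0 κ) p.2) (log κ) p.1)
          (W.first (.cons (c0 κ) p.2)) (ψ κ))| := by
  obtain ⟨g₀, I₀, hB₀⟩ := h₀
  obtain ⟨g₁, I₁, hB₁⟩ := h₁
  obtain ⟨qa, hqa⟩ := (PF.control A).out_bound
  obtain ⟨qp, hqp⟩ := W.pre_PF.out_bound
  -- For each `κ` a tape with at least half of the average difference is fixed. It becomes part of
  -- the classical advice, so that the reduction tosses no coins of its own.
  choose t ht hle using fun κ => exists_prT_bind_sub_le (tape (N κ) (k κ))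
    (fun t => (B₀ κ).start.bind fun p => A.run (W.det (B₀ κ) (.cons (c0 κ) p.2))
      (A.bound.eval κ) (k κ) (W.detState (B₀ κ) (.cons (c0 κ) p.2) (log κ) t p.1)
      (W.first (.cons (c0 κ) p.2)) (ψ κ))
    (fun t => (B₁ κ).start.bind fun p => A.run (W.det (B₁ κ) (.cons (c0 κ) p.2))
      (A.bound.eval κ) (k κ) (W.detState (B₁ κ) (.cons (c0 κ) p.2) (log κ) t p.1)
      (W.first (.cons (c0 κ) p.2)) (ψ κ))
  -- Bounds, in this order, for memory and messages of `A`, the tape, the fixed data with the first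
  -- message, the messages to the challenger, its answers, the log, and the total memory of the
  -- reduction.
  let pqb : Polynomial ℕ := qa.comp A.bound
  let pτ : Polynomial ℕ := A.bound * (4 * pN + 2) + 1
  let pcs : Polynomial ℕ := pc + (g₀ + g₁) + 1
  let ppb : Polynomial ℕ := qp.comp (pcs + pqb + pτ + 2)
  let pρ : Polynomial ℕ := (g₀ + g₁).comp (.X + ppb)
  let pL : Polynomial ℕ := pl + A.bound * (pqb + 1)
  let pR : Polynomial ℕ := pcs + pL + (2 * A.bound + 1) + pτ + (2 * A.bound + 1) +
    (2 * pqb + pτ + 2) + pρ + 30 + 2 * .X + pc + pl + (g₀ + g₁)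
  have hR : ∀ κ, pR.eval κ = pcs.eval κ + pL.eval κ + (2 * A.bound.eval κ + 1) + pτ.eval κ +
      (2 * A.bound.eval κ + 1) + (2 * pqb.eval κ + pτ.eval κ + 2) + pρ.eval κ + 30 + 2 * κ +
      pc.eval κ + pl.eval κ + (g₀.eval κ + g₁.eval κ) := by
    intro κ
    simp only [pR, Polynomial.eval_add, Polynomial.eval_mul, Polynomial.eval_ofNat,
      Polynomial.eval_one, Polynomial.eval_X]
  have hcs : ∀ κ, pcs.eval κ = pc.eval κ + (g₀.eval κ + g₁.eval κ) + 1 := by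
    intro κ
    simp only [pcs, Polynomial.eval_add, Polynomial.eval_one]
  have hL : ∀ κ, pL.eval κ = pl.eval κ + A.bound.eval κ * (pqb.eval κ + 1) := by
    intro κ
    simp only [pL, Polynomial.eval_add, Polynomial.eval_one, Polynomial.eval_mul]
  have hτ : ∀ κ, (t κ).size ≤ pτ.eval κ := by
    intro κ
    refine (size_tape _ _ _ (ht κ)).trans ?_
    simp only [pτ, Polynomial.eval_add, Polynomial.eval_one, Polynomial.eval_mul,
      Polynomial.eval_ofNat]
    exact Nat.add_le_add_right (Nat.mul_le_mul (hk κ) (by have := hN κ; omega)) 1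
  have hadv : ∀ κ, (adviceData (c0 κ) (log κ) (t κ) (k κ) (A.bound.eval κ)).size +
      (g₀.eval κ + g₁.eval κ) + (2 * κ + 1) + 2 ≤ pR.eval κ := by
    intro κ
    rw [size_adviceData, hR]
    have h1 := hc κ
    have h2 := hl κ
    have h3 := hτ κ
    have h4 := hk κ
    omega
  let R := W.adversary A pR
    (fun κ => adviceData (c0 κ) (log κ) (t κ) (k κ) (A.bound.eval κ))
    (fun κ => by have := hadv κ; omega)
    (fun κ => by have := A.qubits_le κ; rw [hR]; omega) ψ
  have hexp : ∀ (B : Challenger) (κ : ℕ) (I : B.State → Prop)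
      (_ : ∀ p ∈ B.start.support, I p.1 ∧ p.2.size ≤ g₀.eval κ + g₁.eval κ)
      (_ : ∀ s, I s → ∀ q : Data, ∀ p ∈ (B.reply s q).support,
        I p.1 ∧ p.2.size ≤ (g₀ + g₁).eval (κ + q.size)),
      R.experiment B κ = B.start.bind fun p => A.run (W.det B (.cons (c0 κ) p.2))
        (A.bound.eval κ) (k κ) (W.detState B (.cons (c0 κ) p.2) (log κ) (t κ) p.1)
        (W.first (.cons (c0 κ) p.2)) (ψ κ) := by
    intro B κ I hI1 hI2
    refine PMF.bind_congr_support fun p hp => ?_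
    obtain ⟨hp1, hp2⟩ := hI1 p hp
    have h1 := hc κ
    have h2 := hl κ
    have h3 := hτ κ
    have h4 := hk κ
    have h5 := hadv κ
    have hmul := Nat.mul_le_mul_right (pqb.eval κ + 1) h4
    refine W.run_adversary A R (fun M => rfl) B I (.cons (c0 κ) p.2) (A.bound.eval κ)
      (pqb.eval κ) (ppb.eval κ) (pρ.eval κ) (pL.eval κ) (A.bound.eval κ) (pτ.eval κ)
      (pR.eval κ) ?_ ?_ ?_ ?_ (k κ) _ _ _ _ _ _ _ ?_ h4 hp1 ?_ ?_ h3 ?_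
    · intro m hm
      have h6 := (hqa m).trans (qa.eval_mono_nat hm)
      simp only [pqb, Polynomial.eval_comp]
      simp only [esize_prod, esize_data] at h6
      have h7 : (A.control m).2.payload.size ≤ esize (A.control m).2 := Data.size_tl_le _
      omega
    · intro q ω hq hω
      refine (hqp (.cons (c0 κ) p.2, q, ω)).trans ?_
      simp only [ppb, Polynomial.eval_comp, Polynomial.eval_add, Polynomial.eval_ofNat]
      refine qp.eval_mono_nat ?_
      simp only [esize_prod, esize_data, Data.size, hcs]
      omega
    · intro s hs q hq p hp
      refine (hI2 s hs q p hp).imp_right fun h => h.trans ?_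
      simp only [pρ, Polynomial.eval_comp, Polynomial.eval_add, Polynomial.eval_X]
      exact Nat.add_le_add (g₀.eval_mono_nat (by omega)) (g₁.eval_mono_nat (by omega))
    · rw [hR]
      simp only [Data.size, hcs]
      omega
    · change k κ ≤ pR.eval κ
      rw [hR]; omega
    · change Data.size (.cons (.ofNat κ) (.cons (adviceData (c0 κ) (log κ) (t κ) (k κ)
        (A.bound.eval κ)) p.2)) ≤ _
      simp only [Data.size, Data.size_ofNat]
      omega
    · rw [hL]; omega
    · exact W.view_start _ _ _ _ _ _ _
  -- The factor 2 is the loss from fixing the tape.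
  refine ((h R).const_mul 2 fun _ => abs_nonneg _).mono fun κ => ?_
  rw [W.run_rand_start, W.run_rand_start]
  refine (hle κ).trans (le_of_eq ?_)
  rw [pr_eq_prT, pr_eq_prT, hexp (B₀ κ) κ (I₀ κ), hexp (B₁ κ) κ (I₁ κ)]
  · push_cast; rfl
  · exact fun p hp => ((hB₁ κ).1 p hp).imp_right fun h => by omega
  · exact fun s hs q p hp => ((hB₁ κ).2 s hs q p hp).imp_right fun h => by
      rw [Polynomial.eval_add]; omega
  · exact fun p hp => ((hB₀ κ).1 p hp).imp_right fun h => by omega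
  · exact fun s hs q p hp => ((hB₀ κ).2 s hs q p hp).imp_right fun h => by
      rw [Polynomial.eval_add]; omega

end Wrapper

/-! ### Adaptive games with a log of the legal queries -/

section
variable (Q : PolicyClass) (κ : ℕ) (valid : Data → Bool)

/-- A query is legal after the legal queries in the log. -/
def legalLog (log : List Data) (q : Data) : Bool :=
  if q.hd.toBool then
    (Q.attr κ q.tl.hd && valid q.tl.tl) &&
      log.all fun e => !e.hd.toBool && !Q.sat κ e.tl q.tl.hd
  else Q.pol κ q.tl && log.all fun e => if e.hd.toBool then !Q.sat κ q.tl e.tl.hd else true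

/-- The policies in a log. -/
def queried : List Data → List Data
  | [] => []
  | e :: l => if e.hd.toBool then queried l else e.tl :: queried l

/-- The target attribute in a log. -/
def target : List Data → Option Data
  | [] => none
  | e :: l => if e.hd.toBool then some e.tl.hd else target l

/-- A log contains at most one challenge query. -/
def LogOk : List Data → Prop
  | [] => True
  | e :: l => LogOk l ∧ (e.hd.toBool = true → target l = none)

theorem target_isNone (l : List Data) : (target l).isNone = l.all fun e => !e.hd.toBool := by
  induction l with
  | nil => rfl
  | cons e l ih => cases h : e.hd.toBool <;> simp [target, h, ih]

theorem queried_all (f : Data → Bool) (l : List Data) :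
    (queried l).all f = l.all fun e => e.hd.toBool || f e.tl := by
  induction l with
  | nil => rfl
  | cons e l ih => cases h : e.hd.toBool <;> simp [queried, h, ih]

/-- `target` sees only the most recent challenge query. With at most one of them in the log, a
condition on it is a condition on all entries, which is the form that `legalLog` tests. -/
theorem target_all (f : Data → Bool) (l : List Data) (hl : LogOk l) :
    (target l).all f = l.all fun e => if e.hd.toBool then f e.tl.hd else true := by
  induction l with
  | nil => rfl
  | cons e l ih =>
    cases h : e.hd.toBool
    · simp [target, h, ih hl.1]
    · have h1 := ih hl.1
      rw [hl.2 h] at h1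
      simp only [target, h, if_true, Option.all_some, List.all_cons, ← h1, Option.all_none,
        Bool.and_true]

theorem legalLog_of_challenge {log : List Data} {q : Data} (hq : q.hd.toBool = true) :
    legalLog Q κ valid log q = ((target log).isNone && Q.attr κ q.tl.hd && valid q.tl.tl &&
      (queried log).all fun P => !Q.sat κ P q.tl.hd) := by
  rw [legalLog, if_pos hq, target_isNone, queried_all]
  have : ∀ l : List Data, (l.all fun e => !e.hd.toBool && !Q.sat κ e.tl q.tl.hd) =
      ((l.all fun e => !e.hd.toBool) && l.all fun e => e.hd.toBool || !Q.sat κ e.tl q.tl.hd) := by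
    intro l
    induction l with
    | nil => rfl
    | cons e l ih =>
      simp only [List.all_cons, ih]
      cases e.hd.toBool <;> cases Q.sat κ e.tl q.tl.hd <;> simp
  rw [this]
  cases Q.attr κ q.tl.hd <;> cases valid q.tl.tl <;> simp

theorem legalLog_of_key {log : List Data} (hl : LogOk log) {q : Data} (hq : q.hd.toBool = false) :
    legalLog Q κ valid log q = (Q.pol κ q.tl && (target log).all fun X => !Q.sat κ q.tl X) := by
  rw [legalLog, if_neg (by simp [hq]), target_all _ _ hl]

variable {Q κ valid} in
theorem LogOk.cons {log : List Data} (hl : LogOk log) {q : Data}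
    (hq : legalLog Q κ valid log q = true) : LogOk (q :: log) := by
  refine ⟨hl, fun h => ?_⟩
  rw [legalLog_of_challenge Q κ valid h] at hq
  simp only [Bool.and_eq_true] at hq
  exact Option.isNone_iff_eq_none.1 hq.1.1.1

/-- The answer to a legal query. -/
noncomputable def answer (key : Data → PMF Data) (chal : Data → Data → PMF Data) (q : Data) :
    PMF Data :=
  if q.hd.toBool then chal q.tl.hd q.tl.tl else key q.tl

/-- The list of queried policies and the target are functions of the log of legal queries. Legality
of a query therefore depends on public data only and can be decided by a reduction. -/
theorem adaptiveChallenger_reply {S : Type} (start : PMF (Data × S)) (key : S → Data → PMF Data)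
    (chal : S → Data → Data → PMF Data) (s : S) {log : List Data} (hl : LogOk log) (q : Data) :
    (adaptiveChallenger Q κ S start key valid chal).reply (s, queried log, target log) q =
      if legalLog Q κ valid log q then (answer (key s) (chal s) q).map fun a =>
        ((s, queried (q :: log), target (q :: log)), .cons .nil a)
      else PMF.pure ((s, queried log, target log), .nil) := by
  cases hq : q.hd.toBool
  · rw [legalLog_of_key Q κ valid hl hq]
    simp only [adaptiveChallenger, answer, hq, queried, target]
    rfl
  · rw [legalLog_of_challenge Q κ valid hq]
    simp only [adaptiveChallenger, answer, hq, queried, target]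
    rfl

/-- The adaptive game with given answers; the state is the log of the legal queries. -/
noncomputable def logGame (key : Data → PMF Data) (chal : Data → Data → PMF Data) :
    Challenger where
  State := List Data
  start := PMF.pure ([], .nil)
  reply log q :=
    if legalLog Q κ valid log q then (answer key chal q).map fun a => (q :: log, .cons .nil a)
    else PMF.pure (log, .nil)

def logState (key : Data → PMF Data) (chal : Data → Data → PMF Data) (log : List Data) :
    (logGame Q κ valid key chal).State := log

variable {Q κ valid}

theorem logGame_reply {key : Data → PMF Data} {chal : Data → Data → PMF Data} {log : List Data}
    {q : Data} (h : legalLog Q κ valid log q = true) :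
    (logGame Q κ valid key chal).reply (logState Q κ valid key chal log) q =
      (answer key chal q).map fun a => (logState Q κ valid key chal (q :: log), .cons .nil a) :=
  if_pos h

theorem logGame_reply_illegal {key : Data → PMF Data} {chal : Data → Data → PMF Data}
    {log : List Data} {q : Data} (h : ¬ legalLog Q κ valid log q = true) :
    (logGame Q κ valid key chal).reply (logState Q κ valid key chal log) q =
      PMF.pure (logState Q κ valid key chal log, .nil) :=
  if_neg h

variable (Q κ valid)

theorem run_adaptiveChallenger (A : Adversary) {S : Type} (start : PMF (Data × S))
    (key : S → Data → PMF Data) (chal : S → Data → Data → PMF Data) (s : S) (b k : ℕ) (m : Data)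
    {n : ℕ} (ψ : QState n) :
    A.run (adaptiveChallenger Q κ S start key valid chal) b k (s, [], none) m ψ =
      A.run (logGame Q κ valid (key s) (chal s)) b k (logState _ _ _ _ _ []) m ψ := by
  obtain ⟨qa, hqa⟩ := (PF.control A).out_bound
  refine A.run_bisim (C := adaptiveChallenger Q κ S start key valid chal)
    (C' := logGame Q κ valid (key s) (chal s))
    (fun log : List Data => (s, queried log, target log)) (fun _ log => LogOk log) b (qa.eval b)
    (fun m hm => ?_) (fun _ _ h => h) (fun _ log hl q _ => ?_) k (logState _ _ _ _ _ []) m ψ trivial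
  · have h1 := (hqa m).trans (qa.eval_mono_nat hm)
    have h2 : (A.control m).2.payload.size ≤ esize (A.control m).2 := Data.size_tl_le _
    simp only [esize_prod] at h1
    omega
  · rw [adaptiveChallenger_reply Q κ valid start key chal s hl]
    change List Data at log
    change LogOk log at hl
    by_cases hq : legalLog Q κ valid log q = true
    · have h1 : (logGame Q κ valid (key s) (chal s)).reply log q = _ := logGame_reply hq
      rw [if_pos hq, h1, PMF.map_comp]
      refine ⟨rfl, fun p hp => ?_⟩
      obtain ⟨a, -, rfl⟩ := (PMF.mem_support_map_iff _ _ _).1 hp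
      exact hl.cons hq
    · have h1 : (logGame Q κ valid (key s) (chal s)).reply log q = _ := logGame_reply_illegal hq
      rw [if_neg hq, h1, PMF.pure_map]
      refine ⟨rfl, fun p hp => ?_⟩
      rw [PMF.mem_support_pure_iff] at hp
      subst hp
      exact hl

/-- The output of the adversary in the game with the given answers and public key. -/
noncomputable def play (A : Adversary) (key : Data → PMF Data) (chal : Data → Data → PMF Data)
    (pk : Data) : PMF Bool :=
  A.run (logGame Q κ valid key chal) (A.bound.eval κ) (A.bound.eval κ) (logState _ _ _ _ _ [])
    (.cons (.ofNat κ) (.cons (A.advice κ) pk)) (A.qadvice κ)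

theorem experiment_adaptiveChallenger (A : Adversary) {S : Type} (start : PMF (Data × S))
    (key : S → Data → PMF Data) (chal : S → Data → Data → PMF Data) :
    A.experiment (adaptiveChallenger Q κ S start key valid chal) κ =
      start.bind fun x => play Q κ valid A (key x.2) (chal x.2) x.1 := by
  refine (PMF.bind_map _ _ _).trans ?_
  congr 1
  funext x
  exact run_adaptiveChallenger Q κ valid A start key chal x.2 _ _ _ _

/-- Since at most one challenge is answered, hidden values that are used only for this answer may
be sampled then. -/
theorem run_logGame_lazy (A : Adversary) {ζ : Type} (p : PMF ζ) (key : Data → PMF Data)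
    (chal : ζ → Data → Data → PMF Data) (b : ℕ) {n : ℕ} :
    ∀ (k : ℕ) (log : List Data) (m : Data) (ψ : QState n),
      (p.bind fun ζ => A.run (logGame Q κ valid key (chal ζ)) b k (logState _ _ _ _ _ log) m ψ) =
        A.run (logGame Q κ valid key fun X m => p.bind fun ζ => chal ζ X m) b k
          (logState _ _ _ _ _ log) m ψ ∧
      ((target log).isSome → ∀ ζ, A.run (logGame Q κ valid key (chal ζ)) b k
        (logState _ _ _ _ _ log) m ψ =
        A.run (logGame Q κ valid key fun X m => p.bind fun ζ => chal ζ X m) b k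
          (logState _ _ _ _ _ log) m ψ) := by
  intro k
  -- The two claims are proved together: at the challenge query the hidden value is consumed, and
  -- the second claim says that the rest of the game no longer depends on it because no further
  -- challenge is legal.
  induction k with
  | zero => intro log m ψ; simp only [Adversary.run_zero, PMF.bind_const, implies_true, and_self]
  | succ k ih =>
    intro log m ψ
    by_cases hm : b < m.size
    · simp only [Adversary.run_of_lt _ hm, PMF.bind_const, implies_true, and_self]
    rcases (A.control m).2.kind with ⟨x, hx⟩ | ⟨q, hq⟩ | hl
    · simp only [Adversary.run_output _ hm hx, PMF.bind_const, implies_true, and_self]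
    · simp only [Adversary.run_send _ hm hq]
      by_cases hlegal : legalLog Q κ valid log q = true
      · simp only [logGame_reply hlegal, PMF.bind_map, Function.comp_def, answer]
        cases hc : q.hd.toBool
        · simp only [Bool.false_eq_true, if_false]
          refine ⟨?_, fun ht ζ => ?_⟩
          · rw [PMF.bind_comm]
            congr 1
            funext a
            exact (ih _ _ _).1
          · congr 1
            funext a
            refine (ih _ _ _).2 ?_ ζ
            rwa [target, if_neg (by simp [hc])]
        · simp only [if_true]
          have ht : (target (q :: log)).isSome := by simp [target, hc]
          have h1 : ∀ m ζ, A.run (logGame Q κ valid key (chal ζ)) b k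
              (logState _ _ _ _ _ (q :: log)) m ψ = _ := fun m ζ => (ih (q :: log) m ψ).2 ht ζ
          simp only [h1, PMF.bind_bind, true_and]
          intro ht' ζ
          rw [legalLog_of_challenge Q κ valid hc] at hlegal
          simp only [Bool.and_eq_true] at hlegal
          have h2 := Option.isNone_iff_eq_none.1 hlegal.1.1.1
          simp [h2] at ht'
      · simp only [logGame_reply_illegal hlegal, PMF.pure_bind]
        exact ih _ _ _
    · simp only [Adversary.run_local _ hm hl]
      refine ⟨?_, fun ht ζ => ?_⟩
      · rw [PMF.bind_comm]
        congr 1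
        funext p
        exact (ih _ _ _).1
      · congr 1
        funext p
        exact (ih _ _ _).2 ht ζ

theorem play_lazy (A : Adversary) {ζ : Type} (p : PMF ζ) (key : Data → PMF Data)
    (chal : ζ → Data → Data → PMF Data) (pk : Data) :
    (p.bind fun ζ => play Q κ valid A key (chal ζ) pk) =
      play Q κ valid A key (fun X m => p.bind fun ζ => chal ζ X m) pk :=
  (run_logGame_lazy Q κ valid A p key chal _ _ _ _ _).1

/-- The answers matter only for admissible queries. -/
theorem play_congr (A : Adversary) {key key' : Data → PMF Data}
    {chal chal' : Data → Data → PMF Data} (pk : Data) (h : ∀ P, key P = key' P)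
    (h' : ∀ X m, Q.attr κ X = true → valid m = true → chal X m = chal' X m) :
    play Q κ valid A key chal pk = play Q κ valid A key' chal' pk := by
  obtain ⟨qa, hqa⟩ := (PF.control A).out_bound
  refine A.run_bisim (C := logGame Q κ valid key chal)
    (C' := logGame Q κ valid key' chal') (fun log : List Data => log) (fun _ _ => True) _
    (qa.eval (A.bound.eval κ))
    (fun m hm => ?_) (fun _ _ h => h) (fun _ log hl q _ => ⟨?_, fun _ _ => trivial⟩) _
    (logState _ _ _ _ _ []) _ _ trivial
  · have h1 := (hqa m).trans (qa.eval_mono_nat hm)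
    have h2 : (A.control m).2.payload.size ≤ esize (A.control m).2 := Data.size_tl_le _
    simp only [esize_prod] at h1
    omega
  · change List Data at log
    by_cases hq : legalLog Q κ valid log q = true
    · have h1 : (logGame Q κ valid key' chal').reply log q = _ := logGame_reply hq
      have h2 : (logGame Q κ valid key chal).reply log q = _ := logGame_reply hq
      have h3 : answer key chal q = answer key' chal' q := by
        cases hc : q.hd.toBool
        · simp [answer, hc, h]
        · simp only [answer, hc, if_true]
          rw [legalLog_of_challenge Q κ valid hc] at hq
          simp only [Bool.and_eq_true] at hq
          exact h' _ _ hq.1.1.2 hq.1.2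
      rw [h1, h2, PMF.map_comp, h3]
      rfl
    · have h1 : (logGame Q κ valid key' chal').reply log q = _ := logGame_reply_illegal hq
      have h2 : (logGame Q κ valid key chal).reply log q = _ := logGame_reply_illegal hq
      rw [h1, h2, PMF.pure_map]
      rfl

end

/-! ### Adaptive games that are played with the help of another challenger -/

theorem PPTF.size_bound {α β : Type} [Enc α] [Enc β] {F : α → PMF β} (hF : PPTF F) :
    ∃ q : Polynomial ℕ, ∀ a, ∀ b ∈ (F a).support, esize b ≤ q.eval (esize a) := by
  obtain ⟨f, p, hf, hF⟩ := hF
  obtain ⟨q, hq⟩ := hf.out_bound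
  refine ⟨q.comp (.X + 4 * p + 2), fun a b hb => ?_⟩
  rw [hF a _ le_rfl] at hb
  obtain ⟨r, hr, rfl⟩ := (PMF.mem_support_map_iff _ _ _).1 hb
  refine (hq (a, r)).trans ?_
  have h1 := esize_bits r
  rw [length_of_mem_uniformBits hr] at h1
  simp only [Polynomial.eval_comp, Polynomial.eval_add, Polynomial.eval_mul, Polynomial.eval_X,
    Polynomial.eval_ofNat]
  refine q.eval_mono_nat ?_
  simp only [esize_prod]
  omega

theorem Adversary.exists_payload_bound (A : Adversary) :
    ∃ qa : Polynomial ℕ, ∀ b, ∀ m : Data, m.size ≤ b →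
      (A.control m).2.payload.size ≤ qa.eval b := by
  obtain ⟨qa, hqa⟩ := (PF.control A).out_bound
  refine ⟨qa, fun b m hm => ?_⟩
  have h1 := (hqa m).trans (qa.eval_mono_nat hm)
  have h2 : (A.control m).2.payload.size ≤ esize (A.control m).2 := Data.size_tl_le _
  simp only [esize_prod] at h1
  omega

/-- A wrapper whose random bits are used for a probabilistic choice of the message and a
probabilistic conversion of the answer. -/
theorem Wrapper.exists_of_PPTF {legal : Data → Data → Data → Bool} {first : Data → Data}
    {pre : Data → Data → PMF (Data × Data)} {post : Data → Data → Data → Data → PMF Data}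
    (hl : PF fun x : Data × Data × Data => legal x.1 x.2.1 x.2.2) (hfirst : PF first)
    (hpre : PPTF fun x : Data × Data => pre x.1 x.2)
    (hpost : PPTF fun x : Data × Data × Data × Data => post x.1 x.2.1 x.2.2.1 x.2.2.2) :
    ∃ (W : Wrapper) (p₁ p₂ : Polynomial ℕ), W.legal = legal ∧ W.first = first ∧
      ∀ (B : Challenger) (s : B.State) (c q : Data) (N : ℕ),
        (∀ x ∈ (pre c q).support, ∀ p ∈ (B.reply s x.1).support,
          p₁.eval (esize (c, q)) + p₂.eval (esize (c, q, x.2, p.2)) ≤ N) →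
        ((uniformBits N).bind fun r => (B.reply s (W.pre c q (.ofBits r))).map fun p =>
          (p.1, W.post c q p.2 (.ofBits r))) =
        (pre c q).bind fun x => (B.reply s x.1).bind fun p =>
          (post c q x.2 p.2).map fun y => (p.1, y) := by
  obtain ⟨f, p₁, hf, hF⟩ := hpre
  obtain ⟨g, p₂, hg, hG⟩ := hpost
  have h1 : PF fun x : Data × Data => p₁.eval (esize x) := PF.polynomial_eval p₁ PF.encSize
  let W : Wrapper :=
    { legal := legal
      first := first
      pre := fun c q ω => (f (c, q) (ω.toBits.take (p₁.eval (esize (c, q))))).1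
      -- A wrapper stores nothing private between sending a message and converting the answer. Thus
      -- `post` recomputes the second component of the choice of `pre` from the same first block of
      -- bits, and uses the remaining bits for itself.
      post := fun c q a ω => g (c, q, (f (c, q) (ω.toBits.take (p₁.eval (esize (c, q))))).2, a)
        (ω.toBits.drop (p₁.eval (esize (c, q))))
      legal_PF := hl
      first_PF := hfirst
      pre_PF := by
        have h2 := h1.comp (g := fun x : Data × Data × Data => (x.1, x.2.1)) (by fun_prop)
        have h3 := hf.comp (g := fun x : Data × Data × Data =>
          ((x.1, x.2.1), x.2.2.toBits.take (p₁.eval (esize (x.1, x.2.1))))) (by fun_prop)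
        exact h3.fst
      post_PF := by
        have h2 := h1.comp (g := fun x : Data × Data × Data × Data => (x.1, x.2.1)) (by fun_prop)
        have h3 := hf.comp (g := fun x : Data × Data × Data × Data =>
          ((x.1, x.2.1), x.2.2.2.toBits.take (p₁.eval (esize (x.1, x.2.1))))) (by fun_prop)
        exact hg.comp (g := fun x : Data × Data × Data × Data =>
          ((x.1, x.2.1, (f (x.1, x.2.1) (x.2.2.2.toBits.take (p₁.eval (esize (x.1, x.2.1))))).2,
            x.2.2.1), x.2.2.2.toBits.drop (p₁.eval (esize (x.1, x.2.1))))) (by fun_prop) }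
  refine ⟨W, p₁, p₂, rfl, rfl, fun B s c q N hN => ?_⟩
  obtain ⟨x, hx⟩ := (pre c q).support_nonempty
  obtain ⟨p, hp⟩ := (B.reply s x.1).support_nonempty
  obtain ⟨k, rfl⟩ := Nat.exists_eq_add_of_le ((Nat.le_add_right _ _).trans (hN x hx p hp))
  have hFc : pre c q = _ := hF (c, q) _ le_rfl
  rw [hFc] at hN ⊢
  rw [uniformBits_add, PMF.bind_bind, PMF.bind_map]
  refine PMF.bind_congr_support fun r hr => ?_
  have hr' := length_of_mem_uniformBits hr
  have ht : ∀ t : List Bool, (r ++ t).take (p₁.eval (esize (c, q))) = r := by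
    intro t; rw [← hr']; simp
  have hd : ∀ t : List Bool, (r ++ t).drop (p₁.eval (esize (c, q))) = t := by
    intro t; rw [← hr']; simp
  simp only [PMF.bind_map, Function.comp_def, W, Data.toBits_ofBits, ht, hd]
  change ((uniformBits k).bind fun t => PMF.bind _ _) = _
  rw [PMF.bind_comm]
  refine PMF.bind_congr_support fun p hp => ?_
  rw [show post c q (f (c, q) r).2 p.2 = _ from hG (c, q, (f (c, q) r).2, p.2) k (by
    have := hN (f (c, q) r) ((PMF.mem_support_map_iff _ _ _).2 ⟨r, hr, rfl⟩) p hp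
    omega), PMF.map_comp]
  rfl

section
variable (Q : PolicyClass) (κ : ℕ) (valid : Data → Bool)

/-- The adaptive game in which a legal query `q` is answered after sending a message that is
chosen by `pre` to the challenger `B`, whose answer is converted by `post`. -/
noncomputable def compGame (pre : Data → PMF (Data × Data)) (post : Data → Data → Data → PMF Data)
    (B : Challenger) : Challenger where
  State := List Data × B.State
  start := B.start.map fun p => (([], p.1), p.2)
  reply := fun ⟨log, s⟩ q =>
    if legalLog Q κ valid log q then
      (pre q).bind fun x => (B.reply s x.1).bind fun p => (post q x.2 p.2).map fun y =>
        ((q :: log, p.1), .cons .nil y)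
    else PMF.pure ((log, s), .nil)

def compState (pre : Data → PMF (Data × Data)) (post : Data → Data → Data → PMF Data)
    (B : Challenger) (log : List Data) (s : B.State) : (compGame Q κ valid pre post B).State :=
  (log, s)

variable {Q κ valid}

theorem compGame_reply {pre : Data → PMF (Data × Data)} {post : Data → Data → Data → PMF Data}
    {B : Challenger} {log : List Data} {s : B.State} {q : Data}
    (h : legalLog Q κ valid log q = true) :
    (compGame Q κ valid pre post B).reply (compState Q κ valid pre post B log s) q =
      (pre q).bind fun x => (B.reply s x.1).bind fun p => (post q x.2 p.2).map fun y =>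
        (compState Q κ valid pre post B (q :: log) p.1, .cons .nil y) :=
  if_pos h

theorem compGame_reply_illegal {pre : Data → PMF (Data × Data)}
    {post : Data → Data → Data → PMF Data} {B : Challenger} {log : List Data} {s : B.State}
    {q : Data} (h : ¬ legalLog Q κ valid log q = true) :
    (compGame Q κ valid pre post B).reply (compState Q κ valid pre post B log s) q =
      PMF.pure (compState Q κ valid pre post B log s, .nil) :=
  if_neg h

/-- A composed game is an adaptive game if the answers have the right distribution. -/
theorem run_compGame (A : Adversary) {pre : Data → PMF (Data × Data)}
    {post : Data → Data → Data → PMF Data} {B : Challenger} {key : Data → PMF Data}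
    {chal : Data → Data → PMF Data} (J : List Data → B.State → Prop)
    (h : ∀ log s, J log s → ∀ q, legalLog Q κ valid log q = true →
      ((pre q).bind fun x => (B.reply s x.1).bind fun p => post q x.2 p.2) = answer key chal q ∧
      ∀ x ∈ (pre q).support, ∀ p ∈ (B.reply s x.1).support, J (q :: log) p.1)
    (b k : ℕ) (log : List Data) (s : B.State) (m : Data) {n : ℕ} (ψ : QState n) (hJ : J log s) :
    A.run (compGame Q κ valid pre post B) b k (compState _ _ _ _ _ _ log s) m ψ =
      A.run (logGame Q κ valid key chal) b k (logState _ _ _ _ _ log) m ψ := by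
  obtain ⟨qa, hqa⟩ := A.exists_payload_bound
  refine (A.run_bisim (C := logGame Q κ valid key chal) (C' := compGame Q κ valid pre post B)
    (fun s : List Data × B.State => s.1) (fun _ s => J s.1 s.2) b (qa.eval b) (hqa b)
    (fun _ _ h => h) (fun _ s hs q _ => ?_) k (compState _ _ _ _ _ _ log s) m ψ hJ).symm
  obtain ⟨log, s⟩ := s
  by_cases hq : legalLog Q κ valid log q = true
  · have h1 : (logGame Q κ valid key chal).reply log q = _ := logGame_reply hq
    have h2 : (compGame Q κ valid pre post B).reply (log, s) q = _ := compGame_reply hq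
    obtain ⟨h3, h4⟩ := h log s hs q hq
    rw [h2, h1, ← h3]
    refine ⟨?_, fun p hp => ?_⟩
    · simp only [PMF.map_bind, PMF.map_comp]
      rfl
    · rw [PMF.mem_support_bind_iff] at hp
      obtain ⟨x, hx, hp⟩ := hp
      rw [PMF.mem_support_bind_iff] at hp
      obtain ⟨p', hp', hp⟩ := hp
      obtain ⟨y, -, rfl⟩ := (PMF.mem_support_map_iff _ _ _).1 hp
      exact h4 x hx p' hp'
  · have h1 : (logGame Q κ valid key chal).reply log q = _ := logGame_reply_illegal hq
    have h2 : (compGame Q κ valid pre post B).reply (log, s) q = _ := compGame_reply_illegal hq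
    rw [h1, h2, PMF.pure_map]
    refine ⟨rfl, fun p hp => ?_⟩
    rw [PMF.mem_support_pure_iff] at hp
    subst hp
    exact hs

/-- The output of the adversary in a composed game that goes on for `k` steps, where `c` and the
first message of the challenger are the inputs of `pre`, `post` and `first`. -/
noncomputable def compRun (Q : PolicyClass) (κ : ℕ) (valid : Data → Bool) (A : Adversary)
    (pre : Data → Data → PMF (Data × Data)) (post : Data → Data → Data → Data → PMF Data)
    (first : Data → Data) (B : Challenger) (c : Data) (k : ℕ) (log : List Data)
    (ψ : QState (A.qubits κ)) : PMF Bool :=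
  B.start.bind fun p => A.run (compGame Q κ valid (pre (.cons c p.2)) (post (.cons c p.2)) B)
    (A.bound.eval κ) k (compState _ _ _ _ _ _ log p.1) (first (.cons c p.2)) ψ

/-- Here `x` stands for what the challenger samples at the start, and `φ` turns it into state and
first message. The invariant `J` ties the state of the challenger to the log, so that its answers
are known in distribution. Each reduction below is identified with a hybrid in this way. -/
theorem compRun_eq (A : Adversary) {pre : Data → Data → PMF (Data × Data)}
    {post : Data → Data → Data → Data → PMF Data} (first : Data → Data) {B : Challenger} (c : Data)
    (k : ℕ) (log : List Data) (ψ : QState (A.qubits κ)) {σ : Type} (p : PMF σ)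
    (φ : σ → B.State × Data) (hp : B.start = p.map φ) (key : σ → Data → PMF Data)
    (chal : σ → Data → Data → PMF Data) (J : σ → List Data → B.State → Prop)
    (hJ : ∀ x, J x log (φ x).1)
    (h : ∀ x log s, J x log s → ∀ q, legalLog Q κ valid log q = true →
      ((pre (.cons c (φ x).2) q).bind fun y => (B.reply s y.1).bind fun r =>
        post (.cons c (φ x).2) q y.2 r.2) = answer (key x) (chal x) q ∧
      ∀ y ∈ (pre (.cons c (φ x).2) q).support, ∀ r ∈ (B.reply s y.1).support,
        J x (q :: log) r.1) :
    compRun Q κ valid A pre post first B c k log ψ =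
      p.bind fun x => A.run (logGame Q κ valid (key x) (chal x)) (A.bound.eval κ) k
        (logState _ _ _ _ _ log) (first (.cons c (φ x).2)) ψ := by
  rw [compRun, hp, PMF.bind_map]
  refine congrArg _ (funext fun x => ?_)
  exact run_compGame A (J x) (h x) _ _ _ _ _ _ (hJ x)

end

theorem PF.legalLog {Q : PolicyClass} (hQ : Q.Efficient) {valid : ℕ → Data → Bool}
    (hv : PF fun x : ℕ × Data => valid x.1 x.2) :
    PF fun x : Data × Data × Data =>
      legalLog Q x.1.hd.hd.toNat (valid x.1.hd.hd.toNat) x.2.1.toList x.2.2 := by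
  obtain ⟨h1, h2, h3⟩ := hQ
  rw [polyTime_iff_PF] at h1 h2 h3
  have hattr : PF fun x : ℕ × Data => Q.attr x.1 x.2 :=
    (h1.comp (g := fun x : ℕ × Data => Enc.enc x) (by fun_prop)).of_enc_eq fun x => by
      simp [Enc.enc]
  have hpol : PF fun x : ℕ × Data => Q.pol x.1 x.2 :=
    (h2.comp (g := fun x : ℕ × Data => Enc.enc x) (by fun_prop)).of_enc_eq fun x => by
      simp [Enc.enc]
  have hsat : PF fun x : ℕ × Data × Data => Q.sat x.1 x.2.1 x.2.2 :=
    (h3.comp (g := fun x : ℕ × Data × Data => Enc.enc x) (by fun_prop)).of_enc_eq fun x => by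
      simp [Enc.enc]
  have a1 := hattr.comp (g := fun x : Data × Data × Data => (x.1.hd.hd.toNat, x.2.2.tl.hd))
    (by fun_prop)
  have a2 := hv.comp (g := fun x : Data × Data × Data => (x.1.hd.hd.toNat, x.2.2.tl.tl))
    (by fun_prop)
  have a3 := hpol.comp (g := fun x : Data × Data × Data => (x.1.hd.hd.toNat, x.2.2.tl))
    (by fun_prop)
  have a4 := hsat.comp (g := fun x : (Data × Data × Data) × Data =>
    (x.1.1.hd.hd.toNat, x.2.tl, x.1.2.2.tl.hd)) (by fun_prop)
  have a5 := hsat.comp (g := fun x : (Data × Data × Data) × Data =>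
    (x.1.1.hd.hd.toNat, x.1.2.2.tl, x.2.tl.hd)) (by fun_prop)
  have a6 := PF.list_all (f := fun x : Data × Data × Data => x.2.1.toList)
    (h := fun (x : Data × Data × Data) (e : Data) =>
      !e.hd.toBool && !Q.sat x.1.hd.hd.toNat e.tl x.2.2.tl.hd)
    (by fun_prop) (by fun_prop)
  have a7 := PF.list_all (f := fun x : Data × Data × Data => x.2.1.toList)
    (h := fun (x : Data × Data × Data) (e : Data) =>
      if e.hd.toBool then !Q.sat x.1.hd.hd.toNat x.2.2.tl e.tl.hd else true)
    (by fun_prop) (by fun_prop)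
  unfold _root_.legalLog
  fun_prop

/-- Composed games are indistinguishable if the challengers inside are. -/
theorem compGame_indist {Q : PolicyClass} (hQ : Q.Efficient) {valid : ℕ → Data → Bool}
    (hv : PF fun x : ℕ × Data => valid x.1 x.2) (A : Adversary)
    {pre : Data → Data → PMF (Data × Data)} {post : Data → Data → Data → Data → PMF Data}
    (hpre : PPTF fun x : Data × Data => pre x.1 x.2)
    (hpost : PPTF fun x : Data × Data × Data × Data => post x.1 x.2.1 x.2.2.1 x.2.2.2)
    {first : Data → Data} (hfirst : PF first)
    {B₀ B₁ : ℕ → Challenger} (h : Indistinguishable B₀ B₁) (h₀ : PolyBounded B₀)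
    (h₁ : PolyBounded B₁) (c : ℕ → Data) (log : ℕ → List Data) (pc pl : Polynomial ℕ)
    (hc : ∀ κ, (c κ).size ≤ pc.eval κ) (hl : ∀ κ, (Data.ofList (log κ)).size ≤ pl.eval κ)
    (k : ℕ → ℕ) (hk : ∀ κ, k κ ≤ A.bound.eval κ) (ψ : ∀ κ, QState (A.qubits κ)) :
    Negligible fun κ =>
      |prT (compRun Q κ (valid κ) A pre post first (B₀ κ) (.cons (.ofNat κ) (c κ)) (k κ) (log κ)
          (ψ κ)) -
        prT (compRun Q κ (valid κ) A pre post first (B₁ κ) (.cons (.ofNat κ) (c κ)) (k κ) (log κ)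
          (ψ κ))| := by
  obtain ⟨W, p₁, p₂, hWl, hWf, hW⟩ := Wrapper.exists_of_PPTF (legal := fun c log q =>
    legalLog Q c.hd.hd.toNat (valid c.hd.hd.toNat) log.toList q) (PF.legalLog hQ hv) hfirst
    hpre hpost
  obtain ⟨qa, hqa⟩ := A.exists_payload_bound
  obtain ⟨d, hd⟩ := hpre.size_bound
  obtain ⟨g₀, I₀, hB₀⟩ := id h₀
  obtain ⟨g₁, I₁, hB₁⟩ := id h₁
  let c0 : ℕ → Data := fun κ => .cons (.ofNat κ) (c κ)
  let pc0 : Polynomial ℕ := 2 * .X + pc + 2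
  have hc0 : ∀ κ, (c0 κ).size ≤ pc0.eval κ := by
    intro κ
    have := hc κ
    simp only [c0, pc0, Data.size, Data.size_ofNat, Polynomial.eval_add, Polynomial.eval_mul,
      Polynomial.eval_X, Polynomial.eval_ofNat]
    omega
  -- Bounds for the fixed data together with a query, for the output of `pre`, for the answer of the
  -- challenger, and finally for the number of random bits that suffices for every query.
  let pcq : Polynomial ℕ := (pc0 + (g₀ + g₁) + 1) + qa.comp A.bound + 1
  let px : Polynomial ℕ := d.comp pcq
  let pa : Polynomial ℕ := (g₀ + g₁).comp (.X + px)
  let pN : Polynomial ℕ := p₁.comp pcq + p₂.comp (pcq + px + pa + 3)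
  have key : ∀ (B : Challenger) (κ : ℕ) (I : B.State → Prop)
      (_ : ∀ p ∈ B.start.support, I p.1 ∧ p.2.size ≤ (g₀ + g₁).eval κ)
      (_ : ∀ s, I s → ∀ q : Data, ∀ p ∈ (B.reply s q).support,
        I p.1 ∧ p.2.size ≤ (g₀ + g₁).eval (κ + q.size)),
      compRun Q κ (valid κ) A pre post first B (c0 κ) (k κ) (log κ) (ψ κ) =
        B.start.bind fun p => A.run (W.rand B (pN.eval κ) (.cons (c0 κ) p.2))
          (A.bound.eval κ) (k κ) (W.randState B (pN.eval κ) (.cons (c0 κ) p.2)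
            (.ofList (log κ)) p.1) (W.first (.cons (c0 κ) p.2)) (ψ κ) := by
    intro B κ I hI1 hI2
    refine PMF.bind_congr_support fun p hp => ?_
    obtain ⟨hp1, hp2⟩ := hI1 p hp
    have hcs : (Data.cons (c0 κ) p.2).size ≤ (pc0 + (g₀ + g₁) + 1).eval κ := by
      have := hc0 κ
      rw [Polynomial.eval_add] at hp2
      simp only [Data.size, Polynomial.eval_add, Polynomial.eval_one]
      omega
    rw [hWf]
    have := A.run_bisim (C := compGame Q κ (valid κ) (pre (.cons (c0 κ) p.2))
      (post (.cons (c0 κ) p.2)) B) (C' := W.rand B (pN.eval κ) (.cons (c0 κ) p.2))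
      (fun s : Data × B.State => (s.1.toList, s.2)) (fun _ (s : Data × B.State) => I s.2)
      (A.bound.eval κ) (qa.eval (A.bound.eval κ)) (hqa _) (fun _ _ h => h)
      (fun _ s hs q hq => ?_) (k κ) (W.randState _ _ _ (.ofList (log κ)) p.1)
      (first (.cons (c0 κ) p.2)) (ψ κ) hp1
    · rw [← this]
      simp only [compState, Wrapper.randState, Data.toList_ofList]
    · obtain ⟨l, s⟩ := s
      have hlegal : W.legal (.cons (c0 κ) p.2) l q = legalLog Q κ (valid κ) l.toList q := by
        rw [hWl]
        simp [c0]
      by_cases hleg : legalLog Q κ (valid κ) l.toList q = true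
      · have e1 : (compGame Q κ (valid κ) (pre (.cons (c0 κ) p.2))
          (post (.cons (c0 κ) p.2)) B).reply (l.toList, s) q = _ := compGame_reply hleg
        have e2 : (W.rand B (pN.eval κ) (.cons (c0 κ) p.2)).reply (l, s) q = _ :=
          Wrapper.rand_reply (hlegal.trans hleg)
        rw [e1, e2]
        refine ⟨?_, fun y hy => ?_⟩
        · have e3 := hW B s (.cons (c0 κ) p.2) q (pN.eval κ) ?_
          · have e4 := congrArg (PMF.map fun y : B.State × Data =>
              (compState Q κ (valid κ) (pre (.cons (c0 κ) p.2)) (post (.cons (c0 κ) p.2)) B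
                (q :: l.toList) y.1, Data.cons .nil y.2)) e3
            simp only [PMF.map_bind, PMF.map_comp, Function.comp_def] at e4 ⊢
            exact e4.symm
          · intro x hx y hy
            have s1 : esize (Data.cons (c0 κ) p.2, q) ≤ pcq.eval κ := by
              simp only [pcq, esize_prod, esize_data]
              rw [Polynomial.eval_add, Polynomial.eval_add, Polynomial.eval_comp,
                Polynomial.eval_one]
              omega
            have s2 : esize x ≤ px.eval κ := by
              simp only [px, Polynomial.eval_comp]
              exact (hd _ x hx).trans (d.eval_mono_nat s1)
            have s3 : y.2.size ≤ pa.eval κ := by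
              refine (hI2 s hs x.1 y hy).2.trans ?_
              simp only [pa, Polynomial.eval_comp]
              refine (g₀ + g₁).eval_mono_nat ?_
              rw [Polynomial.eval_add, Polynomial.eval_X]
              simp only [esize_prod, esize_data] at s2
              omega
            simp only [pN]
            rw [Polynomial.eval_add, Polynomial.eval_comp, Polynomial.eval_comp]
            refine Nat.add_le_add (p₁.eval_mono_nat s1) (p₂.eval_mono_nat ?_)
            simp only [esize_prod, esize_data, Polynomial.eval_add, Polynomial.eval_ofNat]
              at s1 s2 ⊢
            omega
        · rw [PMF.mem_support_bind_iff] at hy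
          obtain ⟨r, -, hy⟩ := hy
          obtain ⟨z, hz, rfl⟩ := (PMF.mem_support_map_iff _ _ _).1 hy
          exact (hI2 s hs _ z hz).1
      · have e1 : (compGame Q κ (valid κ) (pre (.cons (c0 κ) p.2))
          (post (.cons (c0 κ) p.2)) B).reply (l.toList, s) q = _ := compGame_reply_illegal hleg
        have e2 : (W.rand B (pN.eval κ) (.cons (c0 κ) p.2)).reply (l, s) q = _ :=
          Wrapper.rand_reply_illegal (by rwa [hlegal])
        rw [e1, e2, PMF.pure_map]
        refine ⟨rfl, fun y hy => ?_⟩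
        rw [PMF.mem_support_pure_iff] at hy
        subst hy
        exact hs
  refine (W.indist A h h₀ h₁ (fun κ => pN.eval κ) pN (fun _ => le_rfl) c0
    (fun κ => .ofList (log κ)) pc0 pl hc0 hl k hk ψ).mono fun κ => le_of_eq ?_
  have k0 := key (B₀ κ) κ (I₀ κ)
    (fun p hp => ((hB₀ κ).1 p hp).imp_right fun h => by rw [Polynomial.eval_add]; omega)
    (fun s hs q p hp => ((hB₀ κ).2 s hs q p hp).imp_right fun h => by
      rw [Polynomial.eval_add]; omega)
  have k1 := key (B₁ κ) κ (I₁ κ)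
    (fun p hp => ((hB₁ κ).1 p hp).imp_right fun h => by rw [Polynomial.eval_add]; omega)
    (fun s hs q p hp => ((hB₁ κ).2 s hs q p hp).imp_right fun h => by
      rw [Polynomial.eval_add]; omega)
  simp only [c0] at k0 k1
  rw [k0, k1]

/-! ### Obfuscated circuits as answers in adaptive games -/

theorem length_le_size_ofList (l : List Data) : l.length ≤ (Data.ofList l).size := by
  induction l with
  | nil => simp
  | cons a l ih =>
    simp only [Data.ofList, Data.size, List.length_cons]
    omega

theorem Circuit.size_le_size_toData (C : Circuit) : C.size ≤ C.toData.size := by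
  have h1 := length_le_size_ofList (C.gates.map Gate.toData)
  have h2 := length_le_size_ofList (C.outputs.map .ofNat)
  simp only [List.length_map] at h1 h2
  simp only [Circuit.size, Circuit.toData, Data.size, Data.size_ofNat]
  omega

/-- A supremum need not be attained, but if it is positive then its half is exceeded somewhere; if
it is zero every point will do. -/
theorem exists_forall_le_two_mul {τ : Type*} [Nonempty τ] (δ : τ → ℝ) (h0 : ∀ t, 0 ≤ δ t)
    (h1 : ∀ t, δ t ≤ 1) : ∃ t₀, ∀ t, δ t ≤ 2 * δ t₀ := by
  by_contra! H
  have hb : BddAbove (Set.range δ) := ⟨1, by rintro _ ⟨t, rfl⟩; exact h1 t⟩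
  obtain ⟨t⟩ := ‹Nonempty τ›
  obtain ⟨t', ht'⟩ := H t
  have hpos : 0 < ⨆ t, δ t :=
    lt_of_lt_of_le (lt_of_le_of_lt (mul_nonneg zero_le_two (h0 t)) ht') (le_ciSup hb t')
  obtain ⟨_, ⟨s, rfl⟩, hs⟩ := exists_lt_of_lt_csSup (Set.range_nonempty δ)
    (show (⨆ t, δ t) / 2 < sSup (Set.range δ) by change _ < ⨆ t, δ t; linarith)
  obtain ⟨u, hu⟩ := H s
  linarith [le_ciSup hb u]

theorem Obfuscator.Efficient.polyBounded {O : Obfuscator} (h : O.Efficient) {C : ℕ → Circuit}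
    (p : Polynomial ℕ) (hC : ∀ κ, (C κ).toData.size ≤ p.eval κ) :
    PolyBounded fun κ => O.challenger κ (C κ) := by
  obtain ⟨q, hq⟩ := h.obf.size_bound
  refine ⟨q.comp (2 * .X + p + 2) + 1, fun _ _ => True, fun κ => ⟨fun x hx => ⟨trivial, ?_⟩,
    fun s _ d x hx => ⟨trivial, ?_⟩⟩⟩
  · obtain ⟨C', hC', rfl⟩ := (PMF.mem_support_map_iff _ _ _).1 hx
    have h1 := hq (κ, (C κ).toData) C'.toData (by
      rw [Circuit.ofData_toData]
      exact (PMF.mem_support_map_iff _ _ _).2 ⟨C', hC', rfl⟩)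
    rw [esize_data] at h1
    refine h1.trans ?_
    simp only [Polynomial.eval_add, Polynomial.eval_comp, Polynomial.eval_mul, Polynomial.eval_X,
      Polynomial.eval_ofNat, Polynomial.eval_one]
    refine (q.eval_mono_nat ?_).trans (Nat.le_succ _)
    have := hC κ
    simp only [esize_prod, esize_nat, esize_data]
    omega
  · have h1 : x ∈ (PMF.pure ((), Data.nil)).support := hx
    obtain rfl := (PMF.mem_support_pure_iff _ _).1 h1
    simp [Data.size]

/-- The data of a game that goes on after an obfuscated circuit has been received. -/
structure ObfConfig (A : Adversary) (b κ : ℕ) where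
  C₀ : Circuit
  C₁ : Circuit
  wf₀ : C₀.WellFormed
  wf₁ : C₁.WellFormed
  size_eq : C₀.size = C₁.size
  equivalent : C₀.Equivalent C₁
  env : Data
  log : List Data
  mem : Data
  steps : ℕ
  reg : QState (A.qubits κ)
  size₀ : C₀.toData.size ≤ b
  size₁ : C₁.toData.size ≤ b
  size_env : env.size ≤ b
  size_log : (Data.ofList log).size ≤ b
  size_mem : mem.size ≤ b
  steps_le : steps ≤ A.bound.eval κ

/-- The summand 10 makes room for the empty circuit and other trivial entries even if `b = 0`. -/
instance (A : Adversary) (b κ : ℕ) : Nonempty (ObfConfig A (b + 10) κ) :=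
  ⟨{  C₀ := ⟨0, [], []⟩
      C₁ := ⟨0, [], []⟩
      wf₀ := ⟨fun _ h => absurd h (by simp), fun _ h => absurd h (by simp)⟩
      wf₁ := ⟨fun _ h => absurd h (by simp), fun _ h => absurd h (by simp)⟩
      size_eq := rfl
      equivalent := ⟨rfl, fun _ _ => rfl⟩
      env := .nil
      log := []
      mem := .nil
      steps := 0
      reg := A.qadvice κ
      size₀ := by simp [Circuit.toData, Data.size, Data.ofList]
      size₁ := by simp [Circuit.toData, Data.size, Data.ofList]
      size_env := by simp [Data.size]
      size_log := by simp [Data.size, Data.ofList]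
      size_mem := by simp [Data.size]
      steps_le := Nat.zero_le _ }⟩

/-- The output of the adversary if the next answer is an obfuscation of `C`. -/
noncomputable def obfRun (O : Obfuscator) (Q : PolicyClass) (κ : ℕ) (valid : Data → Bool)
    (A : Adversary) (key : Data → PMF Data) (chal : Data → Data → PMF Data) (C : Circuit)
    (j : ℕ) (log : List Data) (m : Data) (ψ : QState (A.qubits κ)) : PMF Bool :=
  (O.obf κ C).bind fun C' => A.run (logGame Q κ valid key chal) (A.bound.eval κ) j
    (logState _ _ _ _ _ log) (.cons m (.cons .nil C'.toData)) ψ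

/-- Obfuscations of equivalent circuits may be exchanged in an efficient game. -/
theorem Obfuscator.IsSecureObfuscator.obfRun_sub_le {O : Obfuscator} (hO : O.IsSecureObfuscator)
    {Q : PolicyClass} (hQ : Q.Efficient) {valid : ℕ → Data → Bool}
    (hv : PF fun x : ℕ × Data => valid x.1 x.2) {key : ℕ → Data → Data → PMF Data}
    {chal : ℕ → Data → Data → Data → PMF Data}
    (hkey : PPTF fun x : ℕ × Data × Data => key x.1 x.2.1 x.2.2)
    (hchal : PPTF fun x : ℕ × Data × Data × Data => chal x.1 x.2.1 x.2.2.1 x.2.2.2)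
    (A : Adversary) (p : Polynomial ℕ) :
    ∃ ε : ℕ → ℝ, Negligible ε ∧ (∀ κ, 0 ≤ ε κ) ∧ ∀ κ (t : ObfConfig A (p.eval κ) κ),
      |prT (obfRun O Q κ (valid κ) A (key κ t.env) (chal κ t.env) t.C₀ t.steps t.log t.mem t.reg) -
        prT (obfRun O Q κ (valid κ) A (key κ t.env) (chal κ t.env) t.C₁ t.steps t.log t.mem t.reg)|
        ≤ ε κ := by
  let δ : ∀ κ, ObfConfig A (p.eval κ + 10) κ → ℝ := fun κ t =>
    |prT (obfRun O Q κ (valid κ) A (key κ t.env) (chal κ t.env) t.C₀ t.steps t.log t.mem t.reg) -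
      prT (obfRun O Q κ (valid κ) A (key κ t.env) (chal κ t.env) t.C₁ t.steps t.log t.mem t.reg)|
  -- One configuration per security parameter, within a factor 2 of the worst one, is enough to
  -- control all of them. Its entries serve as non-uniform data, the register as quantum advice.
  choose T hT using fun κ => exists_forall_le_two_mul (δ κ) (fun _ => abs_nonneg _)
    fun _ => abs_prT_sub_le_one _ _
  refine ⟨fun κ => (2 : ℕ) * δ κ (T κ), ?_, fun κ => mul_nonneg (by norm_num) (abs_nonneg _),
    fun κ t => ?_⟩
  swap
  · simpa using hT κ { t with
      size₀ := t.size₀.trans (Nat.le_add_right _ _)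
      size₁ := t.size₁.trans (Nat.le_add_right _ _)
      size_env := t.size_env.trans (Nat.le_add_right _ _)
      size_log := t.size_log.trans (Nat.le_add_right _ _)
      size_mem := t.size_mem.trans (Nat.le_add_right _ _) }
  refine Negligible.const_mul ?_ 2 fun _ => abs_nonneg _
  have hp10 : ∀ κ, p.eval κ + 10 = (p + 10).eval κ := fun κ => by
    rw [Polynomial.eval_add, Polynomial.eval_ofNat]
  have hind : Indistinguishable (fun κ => O.challenger κ (T κ).C₀)
      (fun κ => O.challenger κ (T κ).C₁) :=
    hO.2.2 (p + 10) _ _ fun κ => ⟨(T κ).wf₀, (T κ).wf₁,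
      (T κ).C₀.size_le_size_toData.trans ((T κ).size₀.trans (hp10 κ).le), (T κ).size_eq,
      (T κ).equivalent⟩
  have hpost : PPTF fun x : Data × Data × Data × Data =>
      if x.2.1.hd.toBool then
        chal x.1.hd.hd.toNat x.1.hd.tl.hd x.2.1.tl.hd x.2.1.tl.tl
      else key x.1.hd.hd.toNat x.1.hd.tl.hd x.2.1.tl :=
    PPTF.cases (by fun_prop)
      (hchal.comp (g := fun x : Data × Data × Data × Data =>
        (x.1.hd.hd.toNat, x.1.hd.tl.hd, x.2.1.tl.hd, x.2.1.tl.tl)) (by fun_prop))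
      (hkey.comp (g := fun x : Data × Data × Data × Data =>
        (x.1.hd.hd.toNat, x.1.hd.tl.hd, x.2.1.tl)) (by fun_prop))
  -- The obfuscated circuit is the first message of the challenger and is placed in the memory as
  -- the awaited answer. Afterwards the challenger is queried only pro forma with `nil`, and all
  -- answers are computed from the environment.
  have hgame := compGame_indist hQ hv A (pre := fun _ _ => PMF.pure (.nil, .nil))
    (post := fun c q _ _ => if q.hd.toBool then
        chal c.hd.hd.toNat c.hd.tl.hd q.tl.hd q.tl.tl
      else key c.hd.hd.toNat c.hd.tl.hd q.tl)
    (PPTF.pure (PF.const _)) hpost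
    (first := fun c => .cons c.hd.tl.tl (.cons .nil c.tl)) (by fun_prop) hind
    (hO.1.polyBounded (p + 10) fun κ => (T κ).size₀.trans (hp10 κ).le)
    (hO.1.polyBounded (p + 10) fun κ => (T κ).size₁.trans (hp10 κ).le)
    (fun κ => .cons (T κ).env (T κ).mem) (fun κ => (T κ).log) (2 * (p + 10) + 1) (p + 10)
    (fun κ => by
      have h1 := (T κ).size_env
      have h2 := (T κ).size_mem
      simp only [Data.size, Polynomial.eval_add, Polynomial.eval_mul, Polynomial.eval_ofNat,
        Polynomial.eval_one]
      omega) (fun κ => (T κ).size_log.trans (hp10 κ).le)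
    (fun κ => (T κ).steps) (fun κ => (T κ).steps_le) fun κ => (T κ).reg
  refine hgame.mono fun κ => le_of_eq ?_
  have hrun : ∀ C : Circuit, compRun Q κ (valid κ) A _ _ _ (O.challenger κ C)
      (.cons (.ofNat κ) (.cons (T κ).env (T κ).mem)) (T κ).steps (T κ).log (T κ).reg =
        obfRun O Q κ (valid κ) A (key κ (T κ).env) (chal κ (T κ).env) C (T κ).steps (T κ).log
          (T κ).mem (T κ).reg := fun C => by
    refine compRun_eq A (pre := fun _ _ => PMF.pure (.nil, .nil)) (post := fun c q _ _ =>
      if q.hd.toBool then chal c.hd.hd.toNat c.hd.tl.hd q.tl.hd q.tl.tl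
      else key c.hd.hd.toNat c.hd.tl.hd q.tl) (fun c => .cons c.hd.tl.tl (.cons .nil c.tl)) _ _ _ _
      (O.obf κ C) (fun C' => ((), C'.toData)) rfl (fun _ => key κ (T κ).env)
      (fun _ => chal κ (T κ).env) (fun _ _ _ => True) (fun _ => trivial)
      fun _ log s _ q _ => ⟨?_, fun _ _ _ _ => trivial⟩
    rw [PMF.pure_bind]
    refine (PMF.pure_bind _ _).trans ?_
    rw [answer]
    simp only [Data.hd_cons, Data.tl_cons, Data.toNat_ofNat]
  rw [hrun, hrun]

/-! ### Keys of the construction in the real and in the fake form -/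

section
variable {Q : PolicyClass} {κ : ℕ} {valid : Data → Bool}

/-- Two adaptive games whose keys differ are compared key by key. -/
theorem run_logGame_key_sub_le (A : Adversary) {key key' : Data → PMF Data}
    {chal : Data → Data → PMF Data} (b qb K L : ℕ) {n : ℕ} {ε : ℝ} (hε : 0 ≤ ε)
    (hqb : ∀ m : Data, m.size ≤ b → (A.control m).1.size ≤ qb ∧ (A.control m).2.payload.size ≤ qb)
    (h : ∀ (log : List Data) (m P : Data) (j : ℕ) (ψ : QState n), Q.pol κ P = true → P.size ≤ qb →
      (Data.ofList log).size ≤ L → m.size ≤ qb → j ≤ K →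
      |prT ((key P).bind fun a => A.run (logGame Q κ valid key' chal) b j
          (logState _ _ _ _ _ log) (.cons m (.cons .nil a)) ψ) -
        prT ((key' P).bind fun a => A.run (logGame Q κ valid key' chal) b j
          (logState _ _ _ _ _ log) (.cons m (.cons .nil a)) ψ)| ≤ ε) :
    ∀ (k : ℕ) (log : List Data) (m : Data) (ψ : QState n), k ≤ K →
      (Data.ofList log).size + k * (qb + 1) ≤ L →
      |prT (A.run (logGame Q κ valid key chal) b k (logState _ _ _ _ _ log) m ψ) -
        prT (A.run (logGame Q κ valid key' chal) b k (logState _ _ _ _ _ log) m ψ)| ≤ k * ε := by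
  intro k
  induction k with
  | zero => intro log m ψ _ _; simp [Adversary.run_zero]
  | succ k ih =>
    intro log m ψ hk hlog
    rw [add_mul, one_mul] at hlog
    have hpos : 0 ≤ ((k + 1 : ℕ) : ℝ) * ε := by positivity
    have hle : (k : ℝ) * ε ≤ ((k + 1 : ℕ) : ℝ) * ε :=
      mul_le_mul_of_nonneg_right (by push_cast; linarith) hε
    by_cases hm : b < m.size
    · simpa only [Adversary.run_of_lt _ hm, sub_self, abs_zero] using hpos
    obtain ⟨hq1, hq2⟩ := hqb m (by omega)
    rcases (A.control m).2.kind with ⟨x, hx⟩ | ⟨q, hq⟩ | hl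
    · simpa only [Adversary.run_output _ hm hx, sub_self, abs_zero] using hpos
    · simp only [Adversary.run_send _ hm hq]
      rw [hq] at hq2
      change q.size ≤ qb at hq2
      by_cases hlegal : legalLog Q κ valid log q = true
      · simp only [logGame_reply hlegal, PMF.bind_map, Function.comp_def]
        have hlog' : (Data.ofList (q :: log)).size + k * (qb + 1) ≤ L := by
          simp only [Data.ofList, Data.size]
          omega
        have hih := fun (p : PMF Data) => prT_bind_sub_le p
          (fun a => A.run (logGame Q κ valid key chal) b k (logState _ _ _ _ _ (q :: log))
            (.cons (A.control m).1 (.cons .nil a)) ψ)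
          (fun a => A.run (logGame Q κ valid key' chal) b k (logState _ _ _ _ _ (q :: log))
            (.cons (A.control m).1 (.cons .nil a)) ψ) (k * ε)
          fun a _ => ih _ _ _ (by omega) hlog'
        cases hc : q.hd.toBool
        · have e1 : ∀ chal : Data → Data → PMF Data, ∀ key : Data → PMF Data,
              answer key chal q = key q.tl := fun chal key => by simp [answer, hc]
          rw [e1, e1]
          have hpol : Q.pol κ q.tl = true := by
            rw [legalLog, if_neg (by simp [hc])] at hlegal
            simp only [Bool.and_eq_true] at hlegal
            exact hlegal.1
          have h2 := h (q :: log) (A.control m).1 q.tl k ψ hpol ((Data.size_tl_le q).trans hq2)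
            (by omega) hq1 (by omega)
          -- Triangle inequality at a key query: first the remainder of the game is exchanged by the
          -- induction hypothesis, then this one key, in front of a game that already uses `key'`.
          -- Each action costs at most one `ε`.
          refine (abs_sub_le _ _ _).trans ((add_le_add (hih _) h2).trans (le_of_eq ?_))
          push_cast
          ring
        · have e1 : answer key chal q = answer key' chal q := by simp [answer, hc]
          rw [e1]
          exact (hih _).trans hle
      · simp only [logGame_reply_illegal hlegal, PMF.pure_bind]
        exact (ih _ _ _ (by omega) (by omega)).trans hle
    · simp only [Adversary.run_local _ hm hl]
      exact (prT_bind_sub_le _ _ _ (k * ε) fun p _ => ih _ _ _ (by omega) (by omega)).trans hle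

end

theorem Data.size_vec_le {n B : ℕ} {f : Fin n → Data} (h : ∀ i, (f i).size ≤ B) :
    (Data.vec f).size ≤ n * (B + 1) + 1 := by
  have key : ∀ l : List Data, (∀ x ∈ l, x.size ≤ B) →
      (Data.ofList l).size ≤ l.length * (B + 1) + 1 := by
    intro l
    induction l with
    | nil => simp [Data.ofList, Data.size]
    | cons a l ih =>
      intro hl
      have h1 := ih fun x hx => hl x (List.mem_cons_of_mem _ hx)
      have h2 := hl a (List.mem_cons_self)
      simp only [Data.ofList, Data.size, List.length_cons, add_mul, one_mul] at *
      omega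
  refine (key (List.ofFn f) fun x hx => ?_).trans_eq (by rw [List.length_ofFn])
  · obtain ⟨i, rfl⟩ := (List.mem_ofFn' _ _).1 hx
    exact h i

/-- The public keys, all master secret keys, the selected master secret keys, and the public key,
the master secret key and the auxiliary information of the construction. -/
def ncPks {n : ℕ} (k : Fin n → Bool → Data × Data) : Data := .vec fun i => .pair fun b => (k i b).1

def ncMsks {n : ℕ} (k : Fin n → Bool → Data × Data) : Data := .vec fun i => .pair fun b => (k i b).2

def ncSel {n : ℕ} (k : Fin n → Bool → Data × Data) (z : Fin n → Bool) : Data :=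
  .vec fun i => (k i (z i)).2

def ncBits {n : ℕ} (z : Fin n → Bool) : Data := .ofBits (List.ofFn z)

def ncPk {n : ℕ} (k : Fin n → Bool → Data × Data) (crs : Data) : Data := .cons (ncPks k) crs

def ncMsk {n : ℕ} (k : Fin n → Bool → Data × Data) (crs : Data) (z : Fin n → Bool) : Data :=
  .cons (ncPk k crs) (.cons (ncSel k z) (ncBits z))

def ncAux {n : ℕ} (k : Fin n → Bool → Data × Data) (crs td : Data) (z : Fin n → Bool) : Data :=
  .cons (ncPk k crs) (.cons td (.cons (ncMsks k) (ncBits z)))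

/-- The key pairs of the construction. -/
noncomputable def ncKeys (S : ABE) (len : ℕ → ℕ) (κ : ℕ) :
    PMF (Fin (len κ) → Bool → Data × Data) :=
  sampleVec (len κ) fun _ => samplePair fun _ => S.setup κ

theorem mem_support_ncKeys {S : ABE} {len : ℕ → ℕ} {κ : ℕ}
    {k : Fin (len κ) → Bool → Data × Data} :
    k ∈ (ncKeys S len κ).support ↔ ∀ i b, k i b ∈ (S.setup κ).support := by
  rw [ncKeys, mem_support_sampleVec]
  exact forall_congr' fun i => mem_support_samplePair

section
variable {Q : PolicyClass} {len : ℕ → ℕ} {S : ABE} {O : Obfuscator} {N : NIZK}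
  {Z : NIZKSimulator} {D : DecCircuits}

theorem exists_ncKeys_bound (hlen : PF fun κ : ℕ => len κ) (hS : S.Efficient) :
    ∃ p : Polynomial ℕ, ∀ κ, len κ ≤ p.eval κ ∧ ∀ k ∈ (ncKeys S len κ).support,
      ∀ z : Fin (len κ) → Bool, (∀ i b, (k i b).1.size ≤ p.eval κ ∧ (k i b).2.size ≤ p.eval κ) ∧
      (ncPks k).size ≤ p.eval κ ∧ (ncMsks k).size ≤ p.eval κ ∧
      (ncSel k z).size ≤ p.eval κ ∧ (ncBits z).size ≤ p.eval κ := by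
  obtain ⟨pl, hl⟩ := hlen.out_bound
  obtain ⟨ps, hs⟩ := hS.setup.size_bound
  let l : Polynomial ℕ := pl.comp (2 * .X + 1)
  let s : Polynomial ℕ := ps.comp (2 * .X + 1)
  have hl' : ∀ κ, len κ ≤ l.eval κ := fun κ => by
    have := hl κ
    simp only [esize_nat] at this
    simp only [l, Polynomial.eval_comp, Polynomial.eval_add, Polynomial.eval_mul, Polynomial.eval_X,
      Polynomial.eval_ofNat, Polynomial.eval_one]
    omega
  refine ⟨4 * l + s + l * (2 * s + 1 + 1) + 1, fun κ => ?_⟩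
  have he : (4 * l + s + l * (2 * s + 1 + 1) + 1).eval κ =
      4 * l.eval κ + s.eval κ + l.eval κ * (2 * s.eval κ + 1 + 1) + 1 := by
    simp only [Polynomial.eval_add, Polynomial.eval_mul, Polynomial.eval_ofNat, Polynomial.eval_one]
  rw [he]
  have h1 := hl' κ
  refine ⟨by omega, fun k hk z => ?_⟩
  rw [mem_support_ncKeys] at hk
  have h2 : ∀ i b, (k i b).1.size + (k i b).2.size + 1 ≤ s.eval κ := fun i b => by
    have := hs κ _ (hk i b)
    simp only [esize_prod, esize_data, esize_nat] at this
    simpa [s, Polynomial.eval_comp] using this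
  have h3 := Nat.mul_le_mul_right (2 * s.eval κ + 1 + 1) h1
  refine ⟨fun i b => ⟨by have := h2 i b; omega, by have := h2 i b; omega⟩, ?_, ?_, ?_, ?_⟩
  · refine (Data.size_vec_le (B := 2 * s.eval κ + 1) fun i => ?_).trans (by omega)
    have a := h2 i false
    have b := h2 i true
    simp only [Data.pair, Data.size]
    omega
  · refine (Data.size_vec_le (B := 2 * s.eval κ + 1) fun i => ?_).trans (by omega)
    have a := h2 i false
    have b := h2 i true
    simp only [Data.pair, Data.size]
    omega
  · refine (Data.size_vec_le (B := 2 * s.eval κ + 1) fun i => ?_).trans (by omega)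
    have a := h2 i (z i)
    omega
  · have h4 := esize_bits (List.ofFn z)
    rw [List.length_ofFn] at h4
    change (ncBits z).size ≤ _ at h4
    omega

/-- Left-or-right decryption and left decryption coincide if no false statement has an accepted
proof. -/
theorem circuits_equivalent (hcorrect : S.PerfectlyCorrect Q) (hD : D.Implement S N Q len)
    {κ : ℕ} {P crs : Data} {k : Fin (len κ) → Bool → Data × Data}
    (hk : k ∈ (ncKeys S len κ).support) {z : Fin (len κ) → Bool}
    (hcrs : ∀ x π, N.vrfy κ crs x π = true → ∃ w, doubleRelation S Q len κ x w)
    (hP : Q.pol κ P = true) {sk sk' : Fin (len κ) → Data}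
    (hsk : ∀ i, sk i ∈ (S.keyGen κ (k i (z i)).2 P).support)
    (hsk' : ∀ i, sk' i ∈ (S.keyGen κ (k i false).2 P).support) :
    (D.leftOrRight κ P (ncPk k crs) (.vec sk) (List.ofFn z)).Equivalent
      (D.left κ P (ncPk k crs) (.vec sk')) := by
  rw [mem_support_ncKeys] at hk
  refine (hD.leftOrRight_spec _ _ _ _ _).equivalent (hD.left_spec _ _ _ _) fun d => ?_
  rw [leftOrRightDec, leftDec]
  split_ifs with hv
  -- The statement is true, so the ciphertexts are honest encryptions of common bits `m i` under the
  -- honest public keys. The keys at `z i` and at the left position then give the same value, which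
  -- depends only on `m i` and on whether `P` accepts `X`.
  · obtain ⟨w, pk, ct, X, m, r, hx, -, hX, hct⟩ := hcrs _ _ hv
    simp only [doubleStatement, ncPk, Data.hd_cons, Data.cons.injEq] at hx
    obtain ⟨hpk, hcts, -⟩ := hx
    have hpk' : ∀ i b, pk i b = (k i b).1 := fun i b => by
      have := congrArg (fun d => (d.nth i).sel b) hpk
      simpa [ncPks] using this.symm
    rw [hcts]
    refine joinBits_congr fun i => ?_
    have hz : (List.ofFn z).getD i false = z i := by simp
    simp only [Data.nth_vec]
    rw [hz, Data.sel_pair, show (Data.pair (ct i)).hd = ct i false from rfl,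
      (hct i (z i)).2, (hct i false).2, hpk', hpk',
      hcorrect.dec_eq hP hX (hk i _) (hsk i) (hct i _).1,
      hcorrect.dec_eq hP hX (hk i _) (hsk' i) (hct i _).1]
  · rfl

end

/-! ### Exchange of all keys -/

theorem pr_map {α β : Type} (p : PMF α) (f : α → β) (E : β → Prop) :
    pr (p.map f) E = pr p fun a => E (f a) := by
  rw [pr, pr, PMF.toOuterMeasure_map_apply]
  rfl

/-- Both sides are compared on independent samples; each side ignores the sample of the other. -/
theorem prT_bind_sub_le' {α β : Type} (p : PMF α) (q : PMF β) (f : α → PMF Bool)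
    (g : β → PMF Bool) (ε : ℝ) (h : ∀ a ∈ p.support, ∀ b ∈ q.support, |prT (f a) - prT (g b)| ≤ ε) :
    |prT (p.bind f) - prT (q.bind g)| ≤ ε := by
  rw [show q.bind g = p.bind fun _ => q.bind g from (PMF.bind_const _ _).symm]
  refine prT_bind_sub_le _ _ _ _ fun a ha => ?_
  rw [show f a = q.bind fun _ => f a from (PMF.bind_const _ _).symm]
  exact prT_bind_sub_le _ _ _ _ fun b hb => h a ha b hb

/-- A common reference string is bad if some false statement has an accepted proof. -/
def BadCrs (N : NIZK) (R : ℕ → Data → Data → Prop) (κ : ℕ) (crs : Data) : Prop :=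
  ∃ x π, (¬ ∃ w, R κ x w) ∧ N.vrfy κ crs x π = true

-- The soundness adversary is unbounded: it may choose, for every bad reference string, a false
-- statement with an accepted proof. It wins whenever the string is bad. This turns soundness into a
-- statement about all proofs simultaneously, as equivalence of circuits requires.
open Classical in
theorem NIZK.StatisticallySound.negligible_bad {N : NIZK} {R : ℕ → Data → Data → Prop}
    (h : N.StatisticallySound R) : Negligible fun κ => pr (N.setup κ) (BadCrs N R κ) := by
  let a : ℕ → Data → Data × Data := fun κ crs =>
    if hb : BadCrs N R κ crs then (hb.choose, hb.choose_spec.choose) else (.nil, .nil)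
  refine (h fun κ crs => PMF.pure (a κ crs)).mono fun κ => ?_
  have e : (do
      let crs ← N.setup κ
      let a ← PMF.pure (a κ crs)
      pure (crs, a)) = (N.setup κ).map fun crs => (crs, a κ crs) := by
    change PMF.bind _ _ = PMF.bind _ _
    congr 1
    funext crs
    exact PMF.pure_bind _ _
  rw [e, pr_map, pr, pr]
  refine ENNReal.toReal_mono (PMF.toOuterMeasure_ne_top _ _) ?_
  refine MeasureTheory.measure_mono fun crs hb => ?_
  have hb' : BadCrs N R κ crs := hb
  simp only [Set.mem_ofPred_eq, a, dif_pos hb']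
  exact hb'.choose_spec.choose_spec

section
variable {Q : PolicyClass} {len : ℕ → ℕ} {S : ABE} {O : Obfuscator} {N : NIZK}
  {Z : NIZKSimulator} {D : DecCircuits}

theorem keyGen_bind {β : Type} (κ : ℕ) (k : Fin (len κ) → Bool → Data × Data) (crs P : Data)
    (z : Fin (len κ) → Bool) (F : Data → PMF β) :
    ((ncabe S N Z O D len).keyGen κ (ncMsk k crs z) P).bind F =
      (sampleVec (len κ) fun i => S.keyGen κ (k i (z i)).2 P).bind fun sk =>
        (O.obf κ (D.leftOrRight κ P (ncPk k crs) (.vec sk) (List.ofFn z))).bind fun C =>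
          F C.toData := by
  have e : (ncabe S N Z O D len).keyGen κ (ncMsk k crs z) P =
      (sampleVec (len κ) fun i => S.keyGen κ ((ncSel k z).nth i) P).bind fun sk =>
        (O.obf κ (D.leftOrRight κ P (ncPk k crs) (.vec sk) (ncBits z).toBits)).map
          Circuit.toData := rfl
  simp only [e, PMF.bind_bind, PMF.bind_map, ncSel, ncBits, Data.nth_vec, Data.toBits_ofBits]
  rfl

theorem fakeSK_bind {β : Type} (κ : ℕ) (k : Fin (len κ) → Bool → Data × Data) (crs td P : Data)
    (z : Fin (len κ) → Bool) (F : Data → PMF β) :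
    ((ncabe S N Z O D len).fakeSK κ (ncPk k crs) (ncAux k crs td z) P).bind F =
      (sampleVec (len κ) fun i => S.keyGen κ (k i false).2 P).bind fun sk =>
        (O.obf κ (D.left κ P (ncPk k crs) (.vec sk))).bind fun C => F C.toData := by
  have e : (ncabe S N Z O D len).fakeSK κ (ncPk k crs) (ncAux k crs td z) P =
      (sampleVec (len κ) fun i => S.keyGen κ ((ncMsks k).nth i).hd P).bind fun sk =>
        (O.obf κ (D.left κ P (ncPk k crs) (.vec sk))).map Circuit.toData := rfl
  simp only [e, PMF.bind_bind, PMF.bind_map, ncMsks, Data.nth_vec]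
  rfl

/-- The admissible plaintexts. -/
def validMsg (len : ℕ → ℕ) (κ : ℕ) (m : Data) : Bool := m.toBits.length == len κ

theorem PF.validMsg (hlen : PF fun κ : ℕ => len κ) :
    PF fun x : ℕ × Data => validMsg len x.1 x.2 := by
  have := hlen.comp (g := fun x : ℕ × Data => x.1) (by fun_prop)
  unfold _root_.validMsg
  fun_prop

/-- The answer to the challenge query in the real experiment. -/
noncomputable def chalReal (S : ABE) (N : NIZK) (len : ℕ → ℕ) (κ : ℕ) (pk msk X m : Data) :
    PMF Data :=
  (ncEnc S N len κ pk X m.toBits).map fun ct => .cons ct msk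

theorem PPTF.chalReal (hlen : PF fun κ : ℕ => len κ) (hS : S.Efficient) (hN : N.Efficient) :
    PPTF fun x : ℕ × Data × Data × Data × Data =>
      chalReal S N len x.1 x.2.1 x.2.2.1 x.2.2.2.1 x.2.2.2.2 :=
  PPTF.map (h := fun (x : ℕ × Data × Data × Data × Data) ct => Data.cons ct x.2.2.1)
    ((PPTF.ncEnc hlen hS hN).comp (g := fun x : ℕ × Data × Data × Data × Data =>
      (x.1, x.2.1, x.2.2.2.1, x.2.2.2.2.toBits)) (by fun_prop)) (by fun_prop)

/-- The experiment with keys given by `key` and real proofs. -/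
noncomputable def setupRun (S : ABE) (N : NIZK) (len : ℕ → ℕ) (κ : ℕ)
    (F : (Fin (len κ) → Bool → Data × Data) → (Fin (len κ) → Bool) → Data → PMF Bool) : PMF Bool :=
  (ncKeys S len κ).bind fun k => (PMF.uniformOfFintype (Fin (len κ) → Bool)).bind fun z =>
    (N.setup κ).bind fun crs => F k z crs

theorem exists_circuit_bound (hlen : PF fun κ : ℕ => len κ) (hS : S.Efficient)
    (hN : N.Efficient) (hD : D.Implement S N Q len) (qb : Polynomial ℕ) :
    ∃ p : Polynomial ℕ, ∀ κ, ∀ k ∈ (ncKeys S len κ).support, ∀ (z : Fin (len κ) → Bool),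
      ∀ crs ∈ (N.setup κ).support, ∀ P : Data, P.size ≤ qb.eval κ →
        (ncPk k crs).size ≤ p.eval κ ∧ (ncMsk k crs z).size ≤ p.eval κ ∧
        (ncAux k crs .nil z).size ≤ p.eval κ ∧
        (∀ sk : Fin (len κ) → Data, (∀ i, sk i ∈ (S.keyGen κ (k i (z i)).2 P).support) →
          (D.leftOrRight κ P (ncPk k crs) (.vec sk) (List.ofFn z)).toData.size ≤ p.eval κ) ∧
        ∀ sk : Fin (len κ) → Data, (∀ i, sk i ∈ (S.keyGen κ (k i false).2 P).support) →
          (D.left κ P (ncPk k crs) (.vec sk)).toData.size ≤ p.eval κ := by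
  obtain ⟨pk, hpk⟩ := exists_ncKeys_bound hlen hS
  obtain ⟨pc, hpc⟩ := hN.setup.size_bound
  obtain ⟨pg, hpg⟩ := hS.keyGen.size_bound
  obtain ⟨pr, hpr⟩ := hD.leftOrRight_PF.out_bound
  obtain ⟨pl, hpl⟩ := hD.left_PF.out_bound
  let c : Polynomial ℕ := pc.comp (2 * .X + 1)
  let g : Polynomial ℕ := pg.comp (2 * .X + 1 + pk + qb + 2)
  let y : Polynomial ℕ := 2 * .X + 1 + qb + (pk + c + 1) + (pk * (g + 1) + 1) + pk + 4
  refine ⟨pr.comp y + pl.comp y + y + 3 * pk + 10 + 2 * c, fun κ k hk z crs hcrs P hP => ?_⟩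
  have hy : y.eval κ = 2 * κ + 1 + qb.eval κ + (pk.eval κ + c.eval κ + 1) +
      (pk.eval κ * (g.eval κ + 1) + 1) + pk.eval κ + 4 := by
    simp only [y, Polynomial.eval_add, Polynomial.eval_mul, Polynomial.eval_X,
      Polynomial.eval_ofNat, Polynomial.eval_one]
  have he : (pr.comp y + pl.comp y + y + 3 * pk + 10 + 2 * c).eval κ =
      pr.eval (y.eval κ) + pl.eval (y.eval κ) + y.eval κ + 3 * pk.eval κ + 10 + 2 * c.eval κ := by
    simp only [Polynomial.eval_add, Polynomial.eval_mul, Polynomial.eval_comp,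
      Polynomial.eval_ofNat]
  rw [he]
  obtain ⟨h1, h2⟩ := hpk κ
  obtain ⟨h3, h4, h5, h6, h7⟩ := h2 k hk z
  have hc : crs.size ≤ c.eval κ := by
    have := hpc κ crs hcrs
    simp only [esize_data, esize_nat] at this
    simpa [c, Polynomial.eval_comp] using this
  have hg : ∀ i b, ∀ sk ∈ (S.keyGen κ (k i b).2 P).support, sk.size ≤ g.eval κ := by
    intro i b sk hsk
    refine (hpg (κ, (k i b).2, P) sk hsk).trans ?_
    simp only [g, Polynomial.eval_comp]
    refine pg.eval_mono_nat ?_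
    have := (h3 i b).2
    simp only [esize_prod, esize_nat, esize_data, Polynomial.eval_add, Polynomial.eval_mul,
      Polynomial.eval_X, Polynomial.eval_ofNat, Polynomial.eval_one]
    omega
  have hv : ∀ sk : Fin (len κ) → Data, (∀ i, (sk i).size ≤ g.eval κ) →
      (Data.vec sk).size ≤ pk.eval κ * (g.eval κ + 1) + 1 := fun sk hsk =>
    (Data.size_vec_le hsk).trans (Nat.add_le_add_right (Nat.mul_le_mul_right _ h1) 1)
  simp only [ncMsk, ncAux, ncPk, Data.size]
  refine ⟨by omega, by omega, by omega, fun sk hsk => ?_, fun sk hsk => ?_⟩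
  · have a1 := hpr (κ, P, ncPk k crs, .vec sk, List.ofFn z)
    have a2 := hv sk fun i => hg i _ _ (hsk i)
    have a3 : esize (List.ofFn z) = (ncBits z).size := rfl
    refine a1.trans ((pr.eval_mono_nat (b := y.eval κ) ?_).trans (by omega))
    simp only [esize_prod, esize_nat, esize_data, a3, ncPk, Data.size]
    omega
  · have a1 := hpl (κ, P, ncPk k crs, .vec sk)
    have a2 := hv sk fun i => hg i _ _ (hsk i)
    refine a1.trans ((pl.eval_mono_nat (b := y.eval κ) ?_).trans (by omega))
    simp only [esize_prod, esize_nat, esize_data, ncPk, Data.size]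
    omega

/-- The real experiment does not change noticeably if all keys are left keys. -/
theorem keys_indist (hQ : Q.Efficient) (hlen : PF fun κ : ℕ => len κ) (hS : S.Efficient)
    (hcorrect : S.PerfectlyCorrect Q) (hO : O.IsSecureObfuscator) (hN : N.Efficient)
    (hsound : N.StatisticallySound (doubleRelation S Q len)) (hD : D.Implement S N Q len)
    (A : Adversary) :
    Negligible fun κ =>
      |prT (setupRun S N len κ fun k z crs => play Q κ (validMsg len κ) A
          ((ncabe S N Z O D len).keyGen κ (ncMsk k crs z))
          (chalReal S N len κ (ncPk k crs) (ncMsk k crs z)) (ncPk k crs)) -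
        prT (setupRun S N len κ fun k z crs => play Q κ (validMsg len κ) A
          ((ncabe S N Z O D len).fakeSK κ (ncPk k crs) (ncAux k crs .nil z))
          (chalReal S N len κ (ncPk k crs) (ncMsk k crs z)) (ncPk k crs))| := by
  obtain ⟨qa, hqa⟩ := (PF.control A).out_bound
  have hqb : ∀ κ, ∀ m : Data, m.size ≤ A.bound.eval κ →
      (A.control m).1.size ≤ (qa.comp A.bound).eval κ ∧
        (A.control m).2.payload.size ≤ (qa.comp A.bound).eval κ := by
    intro κ m hm
    have h6 := (hqa m).trans (qa.eval_mono_nat hm)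
    simp only [Polynomial.eval_comp]
    simp only [esize_prod, esize_data] at h6
    have h7 : (A.control m).2.payload.size ≤ esize (A.control m).2 := Data.size_tl_le _
    omega
  obtain ⟨p, hp⟩ := exists_circuit_bound (Q := Q) hlen hS hN hD (qa.comp A.bound)
  -- Each action adds at most one query to the log, of size at most `qa.comp A.bound` plus one
  -- constructor; the empty log has size 1.
  let L : Polynomial ℕ := A.bound * (qa.comp A.bound + 1) + 1
  let b : Polynomial ℕ := 3 * p + 2 + L + qa.comp A.bound
  have hb : ∀ κ, b.eval κ = 3 * p.eval κ + 2 + L.eval κ + (qa.comp A.bound).eval κ := fun κ => by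
    simp only [b, Polynomial.eval_add, Polynomial.eval_mul, Polynomial.eval_ofNat]
  -- The environment `e` packs public key, auxiliary information and master secret key, so that the
  -- later answers are computed from it by fixed efficient algorithms. One `ε` then serves all keys,
  -- reference strings and moments of the game.
  obtain ⟨ε, hε, hε0, hobf⟩ := hO.obfRun_sub_le hQ (PF.validMsg hlen)
    (key := fun κ e P => (ncabe S N Z O D len).fakeSK κ e.hd e.tl.hd P)
    (chal := fun κ e X m => chalReal S N len κ e.hd e.tl.tl X m)
    ((PPTF.fakeSK hlen hS hO.1 hD).comp (g := fun x : ℕ × Data × Data =>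
      (x.1, x.2.1.hd, x.2.1.tl.hd, x.2.2)) (by fun_prop))
    ((PPTF.chalReal hlen hS hN).comp (g := fun x : ℕ × Data × Data × Data =>
      (x.1, x.2.1.hd, x.2.1.tl.tl, x.2.2.1, x.2.2.2)) (by fun_prop)) A b
  -- The total loss is the probability of a bad reference string plus one obfuscation error for each
  -- action.
  refine (hsound.negligible_bad.add (hε.poly_mul A.bound hε0)
    fun _ => ENNReal.toReal_nonneg).mono fun κ => ?_
  refine prT_bind_sub_le _ _ _ _ fun k hk => prT_bind_sub_le _ _ _ _ fun z _ =>
    prT_bind_sub_le_add _ _ _ _ _ (mul_nonneg (Nat.cast_nonneg _) (hε0 κ)) fun crs hcrs hgood => ?_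
  refine run_logGame_key_sub_le A (A.bound.eval κ) ((qa.comp A.bound).eval κ) (A.bound.eval κ)
    (L.eval κ) (hε0 κ) (hqb κ) (fun log m P j ψ hP hPs hlog hm hj => ?_) _ _ _ _ le_rfl ?_
  · rw [keyGen_bind, fakeSK_bind]
    -- The functional keys inside the two circuits are sampled independently of each other. Every
    -- pair of outcomes gives equivalent circuits of equal size, so no coupling is needed.
    refine prT_bind_sub_le' _ _ _ _ _ fun sk hsk sk' hsk' => ?_
    rw [mem_support_sampleVec] at hsk hsk'
    obtain ⟨h1, h2, h3, h4, h5⟩ := hp κ k hk z crs hcrs P hPs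
    have hk' := mem_support_ncKeys.1 hk
    refine hobf κ
      { C₀ := D.leftOrRight κ P (ncPk k crs) (.vec sk) (List.ofFn z)
        C₁ := D.left κ P (ncPk k crs) (.vec sk')
        wf₀ := (hD.leftOrRight_spec _ _ _ _ _).1
        wf₁ := (hD.left_spec _ _ _ _).1
        size_eq := hD.size_eq κ P hP (ncPk k crs, ncMsk k crs z)
          (mem_support_ncSetup.2 ⟨k, z, crs, hk', hcrs, rfl⟩) _ _ _
          ⟨sk, rfl, fun i => ⟨k i (z i), hk' _ _, hsk i⟩⟩
          ⟨sk', rfl, fun i => ⟨k i false, hk' _ _, hsk' i⟩⟩ (by simp)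
        equivalent := circuits_equivalent hcorrect hD hk (fun x π hv => by
          by_contra hw
          exact hgood ⟨x, π, hw, hv⟩) hP hsk hsk'
        env := .cons (ncPk k crs) (.cons (ncAux k crs .nil z) (ncMsk k crs z))
        log := log
        mem := m
        steps := j
        reg := ψ
        size₀ := by have := h4 sk hsk; rw [hb]; omega
        size₁ := by have := h5 sk' hsk'; rw [hb]; omega
        size_env := by simp only [Data.size]; rw [hb]; omega
        size_log := by rw [hb]; omega
        size_mem := by rw [hb]; omega
        steps_le := hj }
  · simp only [L, Polynomial.eval_add, Polynomial.eval_mul, Polynomial.eval_one, Data.ofList,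
      Data.size]
    omega

end

/-! ### Simulation of the proofs -/

theorem prT_bind_bind_sub_le {α β : Type} (p : PMF α) (q : PMF β) (f g : α → β → PMF Bool) :
    ∃ a ∈ p.support, ∃ b ∈ q.support,
      |prT (p.bind fun a => q.bind (f a)) - prT (p.bind fun a => q.bind (g a))| ≤
        (4 : ℕ) * |prT (f a b) - prT (g a b)| := by
  obtain ⟨a, ha, h1⟩ := exists_prT_bind_sub_le p (fun a => q.bind (f a)) fun a => q.bind (g a)
  obtain ⟨b, hb, h2⟩ := exists_prT_bind_sub_le q (f a) (g a)
  refine ⟨a, ha, b, hb, h1.trans ?_⟩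
  push_cast
  linarith

theorem NIZK.polyBounded_proofChallenger {R : ℕ → Data → Data → Prop} {σ : Type}
    {start : ℕ → PMF (Data × σ)} {proof : ℕ → Data → σ → Data → Data → PMF Data}
    (p : Polynomial ℕ) (h₁ : ∀ κ, ∀ x ∈ (start κ).support, x.1.size ≤ p.eval κ)
    (h₂ : ∀ κ, ∀ x ∈ (start κ).support, ∀ q : Data, ∀ π ∈ (proof κ x.1 x.2 q.hd q.tl).support,
      π.size ≤ p.eval (κ + q.size)) :
    PolyBounded fun κ => proofChallenger (R κ) σ (start κ) (proof κ) := by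
  refine ⟨p + 2, fun κ (s : (Data × σ) × Bool) => s.1 ∈ (start κ).support,
    fun κ => ⟨fun x hx => ?_, fun s hs q x hx => ?_⟩⟩
  · obtain ⟨y, hy, rfl⟩ := (PMF.mem_support_map_iff _ _ _).1 hx
    refine ⟨hy, (h₁ κ y hy).trans ?_⟩
    rw [Polynomial.eval_add]
    omega
  · obtain ⟨s, used⟩ := s
    change s ∈ (start κ).support at hs
    simp only [proofChallenger] at hx
    rw [Polynomial.eval_add, Polynomial.eval_ofNat]
    split_ifs at hx
    · obtain ⟨π, hπ, rfl⟩ := (PMF.mem_support_map_iff _ _ _).1 hx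
      have := h₂ κ s hs q π hπ
      refine ⟨hs, ?_⟩
      simp only [Data.ofOption, Data.size]
      omega
    · obtain rfl := (PMF.mem_support_pure_iff _ _).1 hx
      refine ⟨hs, ?_⟩
      simp only [Data.ofOption, Data.size]
      omega

section
variable {Q : PolicyClass} {len : ℕ → ℕ} {S : ABE} {O : Obfuscator} {N : NIZK}
  {Z : NIZKSimulator} {D : DecCircuits}

theorem NIZK.Efficient.polyBounded (hN : N.Efficient) (R : ℕ → Data → Data → Prop) :
    PolyBounded fun κ => proofChallenger (R κ) Unit ((N.setup κ).map fun crs => (crs, ()))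
      fun crs _ x w => N.prove κ crs x w := by
  obtain ⟨ps, hs⟩ := hN.setup.size_bound
  obtain ⟨pp, hp⟩ := hN.prove.size_bound
  let s : Polynomial ℕ := ps.comp (2 * .X + 1)
  have hs' : ∀ κ, ∀ x ∈ ((N.setup κ).map fun crs => (crs, ())).support, x.1.size ≤ s.eval κ := by
    intro κ x hx
    obtain ⟨crs, hcrs, rfl⟩ := (PMF.mem_support_map_iff _ _ _).1 hx
    have := hs κ crs hcrs
    simp only [esize_data, esize_nat] at this
    simpa [s, Polynomial.eval_comp] using this
  clear_value s
  refine polyBounded_proofChallenger (s + pp.comp (4 * .X + s + 4)) (fun κ x hx => ?_)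
    fun κ x hx q π hπ => ?_
  · rw [Polynomial.eval_add]
    exact (hs' κ x hx).trans (Nat.le_add_right _ _)
  · have h1 := hs' κ x hx
    have h2 := hp (κ, x.1, q.hd, q.tl) π hπ
    have h3 := q.size_hd_le
    have h4 := q.size_tl_le
    have h5 := s.eval_mono_nat (Nat.le_add_right κ q.size)
    rw [Polynomial.eval_add, Polynomial.eval_comp]
    refine h2.trans ((pp.eval_mono_nat ?_).trans (Nat.le_add_left _ _))
    simp only [esize_prod, esize_nat, esize_data, Polynomial.eval_add, Polynomial.eval_mul,
      Polynomial.eval_X, Polynomial.eval_ofNat]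
    omega

theorem NIZKSimulator.Efficient.polyBounded (hZ : Z.Efficient) (R : ℕ → Data → Data → Prop) :
    PolyBounded fun κ => NIZK.proofChallenger (R κ) Data (Z.sim₁ κ)
      fun crs td x _ => Z.sim₂ κ crs td x := by
  obtain ⟨ps, hs⟩ := hZ.sim₁.size_bound
  obtain ⟨pp, hp⟩ := hZ.sim₂.size_bound
  let s : Polynomial ℕ := ps.comp (2 * .X + 1)
  have hs' : ∀ κ, ∀ x ∈ (Z.sim₁ κ).support, x.1.size + x.2.size ≤ s.eval κ := by
    intro κ x hx
    have := hs κ x hx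
    simp only [esize_prod, esize_data, esize_nat] at this
    simp only [s, Polynomial.eval_comp, Polynomial.eval_add, Polynomial.eval_mul,
      Polynomial.eval_X, Polynomial.eval_ofNat, Polynomial.eval_one]
    omega
  clear_value s
  refine NIZK.polyBounded_proofChallenger (s + pp.comp (4 * .X + s + 4)) (fun κ x hx => ?_)
    fun κ x hx q π hπ => ?_
  · rw [Polynomial.eval_add]
    have := hs' κ x hx
    omega
  · have h1 := hs' κ x hx
    have h2 := hp (κ, x.1, x.2, q.hd) π hπ
    have h3 := q.size_hd_le
    have h5 := s.eval_mono_nat (Nat.le_add_right κ q.size)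
    rw [Polynomial.eval_add, Polynomial.eval_comp]
    refine h2.trans ((pp.eval_mono_nat ?_).trans (Nat.le_add_left _ _))
    simp only [esize_prod, esize_nat, esize_data, Polynomial.eval_add, Polynomial.eval_mul,
      Polynomial.eval_X, Polynomial.eval_ofNat]
    omega

/-- The randomness of a double encryption. -/
noncomputable def ncCoins (S : ABE) (len : ℕ → ℕ) (κ : ℕ) :
    PMF (Fin (len κ) → Bool → List Bool) :=
  sampleVec (len κ) fun _ => samplePair fun _ => uniformBits (S.coins κ)

def ncCts (S : ABE) (len : ℕ → ℕ) (κ : ℕ) (pks X : Data) (m : List Bool)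
    (r : Fin (len κ) → Bool → List Bool) (i : Fin (len κ)) (b : Bool) : Data :=
  S.encWith κ ((pks.nth i).sel b) X (m.getD i false) (r i b)

def ncStatement (S : ABE) (len : ℕ → ℕ) (κ : ℕ) (pks X : Data) (m : List Bool)
    (r : Fin (len κ) → Bool → List Bool) : Data :=
  doubleStatement pks (.vec fun i => .pair (ncCts S len κ pks X m r i)) X

def ncWitness (len : ℕ → ℕ) (κ : ℕ) (m : List Bool) (r : Fin (len κ) → Bool → List Bool) : Data :=
  doubleWitness (fun i : Fin (len κ) => m.getD i false) r

/-- An honest double encryption with a proof by the given algorithm, together with the master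
secret key. -/
noncomputable def chalWith (S : ABE) (len : ℕ → ℕ) (κ : ℕ) (proof : Data → Data → PMF Data)
    (pks msk X : Data) (m : List Bool) : PMF Data :=
  (ncCoins S len κ).bind fun r =>
    (proof (ncStatement S len κ pks X m r) (ncWitness len κ m r)).map fun π =>
      .cons (ncCiphertext (ncCts S len κ pks X m r) X π) msk

theorem chalReal_eq (κ : ℕ) (pk msk X m : Data) : chalReal S N len κ pk msk X m =
    chalWith S len κ (N.prove κ pk.tl) pk.hd msk X m.toBits := by
  refine (PMF.map_bind _ _ _).trans ?_
  refine congrArg _ (funext fun r => ?_)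
  exact (PMF.map_bind _ _ _).trans (congrArg _ (funext fun π => PMF.pure_map _ _))

theorem doubleRelation_ncStatement {κ : ℕ} {X : Data} {m : List Bool}
    {r : Fin (len κ) → Bool → List Bool} (hr : r ∈ (ncCoins S len κ).support)
    (k : Fin (len κ) → Bool → Data × Data) (hX : Q.attr κ X = true) :
    doubleRelation S Q len κ (ncStatement S len κ (ncPks k) X m r) (ncWitness len κ m r) := by
  refine ⟨fun i b => (k i b).1, ncCts S len κ (ncPks k) X m r, X, fun i => m.getD i false, r,
    rfl, rfl, hX, fun i b => ⟨?_, ?_⟩⟩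
  · exact length_of_mem_uniformBits (mem_support_samplePair.1 (mem_support_sampleVec.1 hr i) b)
  · simp only [ncCts, ncPks, Data.nth_vec, Data.sel_pair]

/-- The message of the reduction to zero-knowledge for a challenge query, and the ciphertexts. -/
noncomputable def zkPre (S : ABE) (len : ℕ → ℕ) (κ : ℕ) (pks q : Data) : PMF (Data × Data) :=
  if q.hd.toBool then
    (ncCoins S len κ).map fun r =>
      (.cons (ncStatement S len κ pks q.tl.hd q.tl.tl.toBits r) (ncWitness len κ q.tl.tl.toBits r),
      .vec fun i => .pair (ncCts S len κ pks q.tl.hd q.tl.tl.toBits r i))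
  else PMF.pure (.nil, .nil)

theorem PPTF.zkPre (hlen : PF fun κ : ℕ => len κ) (hS : S.Efficient) :
    PPTF fun x : Data × Data => zkPre S len x.1.hd.hd.toNat x.1.hd.tl.tl.hd x.2 := by
  let κ : (Data × Data) × List (List Bool × List Bool) → ℕ := fun x => x.1.1.hd.hd.toNat
  let ct : (Data × Data) × List (List Bool × List Bool) → Data := fun x =>
    .vec fun i : Fin (len (κ x)) => .pair fun b =>
    S.encWith (κ x) ((x.1.1.hd.tl.tl.hd.nth i).sel b) x.1.2.tl.hd
      (x.1.2.tl.tl.toBits.getD i false) (pairGet [] x.2 i b)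
  let wit : (Data × Data) × List (List Bool × List Bool) → Data := fun x =>
    .cons (.vec fun i : Fin (len (κ x)) => Data.ofBool (x.1.2.tl.tl.toBits.getD i false))
      (.vec fun i : Fin (len (κ x)) => .pair fun b => .ofBits (pairGet [] x.2 i b))
  have hn : PF fun x : (Data × Data) × List (List Bool × List Bool) => len (κ x) :=
    hlen.comp (g := fun x : (Data × Data) × List (List Bool × List Bool) =>
      x.1.1.hd.hd.toNat) (by fun_prop)
  have hct : PF fun x : (Data × Data) × List (List Bool × List Bool) => ct x := by
    refine PF.data_vec_pair (α := (Data × Data) × List (List Bool × List Bool))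
      (n := fun x => len (κ x)) (g := fun x i b =>
        S.encWith (κ x) ((x.1.1.hd.tl.tl.hd.nth i).sel b) x.1.2.tl.hd
          (x.1.2.tl.tl.toBits.getD i false) (pairGet [] x.2 i b)) hn ?_
    exact PF.encWith_comp hS (by fun_prop) (by fun_prop) (by fun_prop) (by fun_prop) (by fun_prop)
  have hwit : PF fun x : (Data × Data) × List (List Bool × List Bool) => wit x := by
    refine PF.data_cons (PF.data_vec (α := (Data × Data) × List (List Bool × List Bool))
      (n := fun x => len (κ x))
      (g := fun x i => Data.ofBool (x.1.2.tl.tl.toBits.getD i false)) hn (by fun_prop)) ?_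
    exact PF.data_vec_pair (α := (Data × Data) × List (List Bool × List Bool))
      (n := fun x => len (κ x)) (g := fun x i b => Data.ofBits (pairGet [] x.2 i b)) hn
      (by fun_prop)
  have h1 := (PPTF.encCoins hlen hS).comp (g := fun x : Data × Data => x.1.hd.hd.toNat)
    (by fun_prop)
  have h2 := PPTF.map (α := Data × Data) (h := fun x l =>
    (Data.cons (Data.cons x.1.hd.tl.tl.hd (.cons (ct (x, l)) x.2.tl.hd)) (wit (x, l)), ct (x, l)))
    h1 (by fun_prop)
  refine (PPTF.cases (c := fun x : Data × Data => x.2.hd.toBool) (by fun_prop) h2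
    (PPTF.pure (PF.const ((.nil, .nil) : Data × Data)))).congr fun x => ?_
  rw [_root_.zkPre]
  congr 1
  rw [PMF.map_comp]
  refine congrArg (fun f => PMF.map f _) (funext fun r => ?_)
  simp only [Function.comp_apply, ct, wit, κ, pairGet_pairList, ← ofBits_ofFn_getD]
  rfl

/-- The answer of the reduction to zero-knowledge. -/
noncomputable def zkPost (S : ABE) (N : NIZK) (Z : NIZKSimulator) (O : Obfuscator)
    (D : DecCircuits) (len : ℕ → ℕ) (c q t a : Data) : PMF Data :=
  if q.hd.toBool then
    PMF.pure (.cons (.cons t (.cons q.tl.hd a.tl))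
      (.cons (.cons c.hd.tl.tl.hd c.tl) c.hd.tl.tl.tl.tl))
  else (ncabe S N Z O D len).fakeSK c.hd.hd.toNat (.cons c.hd.tl.tl.hd c.tl)
    (.cons .nil (.cons .nil (.cons c.hd.tl.tl.tl.hd .nil))) q.tl

theorem PPTF.zkPost (hlen : PF fun κ : ℕ => len κ) (hS : S.Efficient) (hO : O.Efficient)
    (hD : D.Implement S N Q len) :
    PPTF fun x : Data × Data × Data × Data =>
      zkPost S N Z O D len x.1 x.2.1 x.2.2.1 x.2.2.2 := by
  unfold _root_.zkPost
  exact PPTF.cases (c := fun x : Data × Data × Data × Data => x.2.1.hd.toBool)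
    (F := fun x => PMF.pure (Data.cons (.cons x.2.2.1 (.cons x.2.1.tl.hd x.2.2.2.tl))
      (.cons (.cons x.1.hd.tl.tl.hd x.1.tl) x.1.hd.tl.tl.tl.tl)))
    (G := fun x => (ncabe S N Z O D len).fakeSK x.1.hd.hd.toNat (.cons x.1.hd.tl.tl.hd x.1.tl)
      (.cons .nil (.cons .nil (.cons x.1.hd.tl.tl.tl.hd .nil))) x.2.1.tl)
    (by fun_prop) (PPTF.pure (by fun_prop))
    ((PPTF.fakeSK hlen hS hO hD).comp (g := fun x : Data × Data × Data × Data =>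
      (x.1.hd.hd.toNat, Data.cons x.1.hd.tl.tl.hd x.1.tl,
        Data.cons .nil (.cons .nil (.cons x.1.hd.tl.tl.tl.hd .nil)), x.2.1.tl)) (by fun_prop))

/-- The fixed data of the reduction to zero-knowledge. -/
def zkData (A : Adversary) (κ : ℕ) {n : ℕ} (k : Fin n → Bool → Data × Data) (z : Fin n → Bool) :
    Data :=
  .cons (A.advice κ) (.cons (ncPks k) (.cons (ncMsks k) (.cons (ncSel k z) (ncBits z))))

/-- With the key pairs and `z` fixed, the reduction reproduces the experiment perfectly for any
generation of reference string and proof; the real and the simulated case are two instances. The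
invariant says that the single proof is still available as long as no challenge has been answered.
-/
theorem zk_compRun (A : Adversary) {κ : ℕ} (k : Fin (len κ) → Bool → Data × Data)
    (z : Fin (len κ) → Bool) {σ : Type} (start : PMF (Data × σ))
    (proof : Data → σ → Data → Data → PMF Data) :
    compRun Q κ (validMsg len κ) A
      (fun c q => zkPre S len c.hd.hd.toNat c.hd.tl.tl.hd q) (zkPost S N Z O D len)
      (fun c => .cons c.hd.hd (.cons c.hd.tl.hd (.cons c.hd.tl.tl.hd c.tl)))
      (NIZK.proofChallenger (doubleRelation S Q len κ) σ start proof)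
      (.cons (.ofNat κ) (zkData A κ k z)) (A.bound.eval κ) [] (A.qadvice κ) =
    start.bind fun t => play Q κ (validMsg len κ) A
      ((ncabe S N Z O D len).fakeSK κ (ncPk k t.1) (ncAux k t.1 .nil z))
      (fun X m => chalWith S len κ (proof t.1 t.2) (ncPks k) (ncMsk k t.1 z) X m.toBits)
      (ncPk k t.1) := by
  refine compRun_eq A (B := NIZK.proofChallenger (doubleRelation S Q len κ) σ start proof)
    (fun c => .cons c.hd.hd (.cons c.hd.tl.hd (.cons c.hd.tl.tl.hd c.tl)))
    _ _ _ _ start (fun t => ((t, false), t.1)) rfl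
    (fun t => (ncabe S N Z O D len).fakeSK κ (ncPk k t.1) (ncAux k t.1 .nil z))
    (fun t X m => chalWith S len κ (proof t.1 t.2) (ncPks k) (ncMsk k t.1 z) X m.toBits)
    (fun t log (s : (Data × σ) × Bool) => s.1 = t ∧ (target log = none → s.2 = false))
    (fun t => ⟨rfl, fun _ => rfl⟩) fun t log s hs q hq => ?_
  obtain ⟨s, used⟩ := s
  obtain ⟨rfl, hused⟩ := hs
  simp only at hused
  cases hc : q.hd.toBool
  · have hpre : ∀ κ pks, zkPre S len κ pks q = PMF.pure (.nil, .nil) := fun κ pks => by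
      simp [zkPre, hc]
    -- For a key query the message sent is `nil`. It is not a statement with a witness, so it is
    -- refused and does not use up the single proof.
    have hrep : (NIZK.proofChallenger (doubleRelation S Q len κ) σ start proof).reply (s, used)
        .nil = PMF.pure ((s, used), .nil) := by
      refine if_neg ?_
      rintro ⟨-, pk, ct, X, m, r, hx, -⟩
      simp [doubleStatement, Data.hd] at hx
    simp only [hpre, PMF.pure_bind]
    refine ⟨?_, fun y hy r hr => ?_⟩
    · rw [hrep]
      refine (PMF.pure_bind _ _).trans ?_
      simp only [zkPost, answer, hc, Bool.false_eq_true, if_false]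
      simp only [Data.hd_cons, Data.tl_cons, Data.toNat_ofNat]
      rfl
    · obtain rfl := (PMF.mem_support_pure_iff _ _).1 hy
      rw [hrep] at hr
      obtain rfl := (PMF.mem_support_pure_iff _ _).1 hr
      refine ⟨rfl, fun ht => hused ?_⟩
      rwa [target, if_neg (by simp [hc])] at ht
  · rw [legalLog_of_challenge Q κ _ hc] at hq
    simp only [Bool.and_eq_true, Option.isNone_iff_eq_none] at hq
    obtain ⟨⟨⟨ht, hX⟩, -⟩, -⟩ := hq
    obtain rfl := hused ht
    have hpre : zkPre S len (Data.cons (.cons (.ofNat κ) (zkData A κ k z)) s.1).hd.hd.toNat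
        (Data.cons (.cons (.ofNat κ) (zkData A κ k z)) s.1).hd.tl.tl.hd q =
        (ncCoins S len κ).map fun r =>
          (.cons (ncStatement S len κ (ncPks k) q.tl.hd q.tl.tl.toBits r)
            (ncWitness len κ q.tl.tl.toBits r),
          .vec fun i => .pair (ncCts S len κ (ncPks k) q.tl.hd q.tl.tl.toBits r i)) := by
      simp only [Data.hd_cons, Data.toNat_ofNat]
      rw [zkPre, if_pos hc]
      rfl
    have hrep : ∀ r ∈ (ncCoins S len κ).support,
        (NIZK.proofChallenger (doubleRelation S Q len κ) σ start proof).reply (s, false)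
          (.cons (ncStatement S len κ (ncPks k) q.tl.hd q.tl.tl.toBits r)
            (ncWitness len κ q.tl.tl.toBits r)) =
        (proof s.1 s.2 (ncStatement S len κ (ncPks k) q.tl.hd q.tl.tl.toBits r)
          (ncWitness len κ q.tl.tl.toBits r)).map fun π => ((s, true), .cons .nil π) :=
      fun r hr => if_pos ⟨rfl, doubleRelation_ncStatement hr k hX⟩
    refine ⟨?_, fun y hy r hr => ⟨?_, fun h => by simp [target, hc] at h⟩⟩
    · simp only [hpre, PMF.bind_map, answer, hc, if_true]
      refine PMF.bind_congr_support fun r hr => ?_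
      simp only [Function.comp_apply]
      rw [hrep r hr]
      refine (PMF.bind_map _ _ _).trans ?_
      simp only [zkPost, hc, if_true]
      rfl
    · rw [hpre] at hy
      obtain ⟨r', hr', rfl⟩ := (PMF.mem_support_map_iff _ _ _).1 hy
      rw [hrep r' hr'] at hr
      obtain ⟨π, -, rfl⟩ := (PMF.mem_support_map_iff _ _ _).1 hr
      rfl

/-- The experiment with left keys and real proofs does not change noticeably if the proofs are
simulated. -/
theorem proofs_indist (hQ : Q.Efficient) (hlen : PF fun κ : ℕ => len κ) (hS : S.Efficient)
    (hO : O.Efficient) (hN : N.Efficient) (hZ : Z.Efficient)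
    (hzk : N.ZeroKnowledge Z (doubleRelation S Q len)) (hD : D.Implement S N Q len)
    (A : Adversary) :
    Negligible fun κ =>
      |prT (setupRun S N len κ fun k z crs => play Q κ (validMsg len κ) A
          ((ncabe S N Z O D len).fakeSK κ (ncPk k crs) (ncAux k crs .nil z))
          (chalReal S N len κ (ncPk k crs) (ncMsk k crs z)) (ncPk k crs)) -
        prT ((ncKeys S len κ).bind fun k => (PMF.uniformOfFintype (Fin (len κ) → Bool)).bind
          fun z => (Z.sim₁ κ).bind fun t => play Q κ (validMsg len κ) A
            ((ncabe S N Z O D len).fakeSK κ (ncPk k t.1) (ncAux k t.1 .nil z))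
            (fun X m => chalWith S len κ (fun x _ => Z.sim₂ κ t.1 t.2 x) (ncPks k)
              (ncMsk k t.1 z) X m.toBits) (ncPk k t.1))| := by
  -- Key pairs and `z` are fixed by averaging twice, which costs the factor 4. They do not depend on
  -- the reference string, so they can be put into the advice.
  choose k hk z _ hkz using fun κ => prT_bind_bind_sub_le (ncKeys S len κ)
    (PMF.uniformOfFintype (Fin (len κ) → Bool))
    (fun k z => (N.setup κ).bind fun crs => play Q κ (validMsg len κ) A
          ((ncabe S N Z O D len).fakeSK κ (ncPk k crs) (ncAux k crs .nil z))
          (chalReal S N len κ (ncPk k crs) (ncMsk k crs z)) (ncPk k crs))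
    (fun k z => (Z.sim₁ κ).bind fun t => play Q κ (validMsg len κ) A
            ((ncabe S N Z O D len).fakeSK κ (ncPk k t.1) (ncAux k t.1 .nil z))
            (fun X m => chalWith S len κ (fun x _ => Z.sim₂ κ t.1 t.2 x) (ncPks k)
              (ncMsk k t.1 z) X m.toBits) (ncPk k t.1))
  obtain ⟨p, hp⟩ := exists_ncKeys_bound hlen hS
  have h := compGame_indist hQ (PF.validMsg hlen) A
    (pre := fun c q => zkPre S len c.hd.hd.toNat c.hd.tl.tl.hd q) (PPTF.zkPre hlen hS)
    (PPTF.zkPost (N := N) (Z := Z) hlen hS hO hD)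
    (first := fun c => .cons c.hd.hd (.cons c.hd.tl.hd (.cons c.hd.tl.tl.hd c.tl))) (by fun_prop)
    hzk (hN.polyBounded _) (hZ.polyBounded _) (fun κ => zkData A κ (k κ) (z κ)) (fun _ => [])
    (A.bound + 4 * p + 4) 1 (fun κ => ?_) (fun κ => by simp [Data.ofList, Data.size])
    (fun κ => A.bound.eval κ) (fun κ => le_rfl) A.qadvice
  · refine (h.const_mul 4 fun _ => abs_nonneg _).mono fun κ => (hkz κ).trans (le_of_eq ?_)
    rw [zk_compRun, zk_compRun, PMF.bind_map]
    have hr : ∀ pk msk, chalReal S N len κ pk msk = fun X m =>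
        chalWith S len κ (N.prove κ pk.tl) pk.hd msk X m.toBits := fun pk msk =>
      funext fun X => funext fun m => chalReal_eq κ pk msk X m
    simp only [hr]
    rfl
  · obtain ⟨h1, h2, h3, h4, h5⟩ := (hp κ).2 (k κ) (hk κ) (z κ)
    have h6 := A.advice_le κ
    simp only [zkData, Data.size, Polynomial.eval_add, Polynomial.eval_mul, Polynomial.eval_ofNat]
    omega

end

/-! ### Resampling of one component -/

/-- By independence, the component `j` may be drawn separately and written over an unrelated sample;
`p' j` is arbitrary and its value is discarded. Keys and ciphertexts of an external challenger are
inserted in this way. -/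
theorem sampleVec_overwrite {α : Type} : ∀ {n : ℕ} (j : Fin n) (p p' : Fin n → PMF α)
    (_ : ∀ i, i ≠ j → p i = p' i),
    sampleVec n p = (p j).bind fun a => (sampleVec n p').map fun v => Function.update v j a
  | 0, j, _, _, _ => j.elim0
  | n + 1, j, p, p', h => by
    refine Fin.cases (fun h => ?_) (fun j h => ?_) j h
    · have h1 : (fun i : Fin n => p i.succ) = fun i => p' i.succ :=
        funext fun i => h _ (Fin.succ_ne_zero i)
      simp only [sampleVec, h1, PMF.map_bind, PMF.map_comp]
      congr 1
      funext a
      have : ∀ b, ((fun v : Fin (n + 1) → α => Function.update v 0 a) ∘ fun v : Fin n → α =>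
          (Fin.cons b v : Fin (n + 1) → α)) = fun v : Fin n → α => (Fin.cons a v : Fin (n + 1) → α) :=
        fun b => funext fun v => by
        simp
      simp only [this, PMF.bind_const]
    · have ih := sampleVec_overwrite j (fun i => p i.succ) (fun i => p' i.succ)
        fun i hi => h _ fun e => hi (Fin.succ_injective _ e)
      simp only [sampleVec, PMF.map_bind, PMF.map_comp]
      rw [ih, PMF.bind_comm, h 0 (Fin.succ_ne_zero j).symm]
      congr 1
      funext b
      simp only [PMF.map_bind, PMF.map_comp]
      congr 1
      funext a
      congr 1
      funext v
      simp only [Function.comp_apply, Fin.cons_update]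

theorem samplePair_overwrite {α : Type} (c : Bool) (p p' : Bool → PMF α)
    (h : ∀ b, b ≠ c → p b = p' b) :
    samplePair p = (p c).bind fun a => (samplePair p').map fun f => Function.update f c a := by
  cases c
  · simp only [samplePair, PMF.map_bind, PMF.map_comp, h true (by simp)]
    congr 1
    funext a
    have : ∀ b, ((fun f : Bool → α => Function.update f false a) ∘ fun a' (x : Bool) =>
        if x then a' else b) = fun a' x => if x then a' else a := fun b => by
      funext a' x
      cases x <;> simp
    simp only [this, PMF.bind_const]
  · simp only [samplePair, PMF.map_bind, PMF.map_comp, h false (by simp)]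
    rw [PMF.bind_comm]
    congr 1
    funext a
    have : ∀ b, ((fun f : Bool → α => Function.update f true b) ∘ fun a' (x : Bool) =>
        if x then a' else a) = fun _ x => if x then b else a := fun b => by
      funext a' x
      cases x <;> simp
    simp only [this]
    rw [← PMF.bind_pure_comp]
    congr 1
    funext b
    exact (PMF.map_const _ _).symm

/-- The family `v` with the entry `(j, c)` replaced by `a`. -/
def updatePair {α : Type} {n : ℕ} (j : Fin n) (c : Bool) (a : α) (v : Fin n → Bool → α) :
    Fin n → Bool → α := fun i b => if i = j ∧ b = c then a else v i b

theorem sampleVec_samplePair_overwrite {α : Type} {n : ℕ} (j : Fin n) (c : Bool)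
    (p p' : Fin n → Bool → PMF α) (h : ∀ i b, ¬ (i = j ∧ b = c) → p i b = p' i b) :
    (sampleVec n fun i => samplePair (p i)) = (p j c).bind fun a =>
      (sampleVec n fun i => samplePair (p' i)).map (updatePair j c a) := by
  rw [sampleVec_overwrite j (fun i => samplePair (p i)) (fun i => samplePair (p' i))
    fun i hi => congrArg _ (funext fun b => h i b fun e => hi e.1),
    samplePair_overwrite c (p j) (p' j) fun b hb => h j b fun e => hb e.2, PMF.bind_bind]
  congr 1
  funext a
  rw [PMF.bind_map]
  conv_rhs => rw [sampleVec_overwrite j (fun i => samplePair (p' i)) (fun i => samplePair (p' i))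
    fun i _ => rfl, PMF.map_bind]
  congr 1
  funext f
  simp only [Function.comp_apply, PMF.map_comp]
  congr 1
  funext v
  funext i b
  by_cases hi : i = j
  · subst hi
    by_cases hb : b = c
    · subst hb; simp [updatePair]
    · simp [updatePair, hb]
  · simp [updatePair, hi]

theorem samplePair_map {τ υ : Type} (p : Bool → PMF τ) (g : Bool → τ → υ) :
    (samplePair fun b => (p b).map (g b)) = (samplePair p).map fun f b => g b (f b) := by
  simp only [samplePair, PMF.bind_map, PMF.map_bind, PMF.map_comp]
  congr 1
  funext a
  refine congrArg (fun f => PMF.map f _) (funext fun a' => funext fun b => ?_)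
  cases b <;> simp

theorem uniform_xor {n : ℕ} (m : Fin n → Bool) :
    (PMF.uniformOfFintype (Fin n → Bool)).map (fun z i => z i ^^ m i) =
      PMF.uniformOfFintype (Fin n → Bool) := by
  ext f
  rw [PMF.map_apply, tsum_eq_single fun i => f i ^^ m i]
  · simp
  · intro z hz
    rw [if_neg]
    rintro rfl
    exact hz (funext fun i => by simp)

/-- A telescoping sum is at most the number of its terms times one of them. -/
theorem exists_abs_sub_le_mul (G : ℕ → ℝ) (n : ℕ) (hn : 0 < n) :
    ∃ j < n, |G 0 - G n| ≤ n * |G j - G (j + 1)| := by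
  by_contra! H
  have h1 : (0 : ℝ) < n := by exact_mod_cast hn
  have h2 : ∑ j ∈ Finset.range n, |G j - G (j + 1)| < |G 0 - G n| := by
    have h3 : ∀ j ∈ Finset.range n, |G j - G (j + 1)| < |G 0 - G n| / n := fun j hj => by
      rw [lt_div_iff₀ h1, mul_comm]
      exact H j (Finset.mem_range.1 hj)
    refine (Finset.sum_lt_sum_of_nonempty (Finset.nonempty_range_iff.2 hn.ne') h3).trans_eq ?_
    rw [Finset.sum_const, Finset.card_range, nsmul_eq_mul]
    field_simp
  have h4 : G 0 - G n = ∑ j ∈ Finset.range n, (G j - G (j + 1)) := by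
    rw [Finset.sum_range_sub']
  have h5 := Finset.abs_sum_le_sum_abs (fun j => G j - G (j + 1)) (Finset.range n)
  rw [← h4] at h5
  linarith

/-! ### Exchange of one encrypted bit -/

/-- The table `d` of `n` pairs with the component `(j, c)` replaced by `x`. -/
def overwrite (n j : ℕ) (c : Bool) (x d : Data) : Data :=
  .vec fun i : Fin n => .pair fun b => if (i : ℕ) == j && !(b != c) then x else (d.nth i).sel b

theorem overwrite_vec_pair {n : ℕ} (j : Fin n) (c : Bool) (x : Data) (f : Fin n → Bool → Data) :
    overwrite n j c x (.vec fun i => .pair (f i)) = .vec fun i => .pair (updatePair j c x f i) := by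
  refine congrArg _ (funext fun i => congrArg _ (funext fun b => ?_))
  simp [updatePair, Fin.ext_iff]

theorem apply_updatePair {α β : Type} {n : ℕ} (g : α → β) (j : Fin n) (c : Bool) (a : α)
    (v : Fin n → Bool → α) (i : Fin n) (b : Bool) :
    g (updatePair j c a v i b) = updatePair j c (g a) (fun i b => g (v i b)) i b :=
  apply_ite g _ _ _

theorem ncPks_updatePair {n : ℕ} (j : Fin n) (c : Bool) (a : Data × Data)
    (k : Fin n → Bool → Data × Data) :
    ncPks (updatePair j c a k) = overwrite n j c a.1 (ncPks k) := by
  rw [ncPks, ncPks, overwrite_vec_pair]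
  refine congrArg _ (funext fun i => congrArg _ (funext fun b => ?_))
  exact apply_updatePair Prod.fst j c a k i b

/-- The pair that is replaced has index `1 - z j`, so its master secret key is not among the
revealed ones. The reduction can thus answer with the master secret key although it does not know
the secret key of its challenger. -/
theorem ncSel_updatePair {n : ℕ} (j : Fin n) (a : Data × Data) (k : Fin n → Bool → Data × Data)
    (z : Fin n → Bool) : ncSel (updatePair j (!z j) a k) z = ncSel k z := by
  refine congrArg _ (funext fun i => congrArg Prod.snd (if_neg ?_))
  rintro ⟨rfl, h⟩
  simp at h

/-- The encrypted bits of the hybrid in which the first `j` ciphertexts that cannot be decrypted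
with the revealed keys have been exchanged. -/
def hybBits (j : ℕ) (z m : List Bool) (i : ℕ) (b : Bool) : Bool :=
  m.getD i false ^^ (Nat.ble (i + 1) j && (b != z.getD i false))

section
variable {Q : PolicyClass} {len : ℕ → ℕ} {S : ABE} {O : Obfuscator} {N : NIZK}
  {Z : NIZKSimulator} {D : DecCircuits}

/-- A complete family of key pairs is drawn, and its entry `(j, c)` is discarded in favour of the
challenger's key pair. The family itself can then be fixed as advice. -/
theorem ncKeys_bind_overwrite {β : Type} {κ : ℕ} (j : Fin (len κ)) (c : Bool)
    (F : (Fin (len κ) → Bool → Data × Data) → PMF β) :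
    (ncKeys S len κ).bind F =
      (ncKeys S len κ).bind fun k => (S.setup κ).bind fun a => F (updatePair j c a k) := by
  conv_lhs => rw [ncKeys, sampleVec_samplePair_overwrite j c _ _ fun _ _ _ => rfl, PMF.bind_bind]
  simp only [PMF.bind_map]
  exact PMF.bind_comm _ _ _

/-- A double encryption of the bits `e` with a simulated proof, together with the master secret
key. -/
noncomputable def chalBits (S : ABE) (Z : NIZKSimulator) (len : ℕ → ℕ) (κ : ℕ)
    (crs td pks msk X : Data) (e : ℕ → Bool → Bool) : PMF Data :=
  (sampleVec (len κ) fun i => samplePair fun b =>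
    S.enc κ ((pks.nth i).sel b) X (e i b)).bind fun ct =>
      (Z.sim₂ κ crs td (doubleStatement pks (.vec fun i => .pair (ct i)) X)).map fun π =>
        .cons (ncCiphertext ct X π) msk

/-- In hybrid 0 no bit has been exchanged, so both ciphertexts with index `i` encrypt `m i`,
whatever `z` is. -/
theorem chalWith_eq_chalBits (κ : ℕ) (crs td pks msk X : Data) (z m : List Bool) :
    chalWith S len κ (fun x _ => Z.sim₂ κ crs td x) pks msk X m =
      chalBits S Z len κ crs td pks msk X (hybBits 0 z m) := by
  have h : (sampleVec (len κ) fun i => samplePair fun b =>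
      S.enc κ ((pks.nth i).sel b) X (hybBits 0 z m i b)) =
      (ncCoins S len κ).map (ncCts S len κ pks X m) := by
    simp only [ABE.enc, samplePair_map, sampleVec_map]
    refine congrArg (fun f => PMF.map f _) (funext fun r => funext fun i => funext fun b => ?_)
    have : Nat.ble (i + 1) 0 = false := rfl
    simp [ncCts, hybBits, this]
  rw [chalBits, h, PMF.bind_map]
  rfl

/-- The key for the policy `P` that is computed by the reduction to the security of the
encryption scheme, where `a` is the answer of the challenger. -/
noncomputable def abeKey (S : ABE) (O : Obfuscator) (D : DecCircuits) (len : ℕ → ℕ) (κ j : ℕ)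
    (c : Bool) (pk msks a P : Data) : PMF Data :=
  ((sampleVec (len κ) fun i => S.keyGen κ (msks.nth i).hd P).map Data.vec).bind fun d =>
    (O.obf κ (D.left κ P pk
      (.vec fun i : Fin (len κ) => if (i : ℕ) == j && !c then a else d.nth i))).map Circuit.toData

theorem PPTF.abeKey (hlen : PF fun κ : ℕ => len κ) (hS : S.Efficient) (hO : O.Efficient)
    (hD : D.Implement S N Q len) :
    PPTF fun x : ℕ × ℕ × Bool × Data × Data × Data × Data =>
      abeKey S O D len x.1 x.2.1 x.2.2.1 x.2.2.2.1 x.2.2.2.2.1 x.2.2.2.2.2.1 x.2.2.2.2.2.2 := by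
  have h1 := PPTF.sampleKeys (α := ℕ × ℕ × Bool × Data × Data × Data × Data) (κ := fun x => x.1)
    (msk := fun x i => (x.2.2.2.2.1.nth i).hd) (P := fun x => x.2.2.2.2.2.2) hlen hS (by fun_prop)
    (by fun_prop) (by fun_prop)
  have hv : PF fun x : (ℕ × ℕ × Bool × Data × Data × Data × Data) × Data =>
      Data.vec fun i : Fin (len x.1.1) =>
        if (i : ℕ) == x.1.2.1 && !x.1.2.2.1 then x.1.2.2.2.2.2.1 else x.2.nth i :=
    PF.data_vec (α := (ℕ × ℕ × Bool × Data × Data × Data × Data) × Data)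
      (n := fun x => len x.1.1)
      (g := fun x i => if i == x.1.2.1 && !x.1.2.2.1 then x.1.2.2.2.2.2.1 else x.2.nth i)
      (hlen.comp (by fun_prop)) (by fun_prop)
  have h2 := hD.left_PF.comp (g := fun x : (ℕ × ℕ × Bool × Data × Data × Data × Data) × Data =>
    (x.1.1, x.1.2.2.2.2.2.2, x.1.2.2.2.1, Data.vec fun i : Fin (len x.1.1) =>
        if (i : ℕ) == x.1.2.1 && !x.1.2.2.1 then x.1.2.2.2.2.2.1 else x.2.nth i)) (by fun_prop)
  refine (PPTF.bind h1 (G := fun x d => (O.obf x.1 (Circuit.ofData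
    (D.left x.1 x.2.2.2.2.2.2 x.2.2.2.1 (.vec fun i : Fin (len x.1) =>
      if (i : ℕ) == x.2.1 && !x.2.2.1 then x.2.2.2.2.2.1 else d.nth i)).toData)).map
        Circuit.toData) ?_).congr fun x => ?_
  · exact hO.obf.comp (g := fun x : (ℕ × ℕ × Bool × Data × Data × Data × Data) × Data =>
      (x.1.1, (D.left x.1.1 x.1.2.2.2.2.2.2 x.1.2.2.2.1 (.vec fun i : Fin (len x.1.1) =>
        if (i : ℕ) == x.1.2.1 && !x.1.2.2.1 then x.1.2.2.2.2.2.1 else x.2.nth i)).toData))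
      (by fun_prop)
  · simp only [Circuit.ofData_toData]
    rfl

/-- If `z j = 1`, the unrevealed position is the left one, and the `j`-th left key has to come from
the challenger. If `z j = 0`, the unrevealed position is the right one; all left keys are made by
the reduction and the challenger's answer is discarded. -/
theorem keyGen_bind_abeKey {κ : ℕ} (j : Fin (len κ)) (z : Fin (len κ) → Bool)
    (k : Fin (len κ) → Bool → Data × Data) (a : Data × Data) (crs P : Data) :
    ((S.keyGen κ a.2 P).bind fun sk => abeKey S O D len κ j (!z j)
      (ncPk (updatePair j (!z j) a k) crs) (ncMsks k) sk P) =
    (ncabe S N Z O D len).fakeSK κ (ncPk (updatePair j (!z j) a k) crs)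
      (ncAux (updatePair j (!z j) a k) crs .nil z) P := by
  have h : (sampleVec (len κ) fun i => S.keyGen κ (updatePair j (!z j) a k i false).2 P) =
      (S.keyGen κ a.2 P).bind fun sk =>
        (sampleVec (len κ) fun i => S.keyGen κ (k i false).2 P).map fun v (i : Fin (len κ)) =>
          if (i : ℕ) == j && !!z j then sk else v i := by
    cases hz : z j
    · have : ∀ i, updatePair j true a k i false = k i false := fun i => if_neg (by simp)
      simp only [Bool.not_false, Bool.not_true, Bool.and_false, Bool.false_eq_true, if_false,
        PMF.bind_const, this]
      exact (PMF.map_id _).symm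
    · rw [sampleVec_overwrite j _ (fun i => S.keyGen κ (k i false).2 P)]
      · simp only [updatePair, Bool.not_true, and_self, if_true]
        congr 1
        funext sk
        congr 1
        funext v i
        simp [Function.update_apply, Fin.ext_iff]
      · intro i hi
        simp [updatePair, hi]
  have h1 := fakeSK_bind (S := S) (N := N) (Z := Z) (O := O) (D := D) κ
    (updatePair j (!z j) a k) crs .nil P z PMF.pure
  rw [PMF.bind_pure] at h1
  rw [h1, h, PMF.bind_bind]
  congr 1
  funext sk
  simp only [abeKey, ncMsks, Data.nth_vec, PMF.bind_map]
  congr 1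
  funext v
  simp only [Function.comp_apply, Data.nth_vec]
  rfl

/-- The answer to the challenge query in the reduction to the security of the encryption
scheme. -/
noncomputable def abeChal (S : ABE) (Z : NIZKSimulator) (len : ℕ → ℕ) (κ j : ℕ) (z : List Bool)
    (crs td pks msk a X m : Data) : PMF Data :=
  ((sampleVec (len κ) fun i => samplePair fun b => S.enc κ ((pks.nth i).sel b) X
    (hybBits j z m.toBits i b)).map fun ct => Data.vec fun i => .pair (ct i)).bind fun d =>
      (Z.sim₂ κ crs td (doubleStatement pks
        (overwrite (len κ) j (!z.getD j false) a d) X)).map fun π =>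
          .cons (.cons (overwrite (len κ) j (!z.getD j false) a d) (.cons X π)) msk

theorem PF.overwrite {α : Type} [Enc α] {n j : α → ℕ} {c : α → Bool} {x d : α → Data} (hn : PF n)
    (hj : PF j) (hc : PF c) (hx : PF x) (hd : PF d) :
    PF fun a => overwrite (n a) (j a) (c a) (x a) (d a) :=
  PF.data_vec_pair (α := α) (n := n)
    (g := fun a i b => if i == j a && !(b != c a) then x a else ((d a).nth i).sel b) hn
    (by fun_prop)

theorem PPTF.abeChal (hlen : PF fun κ : ℕ => len κ) (hS : S.Efficient) (hZ : Z.Efficient) :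
    PPTF fun x : (ℕ × ℕ × List Bool) × (Data × Data × Data × Data) × Data × Data × Data =>
      abeChal S Z len x.1.1 x.1.2.1 x.1.2.2 x.2.1.1 x.2.1.2.1 x.2.1.2.2.1 x.2.1.2.2.2
        x.2.2.1 x.2.2.2.1 x.2.2.2.2 := by
  have h1 := PPTF.encBits
    (α := (ℕ × ℕ × List Bool) × (Data × Data × Data × Data) × Data × Data × Data)
    (κ := fun x => x.1.1) (pk := fun x i b => (x.2.1.2.2.1.nth i).sel b) (X := fun x => x.2.2.2.1)
    (m := fun x i b => hybBits x.1.2.1 x.1.2.2 x.2.2.2.2.toBits i b) hlen hS (by fun_prop)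
    (by fun_prop) (by fun_prop) (by unfold hybBits; fun_prop)
  have h2 := PF.overwrite
    (α := ((ℕ × ℕ × List Bool) × (Data × Data × Data × Data) × Data × Data × Data) × Data)
    (n := fun x => len x.1.1.1) (j := fun x => x.1.1.2.1)
    (c := fun x => !x.1.1.2.2.getD x.1.1.2.1 false) (x := fun x => x.1.2.2.1) (d := fun x => x.2)
    (hlen.comp (by fun_prop)) (by fun_prop) (by fun_prop) (by fun_prop) (by fun_prop)
  have h3 := h2.comp (g := fun x : (((ℕ × ℕ × List Bool) × (Data × Data × Data × Data) ×
    Data × Data × Data) × Data) × Data => x.1) (by fun_prop)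
  refine PPTF.bind h1 (PPTF.map
    (α := ((ℕ × ℕ × List Bool) × (Data × Data × Data × Data) × Data × Data × Data) × Data)
    (F := fun x => Z.sim₂ x.1.1.1 x.1.2.1.1 x.1.2.1.2.1 (doubleStatement x.1.2.1.2.2.1
      (_root_.overwrite (len x.1.1.1) x.1.1.2.1 (!x.1.1.2.2.getD x.1.1.2.1 false) x.1.2.2.1 x.2)
      x.1.2.2.2.1))
    (h := fun x π => Data.cons (.cons (_root_.overwrite (len x.1.1.1) x.1.1.2.1
      (!x.1.1.2.2.getD x.1.1.2.1 false) x.1.2.2.1 x.2) (.cons x.1.2.2.2.1 π)) x.1.2.1.2.2.2) ?_ ?_)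
  · refine hZ.sim₂.comp (g := fun x : ((ℕ × ℕ × List Bool) × (Data × Data × Data × Data) ×
      Data × Data × Data) × Data => (x.1.1.1, x.1.2.1.1, x.1.2.1.2.1, doubleStatement
        x.1.2.1.2.2.1 (_root_.overwrite (len x.1.1.1) x.1.1.2.1 (!x.1.1.2.2.getD x.1.1.2.1 false)
          x.1.2.2.1 x.2) x.1.2.2.2.1)) ?_
    simp only [doubleStatement]
    fun_prop
  · fun_prop

/-- Hybrids `j` and `j + 1` differ only at the position `(j, 1 - z j)`, which encrypts `m j` in the
former and its negation in the latter. These are the two plaintexts that the reduction submits; all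
other ciphertexts are its own. -/
theorem enc_bind_abeChal {κ : ℕ} (j : Fin (len κ)) (z : Fin (len κ) → Bool) (β : Bool)
    (crs td pks msk X m : Data) :
    ((S.enc κ ((pks.nth j).sel (!z j)) X (m.toBits.getD j false ^^ β)).bind fun a =>
      abeChal S Z len κ j (List.ofFn z) crs td pks msk a X m) =
    chalBits S Z len κ crs td pks msk X
      (hybBits (if β then j + 1 else j) (List.ofFn z) m.toBits) := by
  have hz : (List.ofFn z).getD j false = z j := by simp
  rw [chalBits, sampleVec_samplePair_overwrite j (!z j) _
    (fun i b => S.enc κ ((pks.nth i).sel b) X (hybBits j (List.ofFn z) m.toBits i b)),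
    PMF.bind_bind]
  · have hb : hybBits (if β then j + 1 else j) (List.ofFn z) m.toBits j (!z j) =
        (m.toBits.getD j false ^^ β) := by
      have h1 : Nat.ble (j + 1) j = false := by
        rw [Bool.eq_false_iff, Ne, Nat.ble_eq]
        omega
      have h2 : Nat.ble (j + 1) (j + 1) = true := by rw [Nat.ble_eq]
      rw [hybBits, hz]
      cases β <;> simp [h1, h2]
    rw [hb]
    congr 1
    funext a
    simp only [abeChal, PMF.bind_map, hz]
    congr 1
    funext ct
    simp only [Function.comp_apply, overwrite_vec_pair]
    rfl
  · intro i b hib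
    congr 1
    rw [hybBits, hybBits]
    have hz' : (List.ofFn z).getD i false = z i := by simp
    rw [hz']
    -- At a revealed position nothing is ever exchanged. At an unrevealed one the index is not `j`,
    -- and for such an index `i < j` and `i < j + 1` mean the same.
    by_cases hb : b = z i
    · simp [hb]
    · have hij : (i : ℕ) ≠ j := fun e => hib ⟨Fin.ext e, by
        rw [← Fin.ext e]
        cases b <;> cases h : z i <;> simp_all⟩
      have : Nat.ble (i + 1) (if β then j + 1 else j) = Nat.ble (i + 1) j := by
        rw [Bool.eq_iff_iff, Nat.ble_eq, Nat.ble_eq]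
        split_ifs <;> omega
      rw [this]

end

/-! ### The reduction to IND-CPA security of the bit scheme -/

section
variable {Q : PolicyClass} {len : ℕ → ℕ} {S : ABE} {O : Obfuscator} {N : NIZK}
  {Z : NIZKSimulator} {D : DecCircuits}

/-- The query to the challenger of the encryption scheme. -/
def abeQuery (j : ℕ) (q : Data) : Data :=
  if q.hd.toBool then
    .cons (.ofBool true) (.cons q.tl.hd (.cons (.ofBool (q.tl.tl.toBits.getD j false))
      (.ofBool !q.tl.tl.toBits.getD j false)))
  else q

theorem PF.abeQuery {α : Type} [Enc α] {j : α → ℕ} {q : α → Data} (hj : PF j) (hq : PF q) :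
    PF fun a => abeQuery (j a) (q a) := by
  unfold _root_.abeQuery
  fun_prop

/-- The fixed data of the reduction to the security of the encryption scheme. -/
def abeData (A : Adversary) (κ : ℕ) {n : ℕ} (k : Fin n → Bool → Data × Data) (z : Fin n → Bool)
    (t : Data × Data) (j : ℕ) : Data :=
  .cons (A.advice κ) (.cons (.cons t.1 t.2) (.cons (ncPks k) (.cons (ncMsks k)
    (.cons (ncSel k z) (.cons (.ofNat j) (ncBits z))))))

/-- The index and the bits `z` in the data of the reduction. -/
def abeIndex (c : Data) : ℕ := c.tl.tl.tl.tl.tl.hd.toNat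

def abeBits (c : Data) : List Bool := c.tl.tl.tl.tl.tl.tl.toBits

/-- The public keys that the reduction uses, where `a` comes from the challenger. -/
def abePks (len : ℕ → ℕ) (κ : ℕ) (c a : Data) : Data :=
  overwrite (len κ) (abeIndex c) (!(abeBits c).getD (abeIndex c) false) a c.tl.tl.hd

/-- The answers of the reduction to the security of the encryption scheme. -/
noncomputable def abePost (S : ABE) (Z : NIZKSimulator) (O : Obfuscator) (D : DecCircuits)
    (len : ℕ → ℕ) (κ : ℕ) (c pks q a : Data) : PMF Data :=
  if q.hd.toBool then
    abeChal S Z len κ (abeIndex c) (abeBits c) c.tl.hd.hd c.tl.hd.tl pks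
      (.cons (.cons pks c.tl.hd.hd) (.cons c.tl.tl.tl.tl.hd c.tl.tl.tl.tl.tl.tl)) a q.tl.hd q.tl.tl
  else
    abeKey S O D len κ (abeIndex c) (!(abeBits c).getD (abeIndex c) false)
      (.cons pks c.tl.hd.hd) c.tl.tl.tl.hd a q.tl

theorem PPTF.abePost (hlen : PF fun κ : ℕ => len κ) (hS : S.Efficient) (hO : O.Efficient)
    (hZ : Z.Efficient) (hD : D.Implement S N Q len) :
    PPTF fun x : ℕ × Data × Data × Data × Data =>
      abePost S Z O D len x.1 x.2.1 x.2.2.1 x.2.2.2.1 x.2.2.2.2 := by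
  have h1 := (PPTF.abeChal hlen hS hZ).comp (g := fun x : ℕ × Data × Data × Data × Data =>
    ((x.1, abeIndex x.2.1, abeBits x.2.1), (x.2.1.tl.hd.hd, x.2.1.tl.hd.tl, x.2.2.1,
      (.cons (.cons x.2.2.1 x.2.1.tl.hd.hd)
        (.cons x.2.1.tl.tl.tl.tl.hd x.2.1.tl.tl.tl.tl.tl.tl))),
      x.2.2.2.2, x.2.2.2.1.tl.hd, x.2.2.2.1.tl.tl)) (by unfold abeIndex abeBits; fun_prop)
  have h2 := (PPTF.abeKey hlen hS hO hD).comp (g := fun x : ℕ × Data × Data × Data × Data =>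
    (x.1, abeIndex x.2.1, !(abeBits x.2.1).getD (abeIndex x.2.1) false,
      Data.cons x.2.2.1 x.2.1.tl.hd.hd, x.2.1.tl.tl.tl.hd, x.2.2.2.2, x.2.2.2.1.tl))
    (by unfold abeIndex abeBits; fun_prop)
  exact PPTF.cases (c := fun x : ℕ × Data × Data × Data × Data => x.2.2.2.1.hd.toBool)
    (by fun_prop) h1 h2

theorem PF.abePks (hlen : PF fun κ : ℕ => len κ) {α : Type} [Enc α] {κ : α → ℕ} {c a : α → Data}
    (hκ : PF κ) (hc : PF c) (ha : PF a) : PF fun x => abePks len (κ x) (c x) (a x) := by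
  refine PF.overwrite (α := α) (n := fun x => len (κ x)) (hlen.comp hκ) ?_ ?_ ha ?_
  · unfold abeIndex
    fun_prop
  · unfold abeIndex abeBits
    fun_prop
  · fun_prop

/-- The game with left keys, simulated proofs, and `j` exchanged ciphertexts. -/
noncomputable def hybPlay (Q : PolicyClass) (len : ℕ → ℕ) (S : ABE) (N : NIZK)
    (Z : NIZKSimulator) (O : Obfuscator) (D : DecCircuits) (A : Adversary) (κ j : ℕ)
    (k : Fin (len κ) → Bool → Data × Data) (z : Fin (len κ) → Bool) (t : Data × Data) : PMF Bool :=
  play Q κ (validMsg len κ) A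
    ((ncabe S N Z O D len).fakeSK κ (ncPk k t.1) (ncAux k t.1 .nil z))
    (fun X m => chalBits S Z len κ t.1 t.2 (ncPks k) (ncMsk k t.1 z) X
      (hybBits j (List.ofFn z) m.toBits)) (ncPk k t.1)

theorem abePks_abeData (A : Adversary) {κ : ℕ} (k : Fin (len κ) → Bool → Data × Data)
    (z : Fin (len κ) → Bool) (t : Data × Data) (j : Fin (len κ)) (a : Data × Data) :
    abePks len κ (abeData A κ k z t j) a.1 = ncPks (updatePair j (!z j) a k) := by
  rw [ncPks_updatePair, abePks]
  simp only [abeData, abeIndex, abeBits, ncBits, Data.tl_cons, Data.hd_cons, Data.toNat_ofNat,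
    Data.toBits_ofBits]
  simp

theorem abePost_key (A : Adversary) {κ : ℕ} (k : Fin (len κ) → Bool → Data × Data)
    (z : Fin (len κ) → Bool) (t : Data × Data) (j : Fin (len κ)) (pks a : Data) {q : Data}
    (hq : q.hd.toBool = false) :
    abePost S Z O D len κ (abeData A κ k z t j) pks q a =
      abeKey S O D len κ j (!z j) (.cons pks t.1) (ncMsks k) a q.tl := by
  have hz : (List.ofFn z).getD j false = z j := by simp
  rw [abePost, if_neg (by simp [hq])]
  simp only [abeData, abeIndex, abeBits, ncBits, Data.tl_cons, Data.hd_cons, Data.toNat_ofNat,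
    Data.toBits_ofBits, hz]

theorem abePost_chal (A : Adversary) {κ : ℕ} (k : Fin (len κ) → Bool → Data × Data)
    (z : Fin (len κ) → Bool) (t : Data × Data) (j : Fin (len κ)) (pks a : Data) {q : Data}
    (hq : q.hd.toBool = true) :
    abePost S Z O D len κ (abeData A κ k z t j) pks q a =
      abeChal S Z len κ j (List.ofFn z) t.1 t.2 pks
        (.cons (.cons pks t.1) (.cons (ncSel k z) (ncBits z))) a q.tl.hd q.tl.tl := by
  rw [abePost, if_pos hq]
  simp only [abeData, abeIndex, abeBits, ncBits, Data.tl_cons, Data.hd_cons, Data.toNat_ofNat,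
    Data.toBits_ofBits]

theorem abeQuery_of_key {q : Data} (h : q.hd.toBool = false) (j : ℕ) : abeQuery j q = q :=
  if_neg (by simp [h])

theorem abeQuery_of_challenge {q : Data} (h : q.hd.toBool = true) (j : ℕ) :
    abeQuery j q = .cons (.ofBool true) (.cons q.tl.hd
      (.cons (.ofBool (q.tl.tl.toBits.getD j false)) (.ofBool !q.tl.tl.toBits.getD j false))) :=
  if_pos h

theorem queried_cons_abeQuery (j : ℕ) (q : Data) (log : List Data) :
    queried (abeQuery j q :: log) = queried (q :: log) := by
  cases h : q.hd.toBool
  · rw [abeQuery_of_key h]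
  · rw [abeQuery_of_challenge h]
    exact (if_pos h).symm

theorem target_cons_abeQuery (j : ℕ) (q : Data) (log : List Data) :
    target (abeQuery j q :: log) = target (q :: log) := by
  cases h : q.hd.toBool
  · rw [abeQuery_of_key h]
  · rw [abeQuery_of_challenge h]
    exact (if_pos h).symm

/-- The translated query keeps the attribute or the policy, and legality involves the plaintext only
through `valid`, which is trivial for the bit scheme. Hence every query that the large game admits
is answered by the inner challenger. -/
theorem legalLog_abeQuery {κ : ℕ} {valid : Data → Bool} {log : List Data} {q : Data} (j : ℕ)
    (h : legalLog Q κ valid log q = true) :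
    legalLog Q κ (fun _ => true) log (abeQuery j q) = true := by
  cases hq : q.hd.toBool
  · rw [abeQuery_of_key hq]
    rw [legalLog, if_neg (by simp [hq])] at h ⊢
    exact h
  · rw [abeQuery_of_challenge hq, legalLog]
    rw [legalLog, if_pos hq] at h
    simp only [Bool.and_eq_true, Data.tl_cons, Data.hd_cons, Data.toBool_ofBool, if_true,
      and_true] at h ⊢
    exact ⟨h.1.1, h.2⟩

theorem logOk_nil : LogOk [] := trivial

theorem challenger_reply (β : Bool) {κ : ℕ} {valid : Data → Bool} (a : Data × Data)
    {log : List Data} (hl : LogOk log) {q : Data} (j : ℕ) (h : legalLog Q κ valid log q = true) :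
    (S.challenger Q β κ).reply (a, queried log, target log) (abeQuery j q) =
      (if q.hd.toBool then S.enc κ a.1 q.tl.hd (q.tl.tl.toBits.getD j false ^^ β)
        else S.keyGen κ a.2 q.tl).map fun x =>
          ((a, queried (q :: log), target (q :: log)), .cons .nil x) := by
  refine (adaptiveChallenger_reply Q κ (fun _ => true) _ _ _ a hl (abeQuery j q)).trans ?_
  rw [if_pos (legalLog_abeQuery j h), queried_cons_abeQuery, target_cons_abeQuery]
  refine congrArg _ ?_
  cases hq : q.hd.toBool
  · rw [abeQuery_of_key hq]
    simp [hq, answer]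
  · rw [abeQuery_of_challenge hq, answer]
    simp only [Data.hd_cons, Data.tl_cons, Data.toBool_ofBool, if_true]
    cases β <;> cases q.tl.tl.toBits.getD j false <;> rfl

/-- For fixed key pairs, `z`, reference string with trapdoor and index `j`, the challenge bit `β`
decides between hybrids `j` and `j + 1`, in which the pair at `(j, 1 - z j)` is the challenger's.
The invariant says that the inner challenger has seen exactly the policies and the target of the
log. -/
theorem abe_compRun (A : Adversary) {κ : ℕ} (k : Fin (len κ) → Bool → Data × Data)
    (z : Fin (len κ) → Bool) (t : Data × Data) (j : Fin (len κ)) (β : Bool) :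
    compRun Q κ (validMsg len κ) A
      (fun c q => PMF.pure (abeQuery (abeIndex c.hd.tl) q, .nil))
      (fun c q _ a => abePost S Z O D len c.hd.hd.toNat c.hd.tl
        (abePks len c.hd.hd.toNat c.hd.tl c.tl) q a.tl)
      (fun c => .cons c.hd.hd (.cons c.hd.tl.hd
        (.cons (abePks len c.hd.hd.toNat c.hd.tl c.tl) c.hd.tl.tl.hd.hd)))
      (S.challenger Q β κ) (.cons (.ofNat κ) (abeData A κ k z t j)) (A.bound.eval κ) []
      (A.qadvice κ) =
    (S.setup κ).bind fun a => hybPlay Q len S N Z O D A κ (if β then j + 1 else j)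
      (updatePair j (!z j) a k) z t := by
  have hidx : abeIndex (abeData A κ k z t j) = j := by
    simp [abeIndex, abeData]
  refine (compRun_eq A (B := S.challenger Q β κ) (fun c => .cons c.hd.hd (.cons c.hd.tl.hd
      (.cons (abePks len c.hd.hd.toNat c.hd.tl c.tl) c.hd.tl.tl.hd.hd)))
    _ _ _ _ (S.setup κ) (fun a => ((a, [], none), a.1)) (PMF.map_comp _ _ _)
    (fun a => (ncabe S N Z O D len).fakeSK κ (ncPk (updatePair j (!z j) a k) t.1)
      (ncAux (updatePair j (!z j) a k) t.1 .nil z))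
    (fun a X m => chalBits S Z len κ t.1 t.2 (ncPks (updatePair j (!z j) a k))
      (ncMsk (updatePair j (!z j) a k) t.1 z) X
      (hybBits (if β then j + 1 else j) (List.ofFn z) m.toBits))
    (fun a log (s : (Data × Data) × List Data × Option Data) =>
      LogOk log ∧ s = (a, queried log, target log))
    (fun a => ⟨logOk_nil, rfl⟩) fun a log s hs q hq => ?_).trans ?_
  · obtain ⟨hl, rfl⟩ := hs
    have hrep := challenger_reply (S := S) β a hl (j : ℕ) hq
    simp only [Data.hd_cons, Data.tl_cons, Data.toNat_ofNat, hidx, PMF.pure_bind, abePks_abeData]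
    refine ⟨?_, fun y hy r hr => ?_⟩
    · rw [hrep]
      refine (PMF.bind_map _ _ _).trans ?_
      change (PMF.bind (if q.hd.toBool then
          S.enc κ a.1 q.tl.hd (q.tl.tl.toBits.getD j false ^^ β) else S.keyGen κ a.2 q.tl)
        fun x => abePost S Z O D len κ (abeData A κ k z t j) (ncPks (updatePair j (!z j) a k)) q
          x) = _
      cases hc : q.hd.toBool
      · simp only [abePost_key A k z t j _ _ hc, answer, hc, Bool.false_eq_true, if_false]
        exact keyGen_bind_abeKey j z k a t.1 q.tl
      · simp only [abePost_chal A k z t j _ _ hc, answer, hc, if_true]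
        have h1 : ((ncPks (updatePair j (!z j) a k)).nth j).sel (!z j) = a.1 := by
          rw [ncPks, Data.nth_vec, Data.sel_pair, updatePair, if_pos ⟨rfl, rfl⟩]
        have h2 := enc_bind_abeChal (S := S) (Z := Z) j z β t.1 t.2
          (ncPks (updatePair j (!z j) a k))
          (ncMsk (updatePair j (!z j) a k) t.1 z) q.tl.hd q.tl.tl
        rw [h1] at h2
        rw [← h2, ncMsk, ncSel_updatePair]
        rfl
    · obtain rfl := (PMF.mem_support_pure_iff _ _).1 hy
      rw [hrep] at hr
      obtain ⟨x, -, rfl⟩ := (PMF.mem_support_map_iff _ _ _).1 hr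
      exact ⟨hl.cons hq, rfl⟩
  · refine congrArg _ (funext fun a => ?_)
    simp only [Data.hd_cons, Data.tl_cons, Data.toNat_ofNat, abePks_abeData]
    rfl

end

/-! ### Summation over the hybrids -/

section
variable {Q : PolicyClass} {len : ℕ → ℕ} {S : ABE} {O : Obfuscator} {N : NIZK}
  {Z : NIZKSimulator} {D : DecCircuits}

theorem ABE.Efficient.polyBounded (hS : S.Efficient) (Q : PolicyClass) (b : Bool) :
    PolyBounded (S.challenger Q b) := by
  obtain ⟨ps, hs⟩ := hS.setup.size_bound
  obtain ⟨pk, hk⟩ := hS.keyGen.size_bound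
  obtain ⟨pe, he⟩ := hS.enc.size_bound
  let s : Polynomial ℕ := ps.comp (2 * .X + 1)
  have hs' : ∀ κ, ∀ x ∈ (S.setup κ).support, x.1.size + x.2.size ≤ s.eval κ := by
    intro κ x hx
    have := hs κ x hx
    simp only [esize_prod, esize_data, esize_nat] at this
    simp only [s, Polynomial.eval_comp, Polynomial.eval_add, Polynomial.eval_mul,
      Polynomial.eval_X, Polynomial.eval_ofNat, Polynomial.eval_one]
    omega
  clear_value s
  let l : Polynomial ℕ := 4 * .X + s + 8
  have hl : ∀ n, l.eval n = 4 * n + s.eval n + 8 := fun n => by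
    simp only [l, Polynomial.eval_add, Polynomial.eval_mul, Polynomial.eval_X,
      Polynomial.eval_ofNat]
  have hg : ∀ n, (s + pk.comp l + pe.comp l + 2).eval n =
      s.eval n + pk.eval (l.eval n) + pe.eval (l.eval n) + 2 := fun n => by
    simp only [Polynomial.eval_add, Polynomial.eval_comp, Polynomial.eval_ofNat]
  refine ⟨s + pk.comp l + pe.comp l + 2,
    fun κ (s : (Data × Data) × List Data × Option Data) => s.1 ∈ (S.setup κ).support,
    fun κ => ⟨fun x hx => ?_, fun x hx q r hr => ?_⟩⟩
  · obtain ⟨y, hy, rfl⟩ := (PMF.mem_support_map_iff _ _ _).1 hx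
    obtain ⟨a, ha, rfl⟩ := (PMF.mem_support_map_iff _ _ _).1 hy
    refine ⟨ha, ?_⟩
    have := hs' κ a ha
    rw [hg]
    simp only
    omega
  · obtain ⟨a, log, tar⟩ := x
    change a ∈ (S.setup κ).support at hx
    have h1 := hs' κ a hx
    have h2 := q.size_tl_le
    have h3 := q.tl.size_hd_le
    have h5 := s.eval_mono_nat (Nat.le_add_right κ q.size)
    rw [hg]
    simp only [ABE.challenger, adaptiveChallenger] at hr
    split_ifs at hr
    · obtain ⟨c, hc, rfl⟩ := (PMF.mem_support_map_iff _ _ _).1 hr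
      refine ⟨hx, ?_⟩
      have h6 := he (κ, a.1, q.tl.hd, (Data.sel b q.tl.tl).toBool) c hc
      have h7 : ∀ x : Bool, esize x ≤ 3 := by decide
      have h8 := h7 (Data.sel b q.tl.tl).toBool
      have h9 := pe.eval_mono_nat (a := esize (κ, a.1, q.tl.hd, (Data.sel b q.tl.tl).toBool))
        (b := l.eval (κ + q.size)) (by
          rw [hl]
          simp only [esize_prod, esize_nat, esize_data]
          omega)
      simp only [esize_data] at h6
      simp only [Data.ofOption, Data.size]
      omega
    · obtain rfl := (PMF.mem_support_pure_iff _ _).1 hr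
      refine ⟨hx, ?_⟩
      simp only [Data.ofOption, Data.size]
      omega
    · obtain ⟨c, hc, rfl⟩ := (PMF.mem_support_map_iff _ _ _).1 hr
      refine ⟨hx, ?_⟩
      have h6 := hk (κ, a.2, q.tl) c hc
      have h9 := pk.eval_mono_nat (a := esize (κ, a.2, q.tl)) (b := l.eval (κ + q.size)) (by
          rw [hl]
          simp only [esize_prod, esize_nat, esize_data]
          omega)
      simp only [esize_data] at h6
      simp only [Data.ofOption, Data.size]
      omega
    · obtain rfl := (PMF.mem_support_pure_iff _ _).1 hr
      refine ⟨hx, ?_⟩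
      simp only [Data.ofOption, Data.size]
      omega

/-- The experiment with left keys, simulated proofs, and `j` exchanged ciphertexts. -/
noncomputable def hybRun (Q : PolicyClass) (len : ℕ → ℕ) (S : ABE) (N : NIZK) (Z : NIZKSimulator)
    (O : Obfuscator) (D : DecCircuits) (A : Adversary) (κ j : ℕ) : PMF Bool :=
  (ncKeys S len κ).bind fun k => (PMF.uniformOfFintype (Fin (len κ) → Bool)).bind fun z =>
    (Z.sim₁ κ).bind fun t => hybPlay Q len S N Z O D A κ j k z t

/-- The position that is overwritten depends on `z`, so `z` is drawn first. The challenger's key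
pair comes last, because everything before it is going to be fixed. -/
theorem hybRun_eq (A : Adversary) (κ i : ℕ) (j : Fin (len κ)) :
    hybRun Q len S N Z O D A κ i = (PMF.uniformOfFintype (Fin (len κ) → Bool)).bind fun z =>
      (ncKeys S len κ).bind fun k => (Z.sim₁ κ).bind fun t => (S.setup κ).bind fun a =>
        hybPlay Q len S N Z O D A κ i (updatePair j (!z j) a k) z t := by
  rw [hybRun, PMF.bind_comm]
  refine congrArg _ (funext fun z => ?_)
  rw [ncKeys_bind_overwrite j (!z j)]
  refine congrArg _ (funext fun k => ?_)
  exact PMF.bind_comm _ _ _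

/-- The two instances of the reduction to the security of the encryption scheme. -/
noncomputable def abeRun (Q : PolicyClass) (len : ℕ → ℕ) (S : ABE) (Z : NIZKSimulator)
    (O : Obfuscator) (D : DecCircuits) (A : Adversary) (κ : ℕ) (d : Data) (β : Bool) : PMF Bool :=
  compRun Q κ (validMsg len κ) A
    (fun c q => PMF.pure (abeQuery (abeIndex c.hd.tl) q, .nil))
    (fun c q _ a => abePost S Z O D len c.hd.hd.toNat c.hd.tl
      (abePks len c.hd.hd.toNat c.hd.tl c.tl) q a.tl)
    (fun c => .cons c.hd.hd (.cons c.hd.tl.hd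
      (.cons (abePks len c.hd.hd.toNat c.hd.tl c.tl) c.hd.tl.tl.hd.hd)))
    (S.challenger Q β κ) (.cons (.ofNat κ) d) (A.bound.eval κ) [] (A.qadvice κ)

/-- The telescoping sum selects an index `j` for each `κ`, at the price of a factor `len κ`.
Averaging then fixes `z` with loss 2, and the key pairs and the simulated reference string with its
trapdoor with loss 4. All of this, including `j`, goes into the advice. The polynomial `p` bounds
both the size of the advice and the total factor `8 * len κ`. -/
theorem exists_hybRun_sub_le (hlen : PF fun κ : ℕ => len κ) (hS : S.Efficient)
    (hZ : Z.Efficient) (A : Adversary) :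
    ∃ p : Polynomial ℕ, ∀ κ, ∃ d : Data, d.size ≤ p.eval κ ∧
      |prT (hybRun Q len S N Z O D A κ 0) - prT (hybRun Q len S N Z O D A κ (len κ))| ≤
        (p.eval κ : ℕ) * |prT (abeRun Q len S Z O D A κ d false) -
          prT (abeRun Q len S Z O D A κ d true)| := by
  obtain ⟨p, hp⟩ := exists_ncKeys_bound hlen hS
  obtain ⟨ps, hs⟩ := hZ.sim₁.size_bound
  refine ⟨A.bound + ps.comp (2 * .X + 1) + 8 * p + 20, fun κ => ?_⟩
  have hev : (A.bound + ps.comp (2 * .X + 1) + 8 * p + 20).eval κ =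
      A.bound.eval κ + ps.eval (2 * κ + 1) + 8 * p.eval κ + 20 := by
    simp only [Polynomial.eval_add, Polynomial.eval_comp, Polynomial.eval_mul, Polynomial.eval_X,
      Polynomial.eval_ofNat, Polynomial.eval_one]
  rw [hev]
  -- For empty plaintexts there is only one hybrid, and no index can be selected.
  rcases Nat.eq_zero_or_pos (len κ) with h0 | h0
  · refine ⟨.nil, by simp only [Data.size]; omega, ?_⟩
    rw [h0, sub_self, abs_zero]
    positivity
  obtain ⟨j, hj, h1⟩ := exists_abs_sub_le_mul
    (fun j => prT (hybRun Q len S N Z O D A κ j)) (len κ) h0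
  obtain ⟨z, -, h2⟩ := exists_prT_bind_sub_le (PMF.uniformOfFintype (Fin (len κ) → Bool))
    (fun z => (ncKeys S len κ).bind fun k => (Z.sim₁ κ).bind fun t => (S.setup κ).bind fun a =>
      hybPlay Q len S N Z O D A κ j (updatePair ⟨j, hj⟩ (!z ⟨j, hj⟩) a k) z t)
    (fun z => (ncKeys S len κ).bind fun k => (Z.sim₁ κ).bind fun t => (S.setup κ).bind fun a =>
      hybPlay Q len S N Z O D A κ (j + 1) (updatePair ⟨j, hj⟩ (!z ⟨j, hj⟩) a k) z t)
  obtain ⟨k, hk, t, ht, h3⟩ := prT_bind_bind_sub_le (ncKeys S len κ) (Z.sim₁ κ)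
    (fun k t => (S.setup κ).bind fun a =>
      hybPlay Q len S N Z O D A κ j (updatePair ⟨j, hj⟩ (!z ⟨j, hj⟩) a k) z t)
    (fun k t => (S.setup κ).bind fun a =>
      hybPlay Q len S N Z O D A κ (j + 1) (updatePair ⟨j, hj⟩ (!z ⟨j, hj⟩) a k) z t)
  obtain ⟨hl, hb⟩ := hp κ
  obtain ⟨-, b1, b2, b3, b4⟩ := hb k hk z
  refine ⟨abeData A κ k z t j, ?_, ?_⟩
  · have b5 := A.advice_le κ
    have b6 := hs κ t ht
    simp only [esize_prod, esize_data, esize_nat] at b6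
    simp only [abeData, Data.size, Data.size_ofNat]
    omega
  · have e1 := abe_compRun (Q := Q) (S := S) (Z := Z) (O := O) (D := D) (N := N) A k z t
      ⟨j, hj⟩ false
    have e2 := abe_compRun (Q := Q) (S := S) (Z := Z) (O := O) (D := D) (N := N) A k z t
      ⟨j, hj⟩ true
    simp only [Bool.false_eq_true, if_false, if_true] at e1 e2
    rw [← e1, ← e2] at h3
    rw [← hybRun_eq, ← hybRun_eq] at h2
    have h4 := h2.trans (mul_le_mul_of_nonneg_left h3 zero_le_two)
    refine h1.trans ((mul_le_mul_of_nonneg_left h4 (Nat.cast_nonneg _)).trans ?_)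
    change _ ≤ _ * |prT (compRun _ _ _ _ _ _ _ _ _ _ _ _) - prT (compRun _ _ _ _ _ _ _ _ _ _ _ _)|
    rw [← mul_assoc, ← mul_assoc]
    refine mul_le_mul_of_nonneg_right ?_ (abs_nonneg _)
    have h5 : len κ * 2 * 4 ≤ A.bound.eval κ + ps.eval (2 * κ + 1) + 8 * p.eval κ + 20 := by omega
    exact_mod_cast h5

/-- The ciphertexts that cannot be decrypted with the revealed keys may be exchanged. -/
theorem hybrids_indist (hQ : Q.Efficient) (hlen : PF fun κ : ℕ => len κ) (hS : S.Efficient)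
    (hcpa : S.INDCPA Q) (hO : O.Efficient) (hZ : Z.Efficient) (hD : D.Implement S N Q len)
    (A : Adversary) :
    Negligible fun κ => |prT (hybRun Q len S N Z O D A κ 0) -
      prT (hybRun Q len S N Z O D A κ (len κ))| := by
  obtain ⟨p, hp⟩ := exists_hybRun_sub_le (Q := Q) (N := N) (O := O) (D := D) hlen hS hZ A
  choose d hd hdiff using hp
  have hpks : PF fun x : Data => abePks len x.hd.hd.toNat x.hd.tl x.tl :=
    PF.abePks hlen (by fun_prop) (by fun_prop) (by fun_prop)
  have h := compGame_indist hQ (PF.validMsg hlen) A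
    (pre := fun c q => PMF.pure (abeQuery (abeIndex c.hd.tl) q, .nil))
    (post := fun c q _ a => abePost S Z O D len c.hd.hd.toNat c.hd.tl
      (abePks len c.hd.hd.toNat c.hd.tl c.tl) q a.tl)
    (PPTF.pure (PF.prodMk (PF.abeQuery (α := Data × Data) (j := fun x => abeIndex x.1.hd.tl)
      (q := fun x => x.2) (by unfold abeIndex; fun_prop) (by fun_prop)) (PF.const Data.nil)))
    ((PPTF.abePost hlen hS hO hZ hD).comp (g := fun x : Data × Data × Data × Data =>
      (x.1.hd.hd.toNat, x.1.hd.tl, abePks len x.1.hd.hd.toNat x.1.hd.tl x.1.tl, x.2.1,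
        x.2.2.2.tl)) (by
          have := hpks.comp (g := fun x : Data × Data × Data × Data => x.1) (by fun_prop)
          fun_prop))
    (first := fun c => .cons c.hd.hd (.cons c.hd.tl.hd
      (.cons (abePks len c.hd.hd.toNat c.hd.tl c.tl) c.hd.tl.tl.hd.hd))) (by fun_prop)
    hcpa (hS.polyBounded Q false) (hS.polyBounded Q true) d (fun _ => []) p 1 hd
    (fun κ => by simp [Data.ofList, Data.size]) (fun κ => A.bound.eval κ) (fun κ => le_rfl)
    A.qadvice
  exact (h.poly_mul p fun _ => abs_nonneg _).mono hdiff

end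

/-! ### The real and the fake experiment -/

section
variable {Q : PolicyClass} {len : ℕ → ℕ} {S : ABE} {O : Obfuscator} {N : NIZK}
  {Z : NIZKSimulator} {D : DecCircuits}

theorem experiment_real (A : Adversary) (κ : ℕ) :
    A.experiment ((ncabe S N Z O D len).realChallenger Q len κ) κ =
      setupRun S N len κ fun k z crs => play Q κ (validMsg len κ) A
        ((ncabe S N Z O D len).keyGen κ (ncMsk k crs z))
        (chalReal S N len κ (ncPk k crs) (ncMsk k crs z)) (ncPk k crs) := by
  refine (experiment_adaptiveChallenger Q κ (validMsg len κ) A _ _ _).trans ?_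
  rw [PMF.bind_map]
  refine (PMF.bind_bind _ _ _).trans (congrArg _ (funext fun k => ?_))
  refine (PMF.bind_bind _ _ _).trans (congrArg _ (funext fun z => ?_))
  refine (PMF.bind_bind _ _ _).trans (congrArg _ (funext fun crs => ?_))
  exact PMF.pure_bind _ _

theorem chalBits_congr {κ : ℕ} {crs td pks msk X : Data} {e e' : ℕ → Bool → Bool}
    (h : ∀ i < len κ, ∀ b, e i b = e' i b) :
    chalBits S Z len κ crs td pks msk X e = chalBits S Z len κ crs td pks msk X e' := by
  have : ∀ (i : Fin (len κ)) b, e i b = e' i b := fun i b => h i i.2 b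
  simp only [chalBits, this]

/-- `fakeSK` reads only the master secret keys from the auxiliary information. The trapdoor and `z`
there may therefore be replaced by constants, which shows that `z` enters through the challenge
answer alone. -/
theorem experiment_fake (A : Adversary) (κ : ℕ) :
    A.experiment ((ncabe S N Z O D len).fakeChallenger Q len κ) κ =
      (ncKeys S len κ).bind fun k => (PMF.uniformOfFintype (Fin (len κ) → Bool)).bind fun z =>
        (Z.sim₁ κ).bind fun t => play Q κ (validMsg len κ) A
          ((ncabe S N Z O D len).fakeSK κ (ncPk k t.1) (ncAux k t.1 .nil fun _ => false))
          (fun X m => chalBits S Z len κ t.1 t.2 (ncPks k)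
            (ncMsk k t.1 fun i => z i ^^ m.toBits.getD i false) X
            fun i b => b != (List.ofFn z).getD i false) (ncPk k t.1) := by
  refine (experiment_adaptiveChallenger Q κ (validMsg len κ) A _ _ _).trans ?_
  rw [PMF.bind_map]
  refine (PMF.bind_bind _ _ _).trans (congrArg _ (funext fun k => ?_))
  refine (PMF.bind_bind _ _ _).trans (congrArg _ (funext fun z => ?_))
  refine (PMF.bind_bind _ _ _).trans (congrArg _ (funext fun t => ?_))
  refine (PMF.pure_bind _ _).trans (play_congr Q κ _ A _ (fun P => rfl) fun X m _ _ => ?_)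
  refine (PMF.bind_bind _ _ _).trans ?_
  have hz : ∀ i : Fin (len κ), ((ncBits z).nth i).toBool = (List.ofFn z).getD i false := by
    intro i
    rw [show (ncBits z).nth i = Data.ofBool (z i) by
      rw [ncBits, Data.ofBits, List.map_ofFn]
      exact Data.nth_vec _ i]
    simp
  have hsel : ncSel k (fun i => z i ^^ m.toBits.getD i false) =
      .vec fun i : Fin (len κ) => ((ncMsks k).nth i).sel
        (((ncBits z).nth i).toBool ^^ m.toBits.getD i false) := by
    refine congrArg Data.vec (funext fun i => ?_)
    rw [hz, ncMsks, Data.nth_vec, Data.sel_pair]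
    simp
  have hbits : ncBits (fun i : Fin (len κ) => z i ^^ m.toBits.getD i false) =
      .ofBits (List.ofFn fun i : Fin (len κ) =>
        ((ncBits z).nth i).toBool ^^ m.toBits.getD i false) := by
    refine congrArg (fun f => Data.ofBits (List.ofFn f)) (funext fun i => ?_)
    rw [hz]
    simp
  rw [chalBits, ncMsk, hsel, hbits]
  simp only [← hz]
  refine congrArg _ (funext fun ct => ?_)
  refine (PMF.bind_bind _ _ _).trans (congrArg _ (funext fun π => ?_))
  refine (PMF.pure_bind _ _).trans ?_
  exact PMF.pure_bind _ _

/-- In both experiments `z` is used for the challenge answer only and is drawn at that moment. In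
the last hybrid the bit at `(i, b)` is `m i ⊕ [b ≠ z i]`; with `z = z* ⊕ m` this becomes `[b ≠ z*
i]`, the bit of the fake ciphertext, and the revealed selection `z` becomes `z* ⊕ m`. The two
experiments are equal, not merely close. -/
theorem hybRun_len (A : Adversary) (κ : ℕ) :
    hybRun Q len S N Z O D A κ (len κ) =
      A.experiment ((ncabe S N Z O D len).fakeChallenger Q len κ) κ := by
  rw [experiment_fake, hybRun]
  refine congrArg _ (funext fun k => ?_)
  rw [PMF.bind_comm, PMF.bind_comm (PMF.uniformOfFintype (Fin (len κ) → Bool))]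
  refine congrArg _ (funext fun t => ?_)
  refine (play_lazy Q κ (validMsg len κ) A (PMF.uniformOfFintype (Fin (len κ) → Bool))
    ((ncabe S N Z O D len).fakeSK κ (ncPk k t.1) (ncAux k t.1 .nil fun _ => false)) _ _).trans
    (Eq.trans ?_ (play_lazy Q κ (validMsg len κ) A _ _ _ _).symm)
  refine play_congr Q κ _ A _ (fun P => rfl) fun X m _ _ => ?_
  -- The shift by `m` is possible because `z` is drawn after the adversary has fixed its challenge
  -- query.
  conv_lhs => rw [← uniform_xor fun i => m.toBits.getD i false, PMF.bind_map]
  refine congrArg _ (funext fun z => chalBits_congr fun i hi b => ?_)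
  have h1 : Nat.ble (i + 1) (len κ) = true := by rw [Nat.ble_eq]; omega
  simp only [hybBits, h1, Bool.true_and]
  have h2 : ∀ f : Fin (len κ) → Bool, (List.ofFn f).getD i false = f ⟨i, hi⟩ := by
    intro f; simp [hi]
  rw [h2, h2]
  cases m.toBits.getD i false <;> cases b <;> cases z ⟨i, hi⟩ <;> rfl

/-- Receiver non-committing security. -/
theorem ncabe_rncSecure (hQ : Q.Efficient) (hlen : PF fun κ : ℕ => len κ) (hS : S.Efficient)
    (hcorrect : S.PerfectlyCorrect Q) (hcpa : S.INDCPA Q) (hO : O.IsSecureObfuscator)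
    (hN : N.IsProofSystem Z (doubleRelation S Q len)) (hD : D.Implement S N Q len) :
    (ncabe S N Z O D len).RNCSecure Q len := by
  intro A
  obtain ⟨hNe, hZ, -, hsound, hzk⟩ := hN
  have h1 := keys_indist (Z := Z) hQ hlen hS hcorrect hO hNe hsound hD A
  have h2 := proofs_indist hQ hlen hS hO.1 hNe hZ hzk hD A
  have h3 := hybrids_indist hQ hlen hS hcpa hO.1 hZ hD A
  -- The three differences telescope: real keys against left keys, real against simulated proofs,
  -- and hybrid 0 against hybrid `len κ`, which equals the fake experiment.
  refine ((h1.add_abs h2).add_abs h3).mono fun κ => le_of_eq ?_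
  have e : ∀ (k : Fin (len κ) → Bool → Data × Data) z t, hybPlay Q len S N Z O D A κ 0 k z t =
      play Q κ (validMsg len κ) A
        ((ncabe S N Z O D len).fakeSK κ (ncPk k t.1) (ncAux k t.1 .nil z))
        (fun X m => chalWith S len κ (fun x _ => Z.sim₂ κ t.1 t.2 x) (ncPks k) (ncMsk k t.1 z) X
          m.toBits) (ncPk k t.1) := fun k z t => by
    simp only [chalWith_eq_chalBits κ t.1 t.2 _ _ _ (List.ofFn z)]
    rfl
  rw [pr_eq_prT, pr_eq_prT, experiment_real, ← hybRun_len]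
  unfold hybRun
  simp only [e]
  congr 1
  ring

end

theorem mainTheorem5
    (Q : PolicyClass) (hQ : Q.Efficient)
    (len : ℕ → ℕ) (hlen : PolyTime fun d => .ofNat (len d.toNat))
    (S : ABE) (hS : S.Efficient) (hcorrect : S.PerfectlyCorrect Q) (hcpa : S.INDCPA Q)
    (O : Obfuscator) (hO : O.IsSecureObfuscator)
    (N : NIZK) (Z : NIZKSimulator) (hN : N.IsProofSystem Z (doubleRelation S Q len))
    (D : DecCircuits) (hD : D.Implement S N Q len) :
    (ncabe S N Z O D len).Efficient ∧
    (ncabe S N Z O D len).PerfectlyCorrect Q len ∧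
    (ncabe S N Z O D len).RNCSecure Q len :=
  ⟨ncabe_efficient hlen hS hO.1 hN.1 hN.2.1 hD, ncabe_correct hcorrect hO.2.1 hN.2.2.1 hD,
    ncabe_rncSecure hQ (PF.of_len hlen) hS hcorrect hcpa hO hN hD⟩
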